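/- Work at the prime $2$. Let $\mathcal A$ be the mod $2$ Steenrod algebra and let $F_*\to\mathbb F_2$ be a resolution by graded free $\mathcal A$-modules, each $F_i$ having a homogeneous $\mathcal A$-basis $(r^*_{i,j})_j$ (with a chosen linear order on the indices $j$) with only finitely many elements in each degree. Let $X$ be a finite CW spectrum whose cells correspond to a homogeneous basis $(e_k^*)$ of $M=H^*(X;\mathbb F_2)$, linearly ordered so that elements of lower degree come first; write $\dim k=|e_k^*|$. (Only the $\mathcal A$-module $M$ matters; the statement holds for every finite-dimensional graded $\mathcal A$-module $M$ with such a basis.) For integers $m,n$ let $X_m^n$ be the truncation of $X$ to the cells of dimensions $m$ through $n$; its cohomology is $M_m^n=M^{\ge m}/M^{\ge n+1}$, with basis the classes of the $e_k^*$ with $m\le\dim k\le n$. For a graded $\mathcal A$-module $N$ let $C^{i,t}(N)=\mathrm{Hom}^t_{\mathcal A}(N\otimes_{\mathbb F_2}F_i,\mathbb F_2)$, where $\mathcal A$ acts diagonally through the Cartan formula and $\mathrm{Hom}^t$ denotes the maps that vanish outside internal degree $t$. For each $t$ this is a cochain complex in $i$. *Curtis tables.* Let $X_0\to X_1\to\cdots$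 be a complex of $\mathbb F_2$-vector spaces with ordered bases $\{x_{i,j}\}_j$. The leading term of a nonzero vector is the largest basis element occurring in it. A Curtis table consists of lists $L_i$ of items, each item of $L_i$ being a basis element $x_{i,j}$ (an untagged item) or a tag $x_{i,j}\leftarrow x_{i-1,k}$, such that (1) each basis element appears exactly once in the lists; (2) $x_{i,j}$ occurs in $L_i$ as an untagged item or as the left entry of a tag if and only if it is the leading term of a cocycle of $X_i$; (3) for each tag $a\leftarrow b$ in $L_i$ there is a vector of $X_{i-1}$ with leading term $b$ whose coboundary has leading term $a$. **Theorem.** Fix $m$, $n$ and $t$. 1. $C^{i,t}(M)$ and $C^{i,t}(M_m^n)$ have bases $\{e_k\otimes r_{i,j}\}$ dual to the elements $e_k^*\otimes r_{i,j}^*$ of degree $t$ (with $m\le\dim k\le n$ in the second case). With respect to these bases in lexicographic order, each of the complexes $C^{*,t}(M)$ and $C^{*,t}(M_m^n)$ has exactly one Curtis table; call these the tables of $X$ and of $X_m^n$. 2. The tags of the table of $X_m^n$ are exactly the tags $a\leftarrow b$ of the table of $X$ for which both $a$ and $b$ come from cells of dimensions $m$ through $n$ (the surviving tags). 3. The untagged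 items of the table of $X_m^n$ are exactly the elements $e_k\otimes r_{i,j}$ with $m\le\dim k\le n$ that appear in no surviving tag. They include all untagged items of the table of $X$ in this range, and possibly further ones. 4. Consequently the Adams $E_2$-page of $X_m^n$ can be read off from the table of $X$. Let $U^{s,t}$ be the set of elements $e_k\otimes r_{s,j}$ of internal degree $t$ with $m\le\dim k\le n$ that appear in no surviving tag. If for every $x\in U^{s,t}$ a cocycle $z_x\in C^{s,t}(M_m^n)$ with leading term $x$ is chosen, then the classes of the $z_x$ form a basis of $H^s(C^{*,t}(M_m^n))$. Moreover $E_2^{s,t}=\mathrm{Ext}^{s,t}_{\mathcal A}(M_m^n,\mathbb F_2)$, computed from any graded free resolution of $M_m^n$, is isomorphic to the $\mathbb F_2$-vector space with basis $U^{s,t}$. -/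

import Mathlib

open scoped TensorProduct DirectSum
open Module

noncomputable section

/-! ### The mod 2 Steenrod algebra -/

/-- Relations of the mod 2 Steenrod algebra on the generators `Sq^0, Sq^1, …`:
`Sq^0 = 1` and the Adem relations. In the latter `c ≤ a / 2 < b`, so that no subtraction truncates. -/
inductive AdemRel : FreeAlgebra (ZMod 2) ℕ → FreeAlgebra (ZMod 2) ℕ → Prop
  | sq_zero : AdemRel (FreeAlgebra.ι (ZMod 2) 0) 1
  | adem (a b : ℕ) (ha : 0 < a) (hab : a < 2 * b) :
      AdemRel (FreeAlgebra.ι (ZMod 2) a * FreeAlgebra.ι (ZMod 2) b)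
        (∑ c ∈ Finset.range (a / 2 + 1), (((b - c - 1).choose (a - 2 * c) : ℕ) : ZMod 2) •
          (FreeAlgebra.ι (ZMod 2) (a + b - c) * FreeAlgebra.ι (ZMod 2) c))

/-- The mod 2 Steenrod algebra `𝒜`. -/
def SteenrodAlgebra : Type := RingQuot AdemRel

namespace SteenrodAlgebra

instance : Ring SteenrodAlgebra := inferInstanceAs (Ring (RingQuot AdemRel))

instance : Algebra (ZMod 2) SteenrodAlgebra :=
  inferInstanceAs (Algebra (ZMod 2) (RingQuot AdemRel))

/-- The quotient map from the free algebra. -/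
def mk : FreeAlgebra (ZMod 2) ℕ →ₐ[ZMod 2] SteenrodAlgebra :=
  RingQuot.mkAlgHom (ZMod 2) AdemRel

/-- The Steenrod square `Sq^n`. -/
def Sq (n : ℕ) : SteenrodAlgebra := mk (FreeAlgebra.ι (ZMod 2) n)

theorem mk_surjective : Function.Surjective mk :=
  RingQuot.mkAlgHom_surjective (ZMod 2) AdemRel

/-- The augmentation `𝒜 → 𝔽₂`: `Sq^0 ↦ 1` and `Sq^n ↦ 0` for `n > 0`. -/
def augmentation : SteenrodAlgebra →ₐ[ZMod 2] ZMod 2 :=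
  RingQuot.liftAlgHom (ZMod 2)
    ⟨FreeAlgebra.lift (ZMod 2) (fun n : ℕ => if n = 0 then (1 : ZMod 2) else 0), by
      intro x y h
      cases h with
      | sq_zero => simp
      | adem a b ha hab =>
        have ha' : a ≠ 0 := ha.ne'
        simp only [map_mul, map_sum, map_smul, FreeAlgebra.lift_ι_apply, if_neg ha', zero_mul]
        symm
        apply Finset.sum_eq_zero
        intro c hc
        have hc' : c ≤ a / 2 := by simpa [Nat.lt_succ_iff] using hc
        have h0 : a + b - c ≠ 0 := by omega
        rw [if_neg h0, zero_mul, smul_zero]⟩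

/-- `𝔽₂` as the trivial `𝒜`-module. -/
instance : Module SteenrodAlgebra (ZMod 2) :=
  Module.compHom (ZMod 2) augmentation.toRingHom

theorem smul_zmod (a : SteenrodAlgebra) (x : ZMod 2) : a • x = augmentation a * x := rfl

instance : IsScalarTower (ZMod 2) SteenrodAlgebra (ZMod 2) where
  smul_assoc c a x := by
    simp only [smul_zmod, map_smul, smul_eq_mul, mul_assoc]

end SteenrodAlgebra

open SteenrodAlgebra (Sq)

/-- Prefer the inherited scalar multiplication on a subspace to the one that every abelian group
of exponent `2` carries (the two agree). -/
instance (priority := 2000) submoduleModuleZMod {V : Type*} [AddCommGroup V] [Module (ZMod 2) V]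
    (S : Submodule (ZMod 2) V) : Module (ZMod 2) S := S.module

/-- The same for an `𝒜`-submodule. -/
instance (priority := 2000) steenrodSubmoduleModuleZMod {V : Type*} [AddCommGroup V]
    [Module (ZMod 2) V] [Module SteenrodAlgebra V] [IsScalarTower (ZMod 2) SteenrodAlgebra V]
    (S : Submodule SteenrodAlgebra V) : Module (ZMod 2) S := S.module'

/-! ### Graded modules and truncations -/

section Graded

variable {M : Type*} [AddCommGroup M] [Module (ZMod 2) M] [Module SteenrodAlgebra M]

/-- The subspaces `𝓜 p`, `p ∈ ℤ`, make `M` a graded `𝒜`-module, with `Sq^i` of degree `i`. -/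
structure IsGradedSteenrodModule (𝓜 : ℤ → Submodule (ZMod 2) M) : Prop where
  isInternal : DirectSum.IsInternal 𝓜
  sq_smul_mem : ∀ (i : ℕ) (p : ℤ) (x : M), x ∈ 𝓜 p → Sq i • x ∈ 𝓜 (p + i)

/-- `M^{≥ m}`: the `𝒜`-submodule generated by the homogeneous elements of degree at least `m`.
As a vector space it is the sum of the `𝓜 p` with `m ≤ p`, see `degreeGE_eq_iSup`. -/
def degreeGE (𝓜 : ℤ → Submodule (ZMod 2) M) (m : ℤ) : Submodule SteenrodAlgebra M :=
  Submodule.span SteenrodAlgebra {x | ∃ p : ℤ, m ≤ p ∧ x ∈ 𝓜 p}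

theorem mem_degreeGE (𝓜 : ℤ → Submodule (ZMod 2) M) {m p : ℤ} (h : m ≤ p) {x : M}
    (hx : x ∈ 𝓜 p) : x ∈ degreeGE 𝓜 m :=
  Submodule.subset_span ⟨p, h, hx⟩

variable [IsScalarTower (ZMod 2) SteenrodAlgebra M]

theorem degreeGE_eq_iSup {𝓜 : ℤ → Submodule (ZMod 2) M} (h : IsGradedSteenrodModule 𝓜) (m : ℤ) :
    (degreeGE 𝓜 m).restrictScalars (ZMod 2) = ⨆ p : Set.Ici m, 𝓜 p := by
  apply le_antisymm
  · have key : ∀ (y : FreeAlgebra (ZMod 2) ℕ) (x : M), x ∈ (⨆ p : Set.Ici m, 𝓜 p) →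
        SteenrodAlgebra.mk y • x ∈ (⨆ p : Set.Ici m, 𝓜 p) := by
      intro y
      induction y using FreeAlgebra.induction with
      | grade0 r =>
        intro x hx
        rw [AlgHom.commutes, algebraMap_smul]
        exact Submodule.smul_mem _ _ hx
      | grade1 n =>
        intro x hx
        induction hx using Submodule.iSup_induction' with
        | mem p x hx =>
          have hp : m ≤ (p : ℤ) := p.2
          exact Submodule.mem_iSup_of_mem (⟨p + n, by simp only [Set.mem_Ici]; omega⟩ : Set.Ici m)
            (h.sq_smul_mem n p x hx)
        | zero => rw [smul_zero]; exact Submodule.zero_mem _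
        | add x y _ _ hx hy => rw [smul_add]; exact Submodule.add_mem _ hx hy
      | mul a b ha hb =>
        intro x hx
        rw [map_mul, mul_smul]
        exact ha _ (hb _ hx)
      | add a b ha hb =>
        intro x hx
        rw [map_add, add_smul]
        exact Submodule.add_mem _ (ha _ hx) (hb _ hx)
    intro x hx
    rw [Submodule.restrictScalars_mem] at hx
    induction hx using Submodule.span_induction with
    | mem x hx =>
      obtain ⟨p, hp, hx⟩ := hx
      exact Submodule.mem_iSup_of_mem (⟨p, hp⟩ : Set.Ici m) hx
    | zero => exact Submodule.zero_mem _
    | add x y _ _ hx hy => exact Submodule.add_mem _ hx hy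
    | smul a x _ hx =>
      obtain ⟨y, rfl⟩ := SteenrodAlgebra.mk_surjective a
      exact key y x hx
  · exact iSup_le fun p x hx => mem_degreeGE 𝓜 p.2 hx

/-- The truncation `M_m^n = M^{≥ m} / M^{≥ n + 1}` of a graded `𝒜`-module to the degrees `m, …, n`:
for `M = H^*(X)` this is the cohomology of the truncation `X_m^n`. -/
abbrev Truncation (𝓜 : ℤ → Submodule (ZMod 2) M) (m n : ℤ) : Type _ :=
  ↥(degreeGE 𝓜 m) ⧸ (degreeGE 𝓜 (n + 1)).submoduleOf (degreeGE 𝓜 m)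

/-- The grading of the truncation. -/
def truncationGrading (𝓜 : ℤ → Submodule (ZMod 2) M) (m n : ℤ) :
    ℤ → Submodule (ZMod 2) (Truncation 𝓜 m n) := fun p =>
  ((𝓜 p).comap ((degreeGE 𝓜 m).subtype.restrictScalars (ZMod 2))).map
    (((degreeGE 𝓜 (n + 1)).submoduleOf (degreeGE 𝓜 m)).mkQ.restrictScalars (ZMod 2))

/-- The cells in dimensions `m` through `n`. -/
abbrev CellsBetween {κ : Type*} (dim : κ → ℤ) (m n : ℤ) : Type _ :=
  {k : κ // m ≤ dim k ∧ dim k ≤ n}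

/-- The classes in the truncation of those given homogeneous elements `e k` of `M` whose degree
lies between `m` and `n`. -/
def truncationVec {κ : Type*} (𝓜 : ℤ → Submodule (ZMod 2) M) (e : κ → M) (dim : κ → ℤ)
    (he : ∀ k, e k ∈ 𝓜 (dim k)) (m n : ℤ) (k : CellsBetween dim m n) : Truncation 𝓜 m n :=
  Submodule.Quotient.mk ⟨e k, mem_degreeGE 𝓜 k.2.1 (he k)⟩

/-- `𝔽₂` concentrated in degree `0`. -/
def trivialGrading : ℤ → Submodule (ZMod 2) (ZMod 2) := fun p => if p = 0 then ⊤ else ⊥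

end Graded

/-! ### Graded free resolutions, and Ext -/

universe v w

set_option linter.checkUnivs false in
/-- A resolution `⋯ → F_1 → F_0 → N → 0` of a graded `𝒜`-module by graded free `𝒜`-modules, with
a chosen homogeneous `𝒜`-basis of each `F_i`. -/
structure GradedFreeResolution {N : Type*} [AddCommGroup N] [Module (ZMod 2) N]
    [Module SteenrodAlgebra N] (𝓝 : ℤ → Submodule (ZMod 2) N) where
  obj : ℕ → Type v
  [addCommGroup : ∀ i, AddCommGroup (obj i)]
  [moduleZMod : ∀ i, Module (ZMod 2) (obj i)]
  [module : ∀ i, Module SteenrodAlgebra (obj i)]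
  [isScalarTower : ∀ i, IsScalarTower (ZMod 2) SteenrodAlgebra (obj i)]
  grading : ∀ i, ℤ → Submodule (ZMod 2) (obj i)
  isGraded : ∀ i, IsGradedSteenrodModule (grading i)
  idx : ℕ → Type w
  gen : ∀ i, Basis (idx i) SteenrodAlgebra (obj i)
  deg : ∀ i, idx i → ℤ
  gen_mem : ∀ i j, gen i j ∈ grading i (deg i j)
  d : ∀ i, obj (i + 1) →ₗ[SteenrodAlgebra] obj i
  aug : obj 0 →ₗ[SteenrodAlgebra] N
  d_mem : ∀ i p x, x ∈ grading (i + 1) p → d i x ∈ grading i p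
  aug_mem : ∀ p x, x ∈ grading 0 p → aug x ∈ 𝓝 p
  exact : ∀ i, Function.Exact (d (i + 1)) (d i)
  exact_zero : Function.Exact (d 0) aug
  aug_surjective : Function.Surjective aug

attribute [instance] GradedFreeResolution.addCommGroup GradedFreeResolution.moduleZMod
  GradedFreeResolution.module GradedFreeResolution.isScalarTower

section Cohomology

variable {X : ℕ → Type*} [∀ i, AddCommGroup (X i)] [∀ i, Module (ZMod 2) (X i)]

/-- The coboundaries in a cochain complex `X 0 → X 1 → ⋯`. -/
def coboundaries (δ : ∀ i, X i →ₗ[ZMod 2] X (i + 1)) : ∀ i, Submodule (ZMod 2) (X i)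
  | 0 => ⊥
  | i + 1 => LinearMap.range (δ i)

/-- The cocycles in a cochain complex `X 0 → X 1 → ⋯`. -/
abbrev cocycles (δ : ∀ i, X i →ₗ[ZMod 2] X (i + 1)) (i : ℕ) : Submodule (ZMod 2) (X i) :=
  LinearMap.ker (δ i)

/-- The cohomology of a cochain complex `X 0 → X 1 → ⋯`. -/
abbrev Cohomology (δ : ∀ i, X i →ₗ[ZMod 2] X (i + 1)) (s : ℕ) : Type _ :=
  ↥(cocycles δ s) ⧸ (coboundaries δ s).submoduleOf (cocycles δ s)

/-- The cohomology class of a cocycle. -/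
def cohomologyClass (δ : ∀ i, X i →ₗ[ZMod 2] X (i + 1)) (s : ℕ) :
    cocycles δ s →ₗ[ZMod 2] Cohomology δ s :=
  ((coboundaries δ s).submoduleOf (cocycles δ s)).mkQ

end Cohomology

section Ext

variable {N : Type*} [AddCommGroup N] [Module (ZMod 2) N] [Module SteenrodAlgebra N]
  {𝓝 : ℤ → Submodule (ZMod 2) N}

/-- `Hom_𝒜^t(P_i, 𝔽₂)`: the `𝒜`-linear maps `P_i → 𝔽₂` that vanish outside degree `t`. -/
def resolutionHom (P : GradedFreeResolution.{v, w} 𝓝) (t : ℤ) (i : ℕ) :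
    Submodule (ZMod 2) (Dual (ZMod 2) (P.obj i)) where
  carrier := {f | (∀ (a : SteenrodAlgebra) (x : P.obj i), f (a • x) = a • f x) ∧
    ∀ p : ℤ, p ≠ t → ∀ x ∈ P.grading i p, f x = 0}
  add_mem' := by
    rintro f g ⟨hf, hf'⟩ ⟨hg, hg'⟩
    refine ⟨fun a x => by simp [hf, hg], fun p hp x hx => by simp [hf' p hp x hx, hg' p hp x hx]⟩
  zero_mem' := by simp
  smul_mem' := by
    rintro c f ⟨hf, hf'⟩
    refine ⟨fun a x => ?_, fun p hp x hx => by simp [hf' p hp x hx]⟩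
    simp only [LinearMap.smul_apply, hf, SteenrodAlgebra.smul_zmod, smul_eq_mul]
    ring

/-- The differential of `Hom_𝒜^t(P_*, 𝔽₂)`. -/
def resolutionHomD (P : GradedFreeResolution.{v, w} 𝓝) (t : ℤ) (i : ℕ) :
    resolutionHom P t i →ₗ[ZMod 2] resolutionHom P t (i + 1) :=
  ((LinearMap.lcomp (ZMod 2) (ZMod 2) ((P.d i).restrictScalars (ZMod 2))).domRestrict
    (resolutionHom P t i)).codRestrict (resolutionHom P t (i + 1)) (by
      rintro ⟨f, hf, hf'⟩
      refine ⟨fun a x => ?_, fun p hp x hx => ?_⟩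
      · simp [hf]
      · simpa using hf' p hp _ (P.d_mem i p x hx))

/-- `Ext_𝒜^{s,t}(N, 𝔽₂)`, computed from the graded free resolution `P` of `N`. -/
abbrev SteenrodExt (P : GradedFreeResolution.{v, w} 𝓝) (s : ℕ) (t : ℤ) : Type _ :=
  Cohomology (X := fun i => ↥(resolutionHom P t i)) (resolutionHomD P t) s

end Ext

/-! ### The complex `Hom_𝒜(M ⊗ F_*, 𝔽₂)` -/

section Diagonal

variable {M : Type*} [AddCommGroup M] [Module (ZMod 2) M] [Module SteenrodAlgebra M]
  [IsScalarTower (ZMod 2) SteenrodAlgebra M]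

/-- The diagonal action of `Sq^n` on `M ⊗ N`, by the Cartan formula
`Sq^n (x ⊗ y) = ∑_{i + j = n} Sq^i x ⊗ Sq^j y`. -/
def cartanSq (M N : Type*) [AddCommGroup M] [Module (ZMod 2) M] [Module SteenrodAlgebra M]
    [IsScalarTower (ZMod 2) SteenrodAlgebra M] [AddCommGroup N] [Module (ZMod 2) N]
    [Module SteenrodAlgebra N] [IsScalarTower (ZMod 2) SteenrodAlgebra N] (n : ℕ) :
    M ⊗[ZMod 2] N →ₗ[ZMod 2] M ⊗[ZMod 2] N :=
  ∑ p ∈ Finset.HasAntidiagonal.antidiagonal n,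
    TensorProduct.map (Algebra.lsmul (ZMod 2) (ZMod 2) M (Sq p.1))
      (Algebra.lsmul (ZMod 2) (ZMod 2) N (Sq p.2))

variable {L : Type*} [AddCommGroup L] [Module (ZMod 2) L] [Module SteenrodAlgebra L]
  {𝓛 : ℤ → Submodule (ZMod 2) L}

/-- `Hom_𝒜^t(M ⊗ F_i, 𝔽₂)` for the diagonal action on `M ⊗ F_i`: the linear maps that commute with
all Steenrod squares (which generate `𝒜`) and vanish outside degree `t`. -/
def diagonalHom (𝓜 : ℤ → Submodule (ZMod 2) M) (F : GradedFreeResolution.{v, w} 𝓛) (t : ℤ)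
    (i : ℕ) : Submodule (ZMod 2) (Dual (ZMod 2) (M ⊗[ZMod 2] F.obj i)) where
  carrier := {f | (∀ (n : ℕ) (z : M ⊗[ZMod 2] F.obj i),
      f (cartanSq M (F.obj i) n z) = Sq n • f z) ∧
    ∀ p q : ℤ, p + q ≠ t → ∀ x ∈ 𝓜 p, ∀ y ∈ F.grading i q, f (x ⊗ₜ[ZMod 2] y) = 0}
  add_mem' := by
    rintro f g ⟨hf, hf'⟩ ⟨hg, hg'⟩
    refine ⟨fun a x => by simp [hf, hg], fun p q hp x hx y hy => by
      simp [hf' p q hp x hx y hy, hg' p q hp x hx y hy]⟩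
  zero_mem' := by simp
  smul_mem' := by
    rintro c f ⟨hf, hf'⟩
    refine ⟨fun a x => ?_, fun p q hp x hx y hy => by simp [hf' p q hp x hx y hy]⟩
    simp only [LinearMap.smul_apply, hf, SteenrodAlgebra.smul_zmod, smul_eq_mul]
    ring

theorem cartanSq_lTensor (F : GradedFreeResolution.{v, w} 𝓛) (i n : ℕ)
    (z : M ⊗[ZMod 2] F.obj (i + 1)) :
    LinearMap.lTensor M ((F.d i).restrictScalars (ZMod 2)) (cartanSq M (F.obj (i + 1)) n z) =
      cartanSq M (F.obj i) n (LinearMap.lTensor M ((F.d i).restrictScalars (ZMod 2)) z) := by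
  induction z using TensorProduct.induction_on with
  | zero => simp
  | tmul x y => simp [cartanSq, LinearMap.sum_apply]
  | add x y hx hy => simp only [map_add, hx, hy]

/-- The differential `f ↦ f ∘ (1 ⊗ d)` of `Hom_𝒜^t(M ⊗ F_*, 𝔽₂)`. -/
def diagonalHomD (𝓜 : ℤ → Submodule (ZMod 2) M) (F : GradedFreeResolution.{v, w} 𝓛) (t : ℤ)
    (i : ℕ) : diagonalHom 𝓜 F t i →ₗ[ZMod 2] diagonalHom 𝓜 F t (i + 1) :=
  ((LinearMap.lcomp (ZMod 2) (ZMod 2)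
    (LinearMap.lTensor M ((F.d i).restrictScalars (ZMod 2)))).domRestrict
    (diagonalHom 𝓜 F t i)).codRestrict (diagonalHom 𝓜 F t (i + 1)) (by
      rintro ⟨f, hf, hf'⟩
      refine ⟨fun n z => ?_, fun p q hp x hx y hy => ?_⟩
      · simp only [LinearMap.domRestrict_apply, LinearMap.lcomp_apply, cartanSq_lTensor, hf]
      · simpa using hf' p q hp x hx _ (F.d_mem i q y hy))

/-- The cocycles in degree `s` of `Hom_𝒜^t(M ⊗ F_*, 𝔽₂)`. -/
abbrev DiagonalCocycles (𝓜 : ℤ → Submodule (ZMod 2) M) (F : GradedFreeResolution.{v, w} 𝓛)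
    (t : ℤ) (s : ℕ) : Type _ :=
  ↥(cocycles (X := fun i => ↥(diagonalHom 𝓜 F t i)) (diagonalHomD 𝓜 F t) s)

/-- The cohomology in degree `s` of `Hom_𝒜^t(M ⊗ F_*, 𝔽₂)`. -/
abbrev DiagonalCohomology (𝓜 : ℤ → Submodule (ZMod 2) M) (F : GradedFreeResolution.{v, w} 𝓛)
    (t : ℤ) (s : ℕ) : Type _ :=
  Cohomology (X := fun i => ↥(diagonalHom 𝓜 F t i)) (diagonalHomD 𝓜 F t) s

/-- The index set of the basis elements `e_k ⊗ r_{i,j}` of internal degree `t`, with the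
lexicographic order. -/
abbrev TensorIndex {κ : Type*} (dim : κ → ℤ) (F : GradedFreeResolution.{v, w} 𝓛) (t : ℤ)
    (i : ℕ) : Type _ :=
  {p : κ ×ₗ F.idx i // dim (ofLex p).1 + F.deg i (ofLex p).2 = t}

/-- `B i` consists of the elements `e_k ⊗ r_{i,j}` of `Hom_𝒜^t(M ⊗ F_i, 𝔽₂)` dual to the
`e k ⊗ F.gen i j`. -/
def IsDualBasis {κ : Type*} {𝓜 : ℤ → Submodule (ZMod 2) M} (e : κ → M) (dim : κ → ℤ)
    {F : GradedFreeResolution.{v, w} 𝓛} {t : ℤ}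
    (B : ∀ i, Basis (TensorIndex dim F t i) (ZMod 2) (diagonalHom 𝓜 F t i)) : Prop :=
  ∀ (i : ℕ) (x : TensorIndex dim F t i) (k : κ) (j : F.idx i),
    (x.1 = toLex (k, j) → (B i x).1 (e k ⊗ₜ[ZMod 2] F.gen i j) = 1) ∧
    (x.1 ≠ toLex (k, j) → (B i x).1 (e k ⊗ₜ[ZMod 2] F.gen i j) = 0)

/-- A basis element `e_k ⊗ r_{i,j}` with `m ≤ dim k ≤ n` as a basis element for all cells. -/
def TensorIndex.incl {κ : Type*} {dim : κ → ℤ} {F : GradedFreeResolution.{v, w} 𝓛} {t m n : ℤ}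
    {i : ℕ} (x : TensorIndex (fun k : CellsBetween dim m n => dim k) F t i) :
    TensorIndex dim F t i :=
  ⟨toLex ((ofLex x.1).1.1, (ofLex x.1).2), x.2⟩

end Diagonal

/-! ### Curtis tables -/

/-- The items that may occur on the `i`-th list `L_i` of a Curtis table: an element `x ∈ ι i`, or a
tag `a ← b` with `a ∈ ι i` and `b ∈ ι (i - 1)`. -/
inductive CurtisItem (ι : ℕ → Type*) : ℕ → Type _
  | single {i : ℕ} (x : ι i) : CurtisItem ι i
  | tag {i : ℕ} (a : ι (i + 1)) (b : ι i) : CurtisItem ι (i + 1)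

/-- The element `y` appears in the given item. -/
def CurtisItem.Mentions {ι : ℕ → Type*} : {i : ℕ} → CurtisItem ι i → (Σ j, ι j) → Prop
  | i, .single x, y => y = ⟨i, x⟩
  | _, .tag (i := i) a b, y => y = ⟨i + 1, a⟩ ∨ y = ⟨i, b⟩

/-- `j` indexes the leading term of `v`: the largest basis element occurring in `v`. -/
def IsLeadingTerm {ι V : Type*} [LinearOrder ι] [AddCommGroup V] [Module (ZMod 2) V]
    (b : Basis ι (ZMod 2) V) (v : V) (j : ι) : Prop :=
  b.repr v j ≠ 0 ∧ ∀ k, b.repr v k ≠ 0 → k ≤ j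

/-- The lists `L i` (as sets of items, since the order within a list carries no information) form a
Curtis table of the complex `X 0 → X 1 → ⋯` with respect to the ordered bases `B i`. -/
structure IsCurtisTable {ι : ℕ → Type*} [∀ i, LinearOrder (ι i)] {X : ℕ → Type*}
    [∀ i, AddCommGroup (X i)] [∀ i, Module (ZMod 2) (X i)]
    (δ : ∀ i, X i →ₗ[ZMod 2] X (i + 1)) (B : ∀ i, Basis (ι i) (ZMod 2) (X i))
    (L : ∀ i, Set (CurtisItem ι i)) : Prop where
  appears_once : ∀ y : Σ i, ι i,
    ∃! q : Σ i, CurtisItem ι i, q.2 ∈ L q.1 ∧ q.2.Mentions y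
  single_or_head_iff_zero : ∀ x : ι 0, CurtisItem.single x ∈ L 0 ↔
    ∃ v : X 0, δ 0 v = 0 ∧ IsLeadingTerm (B 0) v x
  single_or_head_iff_succ : ∀ (i : ℕ) (x : ι (i + 1)),
    (CurtisItem.single x ∈ L (i + 1) ∨ ∃ b : ι i, CurtisItem.tag x b ∈ L (i + 1)) ↔
      ∃ v : X (i + 1), δ (i + 1) v = 0 ∧ IsLeadingTerm (B (i + 1)) v x
  tag_boundary : ∀ (i : ℕ) (a : ι (i + 1)) (b : ι i), CurtisItem.tag a b ∈ L (i + 1) →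
    ∃ v : X i, IsLeadingTerm (B i) v b ∧ IsLeadingTerm (B (i + 1)) (δ i v) a

/-- Curtis tables of `Hom_𝒜^t(M ⊗ F_*, 𝔽₂)` with respect to ordered bases indexed by the
`e_k ⊗ r_{i,j}`. -/
abbrev IsDiagonalCurtisTable {M : Type*} [AddCommGroup M] [Module (ZMod 2) M]
    [Module SteenrodAlgebra M] [IsScalarTower (ZMod 2) SteenrodAlgebra M]
    {L : Type*} [AddCommGroup L] [Module (ZMod 2) L] [Module SteenrodAlgebra L]
    {𝓛 : ℤ → Submodule (ZMod 2) L} {𝓜 : ℤ → Submodule (ZMod 2) M} {κ : Type*} [LinearOrder κ]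
    {dim : κ → ℤ} {F : GradedFreeResolution.{v, w} 𝓛} [∀ i, LinearOrder (F.idx i)] {t : ℤ}
    (B : ∀ i, Basis (TensorIndex dim F t i) (ZMod 2) (diagonalHom 𝓜 F t i))
    (T : ∀ i, Set (CurtisItem (TensorIndex dim F t) i)) : Prop :=
  IsCurtisTable (X := fun i => ↥(diagonalHom 𝓜 F t i)) (diagonalHomD 𝓜 F t) B T

/-- `x` appears in no surviving tag of the table `T`, that is, in no tag `a ← b` of `T` both of
whose entries come from cells in dimensions `m` through `n`. -/
def NotInSurvivingTag {L : Type*} [AddCommGroup L] [Module (ZMod 2) L] [Module SteenrodAlgebra L]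
    {𝓛 : ℤ → Submodule (ZMod 2) L} {κ : Type*} {dim : κ → ℤ}
    {F : GradedFreeResolution.{v, w} 𝓛} {t m n : ℤ}
    (T : ∀ i, Set (CurtisItem (TensorIndex dim F t) i)) {s : ℕ}
    (x : TensorIndex (fun k : CellsBetween dim m n => dim k) F t s) : Prop :=
  ¬ ∃ (i : ℕ) (a : TensorIndex (fun k : CellsBetween dim m n => dim k) F t (i + 1))
      (b : TensorIndex (fun k : CellsBetween dim m n => dim k) F t i),
    CurtisItem.tag a.incl b.incl ∈ T (i + 1) ∧
      CurtisItem.Mentions (ι := TensorIndex (fun k : CellsBetween dim m n => dim k) F t)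
        (CurtisItem.tag a b) ⟨s, x⟩

end

noncomputable section

universe v w v' w'

open SteenrodAlgebra (Sq)

/-! Curtis tables are intrinsic. Over `𝔽₂`, two vectors with the same leading term cancel it when
added. Elimination of this kind shows that a table must contain exactly the tags `a ← b` in which
`b` is the least leading term of a vector whose coboundary is led by `a` (`IsTag`). Its untagged
items must be the leading terms of cocycles that lead no coboundary. This gives existence
(`isCurtisTable_curtisTable`) and uniqueness (`IsCurtisTable.exists_tag_le`,
`IsCurtisTable.eq_curtisTable`). Cocycles led by the untagged items represent a basis of cohomology
(`exists_basis_cohomology`).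

Truncation is handled by a relation. `M^{≥ m}` is a submodule of `M` and maps onto `M_m^n`. Call a
cochain on `M` and a cochain on `M_m^n` related if they agree on `M^{≥ m}`; coboundaries preserve
this. In coordinates, the entries in the range agree, those above it vanish, and those below it are
arbitrary (`truncatesTo_iff`). Because lower cells come first, leading terms in the range
correspond. A vector led by a cell below the range is related to `0`, so its coboundary cannot be
led by a cell in the range. Hence the competitors for the least leading term are the same on both
sides, and so are the tags (`isTag_truncation_iff`). The untagged items are what remains.

For bases and `Ext`: `Hom_𝒜(N ⊗ F, B) = Hom_𝒜(F, Hom(N, B))`, with conjugation action on `Hom(N,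
B)`, so the `e_k ⊗ r_j` form an `𝒜`-basis of `N ⊗ F` (`DiagonalTensor.basis`). Thus `N ⊗ F_*` is a
graded free resolution of `N`, and the comparison theorem (`nonempty_steenrodExt_equiv`) identifies
the cohomology with `Ext`.

Both actions require the Cartan formula and the antipode to respect the Adem relations. These are
therefore replaced by an equivalent identity of generating series, due to Bullett and Macdonald,
which passes to products of commuting series and to inverses (`BullettMacdonald.adem`,
`bullettMacdonald_of_adem`). -/

/-! ### Bullett–Macdonald relations -/

section BullettMacdonald

open Polynomial Finset

/-- The solution `w` of the triangular system `w c + ∑ j < c, α c j (w j) = y c`. -/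
def triangularSolution {R : Type*} [AddCommGroup R] (α : ℕ → ℕ → R → R) (y : ℕ → R) : ℕ → R
  | c => y c - ∑ j : Fin c, α c j (triangularSolution α y j)
decreasing_by exact j.2

theorem triangularSolution_add_sum {R : Type*} [AddCommGroup R] (α : ℕ → ℕ → R → R) (y : ℕ → R)
    (c : ℕ) : triangularSolution α y c + ∑ j ∈ range c, α c j (triangularSolution α y j) = y c := by
  rw [triangularSolution, Finset.sum_range]
  simp

/-- The residue of `g / (s (1 + s)) ^ (a + 1)` at `s = 0`. -/
def residue (a : ℕ) : (ZMod 2)[X] →ₗ[ZMod 2] ZMod 2 :=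
  PowerSeries.coeff a ∘ₗ
    LinearMap.mulRight (ZMod 2) ((PowerSeries.invOneSubPow (ZMod 2) (a + 1)).val) ∘ₗ
      (Polynomial.coeToPowerSeries.algHom (ZMod 2)).toLinearMap

theorem residue_apply (a : ℕ) (g : (ZMod 2)[X]) : residue a g =
    PowerSeries.coeff a ((g : PowerSeries (ZMod 2)) *
      (PowerSeries.invOneSubPow (ZMod 2) (a + 1)).val) := by
  simp [residue, Polynomial.coeToPowerSeries.algHom_apply]

theorem one_add_X_pow_mul_invOneSubPow (d e : ℕ) :
    (1 + PowerSeries.X) ^ e * (PowerSeries.invOneSubPow (ZMod 2) (e + d)).val =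
      (PowerSeries.invOneSubPow (ZMod 2) d).val := by
  have h : (1 + PowerSeries.X : PowerSeries (ZMod 2)) = 1 - PowerSeries.X := by
    have h2 : (2 : PowerSeries (ZMod 2)) = 0 := by
      rw [← map_ofNat (PowerSeries.C (R := ZMod 2)) 2, show (OfNat.ofNat 2 : ZMod 2) = 0 from rfl,
        map_zero]
    linear_combination PowerSeries.X * h2
  rw [h, add_comm, PowerSeries.one_sub_pow_mul_invOneSubPow_val_add_eq_invOneSubPow_val]

theorem residue_of_lt {a k : ℕ} (h : a < k) (g : (ZMod 2)[X]) : residue a (X ^ k * g) = 0 := by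
  rw [residue_apply]
  push_cast
  rw [mul_assoc, PowerSeries.coeff_X_pow_mul', if_neg (by omega)]

/-- For `u = s (1 + s)` one has `du = ds` in characteristic 2, so this is the residue of `u ^ (k - a
- 1) du`. In coordinates, the case `k < a` is the evenness of a central binomial coefficient. -/
theorem residue_pow (a k : ℕ) : residue a ((X * (1 + X)) ^ k) = if k = a then 1 else 0 := by
  rcases lt_or_ge a k with h | h
  · rw [mul_pow, residue_of_lt h, if_neg (by omega)]
  · obtain ⟨d, rfl⟩ := Nat.exists_eq_add_of_le h
    rw [residue_apply, mul_pow]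
    push_cast
    rw [mul_assoc, PowerSeries.coeff_X_pow_mul', if_pos h, add_assoc,
      one_add_X_pow_mul_invOneSubPow, PowerSeries.invOneSubPow_val_succ_eq_mk_add_choose]
    simp only [add_tsub_cancel_left, PowerSeries.coeff_mk]
    rcases Nat.eq_zero_or_pos d with rfl | hd
    · simp
    · rw [if_neg (by omega), ← two_mul, ← Nat.centralBinom_eq_two_mul_choose,
        ZMod.natCast_eq_zero_iff]
      exact Nat.two_dvd_centralBinom_of_one_le hd

/-- The factor `(1 + X) ^ (a + 1)` cancels that part of the denominator, leaving an ordinary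
coefficient of `(1 + X) ^ d`. This is the source of the binomial coefficients in the Adem relations.
-/
theorem residue_mul_pow {a c d : ℕ} (hc : 2 * c ≤ a) :
    residue a ((1 + X) ^ (a + 1 + d) * (X ^ 2) ^ c) = (d.choose (a - 2 * c) : ℕ) := by
  rw [residue_apply]
  have h := one_add_X_pow_mul_invOneSubPow 0 (a + 1)
  rw [PowerSeries.invOneSubPow_zero, add_zero, Units.val_one] at h
  have h2 : (((1 + X) ^ (a + 1 + d) * (X ^ 2) ^ c : (ZMod 2)[X]) : PowerSeries (ZMod 2)) *
      (PowerSeries.invOneSubPow (ZMod 2) (a + 1)).val =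
      PowerSeries.X ^ (2 * c) * (((1 + X) ^ d : (ZMod 2)[X]) : PowerSeries (ZMod 2)) := by
    push_cast
    rw [pow_add, pow_mul]
    linear_combination ((1 + PowerSeries.X) ^ d * (PowerSeries.X ^ 2) ^ c) * h
  rw [h2, PowerSeries.coeff_X_pow_mul', if_pos hc, Polynomial.coeff_coe,
    Polynomial.coeff_one_add_X_pow]

variable {R S : Type*} [AddCommGroup R] [Module (ZMod 2) R] [AddCommGroup S] [Module (ZMod 2) S]

/-- The part of degree `n` of the Bullett–Macdonald relation
`P(s² + st) P(t²) = P(t² + st) P(s²)` with `t = 1`; here `m a b` stands for the coefficient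
of `x ^ a y ^ b` in `P(x) P(y)`. -/
def BullettMacdonald (n : ℕ) (m : ℕ → ℕ → R) : Prop :=
  ∑ p ∈ antidiagonal n, ((X * (1 + X)) ^ p.1 : (ZMod 2)[X]) ⊗ₜ[ZMod 2] m p.1 p.2 =
    ∑ p ∈ antidiagonal n, ((1 + X) ^ p.1 * (X ^ 2) ^ p.2 : (ZMod 2)[X]) ⊗ₜ[ZMod 2] m p.1 p.2

theorem BullettMacdonald.map {n : ℕ} {m : ℕ → ℕ → R} (h : BullettMacdonald n m)
    (f : R →ₗ[ZMod 2] S) : BullettMacdonald n (fun a b => f (m a b)) := by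
  have := congrArg (LinearMap.lTensor (ZMod 2)[X] f) h
  simp only [map_sum, LinearMap.lTensor_tmul] at this
  exact this

/-- Taking residues isolates `m a b` on the left and yields the Adem coefficients on the right.
Terms with `2 * c > a` have no pole; for the others, `a < 2 * b` gives `c < b`, so `b - c - 1` does
not truncate. -/
theorem BullettMacdonald.adem {a b : ℕ} {m : ℕ → ℕ → R} (h : BullettMacdonald (a + b) m)
    (hab : a < 2 * b) :
    m a b = ∑ c ∈ range (a / 2 + 1),
      (((b - c - 1).choose (a - 2 * c) : ℕ) : ZMod 2) • m (a + b - c) c := by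
  have h1 := congrArg ((TensorProduct.lid (ZMod 2) R).toLinearMap ∘ₗ LinearMap.rTensor R (residue a)) h
  simp only [map_sum, LinearMap.comp_apply, LinearMap.rTensor_tmul, LinearEquiv.coe_coe,
    TensorProduct.lid_tmul, residue_pow] at h1
  rw [Finset.sum_eq_single (a, b), if_pos rfl, one_smul] at h1
  · rw [h1, Finset.Nat.sum_antidiagonal_eq_sum_range_succ_mk, ← Finset.sum_range_reflect]
    symm
    apply Finset.sum_subset_zero_on_sdiff
    · intro c hc
      simp only [Finset.mem_range] at hc ⊢
      omega
    · intro c hc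
      simp only [Finset.mem_sdiff, Finset.mem_range] at hc
      have e : a + b - (a + b + 1 - 1 - c) = c := by omega
      simp only [e]
      rw [mul_comm, ← pow_mul, residue_of_lt (by omega), zero_smul]
    · intro c hc
      simp only [Finset.mem_range] at hc
      have e : a + b - (a + b + 1 - 1 - c) = c := by omega
      have e' : a + b + 1 - 1 - c = a + 1 + (b - c - 1) := by omega
      simp only [e]
      rw [e', residue_mul_pow (by omega), show a + b - c = a + 1 + (b - c - 1) by omega]
  · rintro ⟨p, q⟩ hp hne
    rw [HasAntidiagonal.mem_antidiagonal] at hp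
    simp only at hp
    rw [if_neg, zero_smul]
    rintro rfl
    exact hne (by simp; omega)
  · intro hn
    simp at hn

/-- The binomial theorem for `(f + g) ^ (n - 3 * j)`, with exponents shifted by `(2 * j, j)`. -/
theorem sum_antidiagonal_choose {K : Type*} [CommRing K] {n j : ℕ} (hj : 3 * j ≤ n) (f g : K) :
    ∑ p ∈ antidiagonal n,
        (if 2 * j ≤ p.1 then ((n - 3 * j).choose (p.1 - 2 * j) : K) else 0) * (f ^ p.1 * g ^ p.2) =
      f ^ (2 * j) * g ^ j * (f + g) ^ (n - 3 * j) := by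
  rw [(Commute.all f g).add_pow', Finset.mul_sum]
  symm
  refine Finset.sum_of_injOn (fun p => (p.1 + 2 * j, p.2 + j)) ?_ ?_ ?_ ?_
  · rintro ⟨p, q⟩ - ⟨p', q'⟩ - h
    simp only [Prod.mk.injEq] at h ⊢
    omega
  · rintro ⟨p, q⟩ h
    simp only [Finset.mem_coe, HasAntidiagonal.mem_antidiagonal] at h ⊢
    omega
  · rintro ⟨p, q⟩ h h'
    simp only [HasAntidiagonal.mem_antidiagonal, Set.mem_image, Finset.mem_coe, Prod.mk.injEq, Prod.exists,
      not_exists, not_and] at h h'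
    split_ifs with hp
    · rw [Nat.choose_eq_zero_of_lt, Nat.cast_zero, zero_mul]
      by_contra hlt
      exact h' (p - 2 * j) (q - j) (by omega) (by omega) (by omega)
    · rw [zero_mul]
  · rintro ⟨p, q⟩ h
    simp only [nsmul_eq_mul, le_add_iff_nonneg_left, zero_le, if_true, add_tsub_cancel_right]
    ring

/-- The pairs `(f, g) = (s (1 + s), 1)` and `(1 + s, s²)` have the same `f² g = s² (1 + s)²` and the
same `f + g = 1 + s + s²`. So the coefficients of any product `(f² g) ^ j * (f + g) ^ (n - 3 * j)`
solve the relation. -/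
theorem bullettMacdonald_choose_smul {n j : ℕ} (hj : 3 * j ≤ n) (w : R) :
    BullettMacdonald n (fun a _ =>
      (if 2 * j ≤ a then ((n - 3 * j).choose (a - 2 * j) : ZMod 2) else 0) • w) := by
  have key : ∀ f g : (ZMod 2)[X], ∑ p ∈ antidiagonal n, (f ^ p.1 * g ^ p.2) ⊗ₜ[ZMod 2]
      ((if 2 * j ≤ p.1 then ((n - 3 * j).choose (p.1 - 2 * j) : ZMod 2) else 0) • w) =
      (f ^ (2 * j) * g ^ j * (f + g) ^ (n - 3 * j)) ⊗ₜ[ZMod 2] w := by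
    intro f g
    rw [← sum_antidiagonal_choose hj, TensorProduct.sum_tmul]
    refine Finset.sum_congr rfl fun p _ => ?_
    rw [← TensorProduct.smul_tmul]
    split_ifs
    · rw [Algebra.smul_def, map_natCast]
    · simp
  unfold BullettMacdonald
  have h1 := key (X * (1 + X)) 1
  simp only [one_pow, mul_one] at h1
  rw [h1, key]
  congr 1
  have : X * (1 + X) + 1 = (1 + X + X ^ 2 : (ZMod 2)[X]) := by ring
  rw [this, mul_pow, ← pow_mul]
  ring

theorem BullettMacdonald.sum {ι : Type*} {n : ℕ} (s : Finset ι) (m : ι → ℕ → ℕ → R)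
    (h : ∀ i ∈ s, BullettMacdonald n (m i)) :
    BullettMacdonald n (fun a b => ∑ i ∈ s, m i a b) := by
  simp only [BullettMacdonald, TensorProduct.tmul_sum]
  rw [Finset.sum_comm, Finset.sum_comm (s := antidiagonal n)]
  exact Finset.sum_congr rfl h

theorem BullettMacdonald.congr {n : ℕ} {m m' : ℕ → ℕ → R} (h : BullettMacdonald n m)
    (e : ∀ a b, a + b = n → m a b = m' a b) : BullettMacdonald n m' := by
  have e' : ∀ p ∈ antidiagonal n, m p.1 p.2 = m' p.1 p.2 :=
    fun p hp => e p.1 p.2 (HasAntidiagonal.mem_antidiagonal.1 hp)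
  refine (Finset.sum_congr rfl fun p hp => ?_).trans
    (Eq.trans h (Finset.sum_congr rfl fun p hp => ?_)) <;> rw [e' p hp]

/-- The Adem relations express every value through the admissible ones, `a ≥ 2 * b`, so it suffices
to find a Bullett–Macdonald solution with the same admissible values. The explicit solutions for `j
≤ n / 3` are unitriangular on these values, so a suitable combination `m'` exists. It satisfies the
Adem relations too, hence equals `m`. -/
theorem bullettMacdonald_of_adem {n : ℕ} {m : ℕ → ℕ → R}
    (h : ∀ a b, a + b = n → a < 2 * b → m a b = ∑ c ∈ range (a / 2 + 1),
      (((b - c - 1).choose (a - 2 * c) : ℕ) : ZMod 2) • m (a + b - c) c) :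
    BullettMacdonald n m := by
  set w : ℕ → R := triangularSolution
    (fun c j x => ((n - 3 * j).choose (n - c - 2 * j) : ZMod 2) • x) (fun c => m (n - c) c) with hw
  set m' : ℕ → ℕ → R := fun a _ => ∑ j ∈ range (n / 3 + 1),
    (if 2 * j ≤ a then ((n - 3 * j).choose (a - 2 * j) : ZMod 2) else 0) • w j with hm'
  have hbm : BullettMacdonald n m' := by
    apply BullettMacdonald.sum
    intro j hj
    apply bullettMacdonald_choose_smul
    simp only [Finset.mem_range] at hj
    omega
  have hadm : ∀ c, 3 * c ≤ n → m' (n - c) c = m (n - c) c := by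
    intro c hc
    rw [← triangularSolution_add_sum (fun c j x =>
      ((n - 3 * j).choose (n - c - 2 * j) : ZMod 2) • x) (fun c => m (n - c) c) c, ← hw, hm',
      add_comm (triangularSolution _ _ _)]
    have := Finset.sum_range_succ (M := R) (fun j =>
      ((n - 3 * j).choose (n - c - 2 * j) : ZMod 2) • w j) c
    rw [show n - c - 2 * c = n - 3 * c by omega, Nat.choose_self, Nat.cast_one, one_smul] at this
    rw [← this]
    symm
    -- Triangularity: for `j > c` the lower index `n - c - 2 * j` exceeds `n - 3 * j`.
    apply Finset.sum_subset_zero_on_sdiff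
    · intro j hj
      simp only [Finset.mem_range] at hj ⊢
      omega
    · intro j hj
      simp only [Finset.mem_range, Finset.mem_sdiff] at hj
      split_ifs
      · rw [Nat.choose_eq_zero_of_lt (by omega), Nat.cast_zero, zero_smul]
      · rw [zero_smul]
    · intro j hj
      simp only [Finset.mem_range] at hj
      rw [if_pos (by omega)]
  refine hbm.congr fun a b hab => ?_
  rcases lt_or_ge a (2 * b) with hlt | hge
  · subst hab
    rw [hbm.adem hlt, h a b rfl hlt]
    refine Finset.sum_congr rfl fun c hc => ?_
    simp only [Finset.mem_range] at hc
    rw [hadm c (by omega)]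
  · have := hadm b (by omega)
    rwa [show n - b = a by omega] at this

end BullettMacdonald

/-! ### Generating series and products of commuting sequences -/

section GeneratingSeries

open Polynomial Finset

variable {E : Type*} [Ring E] [Algebra (ZMod 2) E]

/-- The series `∑ fⁿ ⊗ qₙ zⁿ`. -/
def generatingSeries (f : (ZMod 2)[X]) (q : ℕ → E) : PowerSeries ((ZMod 2)[X] ⊗[ZMod 2] E) :=
  PowerSeries.mk fun n => (f ^ n) ⊗ₜ q n

theorem coeff_generatingSeries_mul (f g : (ZMod 2)[X]) (q r : ℕ → E) (n : ℕ) :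
    PowerSeries.coeff n (generatingSeries f q * generatingSeries g r) =
      ∑ p ∈ antidiagonal n, (f ^ p.1 * g ^ p.2) ⊗ₜ (q p.1 * r p.2) := by
  simp [generatingSeries, PowerSeries.coeff_mul, Algebra.TensorProduct.tmul_mul_tmul]

/-- The cauchyProduct of two sequences. -/
def cauchyProduct (q r : ℕ → E) (n : ℕ) : E := ∑ p ∈ antidiagonal n, q p.1 * r p.2

theorem generatingSeries_cauchyProduct (f : (ZMod 2)[X]) (q r : ℕ → E) :
    generatingSeries f (cauchyProduct q r) = generatingSeries f q * generatingSeries f r := by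
  ext n
  rw [coeff_generatingSeries_mul, generatingSeries, PowerSeries.coeff_mk, cauchyProduct,
    TensorProduct.tmul_sum]
  refine Finset.sum_congr rfl fun p hp => ?_
  rw [← pow_add, HasAntidiagonal.mem_antidiagonal.1 hp]

/-- The polynomial factor is commutative, so only the entries of the two sequences have to commute.
-/
theorem commute_generatingSeries (f g : (ZMod 2)[X]) {q r : ℕ → E}
    (h : ∀ i j, Commute (q i) (r j)) :
    Commute (generatingSeries f q) (generatingSeries g r) := by
  ext n
  rw [coeff_generatingSeries_mul, coeff_generatingSeries_mul, ← Finset.Nat.sum_antidiagonal_swap]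
  refine Finset.sum_congr rfl fun p _ => ?_
  rw [Prod.fst_swap, Prod.snd_swap, mul_comm, (h _ _).eq]

/-- The Bullett–Macdonald relations, in all degrees, for the products of members of a sequence. -/
def IsBullettMacdonald (q : ℕ → E) : Prop := ∀ n, BullettMacdonald n fun a b => q a * q b

theorem isBullettMacdonald_iff (q : ℕ → E) : IsBullettMacdonald q ↔
    generatingSeries (X * (1 + X)) q * generatingSeries 1 q =
      generatingSeries (1 + X) q * generatingSeries (X ^ 2) q := by
  rw [PowerSeries.ext_iff]
  simp only [coeff_generatingSeries_mul, one_pow, mul_one]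
  rfl

/-- As an identity of power series the relation is multiplicative once commuting factors are
regrouped. -/
theorem IsBullettMacdonald.cauchyProduct {q r : ℕ → E} (hq : IsBullettMacdonald q)
    (hr : IsBullettMacdonald r) (h : ∀ i j, Commute (q i) (r j)) :
    IsBullettMacdonald (cauchyProduct q r) := by
  rw [isBullettMacdonald_iff] at *
  simp only [generatingSeries_cauchyProduct]
  rw [((commute_generatingSeries 1 _ h).symm.mul_mul_mul_comm _ _),
    ((commute_generatingSeries (X ^ 2) _ h).symm.mul_mul_mul_comm _ _), hq, hr]

end GeneratingSeries

/-! ### Maps out of the Steenrod algebra, and the antipode -/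

namespace SteenrodAlgebra

open Polynomial Finset

theorem Sq_zero : Sq 0 = 1 := by
  have := RingQuot.mkAlgHom_rel (ZMod 2) AdemRel.sq_zero
  rwa [map_one] at this

@[elab_as_elim]
theorem induction_on {p : SteenrodAlgebra → Prop} (a : SteenrodAlgebra)
    (scalar : ∀ c : ZMod 2, p (algebraMap _ _ c)) (sq : ∀ n, p (Sq n))
    (mul : ∀ a b, p a → p b → p (a * b)) (add : ∀ a b, p a → p b → p (a + b)) : p a := by
  obtain ⟨x, rfl⟩ := mk_surjective a
  induction x using FreeAlgebra.induction with
  | grade0 r => rw [AlgHom.commutes]; exact scalar r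
  | grade1 n => exact sq n
  | mul a b ha hb => rw [map_mul]; exact mul _ _ ha hb
  | add a b ha hb => rw [map_add]; exact add _ _ ha hb

/-- The algebra map determined by a sequence that satisfies the Bullett–Macdonald relations. -/
def lift {E : Type*} [Ring E] [Algebra (ZMod 2) E] (q : ℕ → E) (h0 : q 0 = 1)
    (h : IsBullettMacdonald q) : SteenrodAlgebra →ₐ[ZMod 2] E :=
  RingQuot.liftAlgHom (ZMod 2) ⟨FreeAlgebra.lift (ZMod 2) q, by
    intro x y hxy
    cases hxy with
    | sq_zero => simp [h0]
    | adem a b ha hab =>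
      simp only [map_mul, map_sum, map_smul, FreeAlgebra.lift_ι_apply]
      exact (h (a + b)).adem hab⟩

theorem lift_Sq {E : Type*} [Ring E] [Algebra (ZMod 2) E] (q : ℕ → E) (h0 : q 0 = 1)
    (h : IsBullettMacdonald q) (n : ℕ) : lift q h0 h (Sq n) = q n := by
  exact (RingQuot.liftAlgHom_mkAlgHom_apply (ZMod 2) _ _ _).trans (FreeAlgebra.lift_ι_apply _ _)

theorem isBullettMacdonald_Sq : IsBullettMacdonald Sq := by
  intro n
  apply bullettMacdonald_of_adem
  rintro a b rfl hab
  -- The presentation has Adem relations only for `a > 0`; for `a = 0` the relation follows from `Sq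
  -- 0 = 1`.
  rcases Nat.eq_zero_or_pos a with rfl | ha
  · simp [Sq_zero]
  · have := RingQuot.mkAlgHom_rel (ZMod 2) (AdemRel.adem a b ha hab)
    simp only [map_mul, map_sum, map_smul] at this
    exact this

theorem augmentation_Sq (n : ℕ) : augmentation (Sq n) = if n = 0 then 1 else 0 := by
  exact (RingQuot.liftAlgHom_mkAlgHom_apply (ZMod 2) _ _ _).trans (FreeAlgebra.lift_ι_apply _ _)

/-- The conjugates `χ(Sqⁿ)`. -/
def conjSq : ℕ → SteenrodAlgebra :=
  triangularSolution (fun n j x => x * Sq (n - j)) (fun n => if n = 0 then 1 else 0)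

theorem cauchyProduct_conjSq_Sq (n : ℕ) : cauchyProduct conjSq Sq n = if n = 0 then 1 else 0 := by
  rw [cauchyProduct, Finset.Nat.sum_antidiagonal_eq_sum_range_succ_mk, Finset.sum_range_succ,
    add_comm, Nat.sub_self, Sq_zero, mul_one]
  exact triangularSolution_add_sum _ _ n

theorem generatingSeries_one (f : (ZMod 2)[X]) :
    generatingSeries f (fun n => if n = 0 then 1 else 0 : ℕ → SteenrodAlgebra) = 1 := by
  ext n
  rw [generatingSeries, PowerSeries.coeff_mk, PowerSeries.coeff_one]
  split_ifs with h
  · rw [h, pow_zero]; rfl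
  · rw [TensorProduct.tmul_zero]

theorem generatingSeries_conjSq_mul (f : (ZMod 2)[X]) :
    generatingSeries f conjSq * generatingSeries f Sq = 1 := by
  rw [← generatingSeries_cauchyProduct, ← generatingSeries_one f]
  exact congrArg _ (funext cauchyProduct_conjSq_Sq)

/-- The recursion makes `conjSq` a left inverse only. The mirrored recursion gives a right inverse,
and the two must coincide. -/
theorem generatingSeries_mul_conjSq (f : (ZMod 2)[X]) :
    generatingSeries f Sq * generatingSeries f conjSq = 1 := by
  set r : ℕ → SteenrodAlgebra :=
    triangularSolution (fun n j x => Sq (n - j) * x) (fun n => if n = 0 then 1 else 0) with hr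
  have h : cauchyProduct Sq r = fun n => if n = 0 then 1 else 0 := by
    funext n
    rw [cauchyProduct, ← Finset.Nat.sum_antidiagonal_swap,
      Finset.Nat.sum_antidiagonal_eq_sum_range_succ_mk, Finset.sum_range_succ, add_comm]
    simp only [Prod.swap, Nat.sub_self, Sq_zero, one_mul]
    exact triangularSolution_add_sum (fun n j x => Sq (n - j) * x) _ n
  have h' := generatingSeries_cauchyProduct f Sq r
  rw [h, generatingSeries_one] at h'
  rwa [left_inv_eq_right_inv (generatingSeries_conjSq_mul f) h'.symm, eq_comm]

theorem cauchyProduct_Sq_conjSq (n : ℕ) : cauchyProduct Sq conjSq n = if n = 0 then 1 else 0 := by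
  have h := congrArg (PowerSeries.coeff n) (generatingSeries_mul_conjSq 1)
  rw [coeff_generatingSeries_mul, PowerSeries.coeff_one] at h
  simp only [one_pow, mul_one, ← TensorProduct.tmul_sum] at h
  -- At `f = 1` the coefficients have the form `1 ⊗ a`, and the constant-coefficient functional
  -- recovers `a`.
  have h2 := congrArg ((TensorProduct.lid (ZMod 2) SteenrodAlgebra).toLinearMap ∘ₗ
    LinearMap.rTensor SteenrodAlgebra (Polynomial.lcoeff (ZMod 2) 0)) h
  split_ifs at h2 ⊢
  · simpa [cauchyProduct, Algebra.TensorProduct.one_def] using h2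
  · simpa [cauchyProduct] using h2

theorem conjSq_zero : conjSq 0 = 1 := by
  have := cauchyProduct_Sq_conjSq 0
  simpa [cauchyProduct, Sq_zero] using this

/-- Inverting both sides of the identity for `Sq` reverses the factors, which is why the products
appear in opposite order. -/
theorem bullettMacdonald_conjSq (n : ℕ) : BullettMacdonald n fun a b => conjSq b * conjSq a := by
  have h := (isBullettMacdonald_iff Sq).1 isBullettMacdonald_Sq
  have h1 : generatingSeries 1 conjSq * generatingSeries (X * (1 + X)) conjSq *
      (generatingSeries (X * (1 + X)) Sq * generatingSeries 1 Sq) = 1 := by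
    rw [mul_assoc, ← mul_assoc (generatingSeries (X * (1 + X)) conjSq),
      generatingSeries_conjSq_mul, one_mul, generatingSeries_conjSq_mul]
  have h2 : (generatingSeries (1 + X) Sq * generatingSeries (X ^ 2) Sq) *
      (generatingSeries (X ^ 2) conjSq * generatingSeries (1 + X) conjSq) = 1 := by
    rw [mul_assoc, ← mul_assoc (generatingSeries (X ^ 2) Sq),
      generatingSeries_mul_conjSq, one_mul, generatingSeries_mul_conjSq]
  rw [h] at h1
  have h3 := congrArg (PowerSeries.coeff n) (left_inv_eq_right_inv h1 h2)
  rw [coeff_generatingSeries_mul, coeff_generatingSeries_mul] at h3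
  unfold BullettMacdonald
  rw [← Finset.Nat.sum_antidiagonal_swap, ← Finset.Nat.sum_antidiagonal_swap (n := n)
    (f := fun p => ((1 + X) ^ p.1 * (X ^ 2) ^ p.2 : (ZMod 2)[X]) ⊗ₜ[ZMod 2] _)]
  simpa [mul_comm] using h3

end SteenrodAlgebra

open Finset in
theorem sum_antidiagonal_assoc {V : Type*} [AddCommMonoid V] (n : ℕ) (f : ℕ → ℕ → ℕ → V) :
    ∑ p ∈ antidiagonal n, ∑ q ∈ antidiagonal p.2, f p.1 q.1 q.2 =
      ∑ p ∈ antidiagonal n, ∑ q ∈ antidiagonal p.1, f q.1 q.2 p.2 := by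
  rw [Finset.sum_sigma', Finset.sum_sigma']
  refine Finset.sum_nbij' (fun x => ⟨(x.1.1 + x.2.1, x.2.2), (x.1.1, x.2.1)⟩)
    (fun x => ⟨(x.2.1, x.2.2 + x.1.2), (x.2.2, x.1.2)⟩) ?_ ?_ ?_ ?_ ?_
  · rintro ⟨⟨a, b⟩, ⟨c, d⟩⟩ h
    simp only [mem_sigma, HasAntidiagonal.mem_antidiagonal] at h ⊢
    exact ⟨by omega, trivial⟩
  · rintro ⟨⟨a, b⟩, ⟨c, d⟩⟩ h
    simp only [mem_sigma, HasAntidiagonal.mem_antidiagonal] at h ⊢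
    exact ⟨by omega, trivial⟩
  · rintro ⟨⟨a, b⟩, ⟨c, d⟩⟩ h
    simp only [mem_sigma, HasAntidiagonal.mem_antidiagonal] at h
    simp only [Sigma.mk.injEq, Prod.mk.injEq, heq_eq_eq, and_true, true_and]
    omega
  · rintro ⟨⟨a, b⟩, ⟨c, d⟩⟩ h
    simp only [mem_sigma, HasAntidiagonal.mem_antidiagonal] at h
    simp only [Sigma.mk.injEq, Prod.mk.injEq, heq_eq_eq, and_true]
    omega
  · rintro ⟨⟨a, b⟩, ⟨c, d⟩⟩ h
    rfl

section SteenrodModules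

open SteenrodAlgebra

variable {V W : Type*} [AddCommGroup V] [Module (ZMod 2) V] [Module SteenrodAlgebra V]
  [IsScalarTower (ZMod 2) SteenrodAlgebra V] [AddCommGroup W] [Module (ZMod 2) W]
  [Module SteenrodAlgebra W] [IsScalarTower (ZMod 2) SteenrodAlgebra W]

theorem map_smul_of_map_Sq_smul (f : V →ₗ[ZMod 2] W)
    (h : ∀ n x, f (Sq n • x) = Sq n • f x) (a : SteenrodAlgebra) (x : V) :
    f (a • x) = a • f x := by
  induction a using SteenrodAlgebra.induction_on generalizing x with
  | scalar c => rw [algebraMap_smul, algebraMap_smul, map_smul]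
  | sq n => exact h n x
  | mul a b ha hb => rw [mul_smul, mul_smul, ha, hb]
  | add a b ha hb => rw [add_smul, add_smul, map_add, ha, hb]

/-- A linear map that commutes with the Steenrod squares. -/
def steenrodLinear (f : V →ₗ[ZMod 2] W) (h : ∀ n x, f (Sq n • x) = Sq n • f x) :
    V →ₗ[SteenrodAlgebra] W :=
  { f with map_smul' := map_smul_of_map_Sq_smul f h }

end SteenrodModules

/-! ### The diagonal action, its adjoint, and freeness of the tensor product -/

section Diagonal

open SteenrodAlgebra Finset

variable (N F B : Type*) [AddCommGroup N] [Module (ZMod 2) N] [Module SteenrodAlgebra N]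
  [IsScalarTower (ZMod 2) SteenrodAlgebra N] [AddCommGroup F] [Module (ZMod 2) F]
  [Module SteenrodAlgebra F] [IsScalarTower (ZMod 2) SteenrodAlgebra F]
  [AddCommGroup B] [Module (ZMod 2) B] [Module SteenrodAlgebra B]
  [IsScalarTower (ZMod 2) SteenrodAlgebra B]

theorem isBullettMacdonald_map {E : Type*} [Ring E] [Algebra (ZMod 2) E]
    (f : SteenrodAlgebra →ₗ[ZMod 2] E) (hf : ∀ a b, f (a * b) = f a * f b) :
    IsBullettMacdonald fun n => f (Sq n) := fun n => by
  simpa only [hf] using (isBullettMacdonald_Sq n).map f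

theorem cartanSq_eq_cauchyProduct (n : ℕ) : cartanSq N F n =
    cauchyProduct (E := Module.End (ZMod 2) (N ⊗[ZMod 2] F))
      (fun n => LinearMap.rTensor F (Algebra.lsmul (ZMod 2) (ZMod 2) N (Sq n)))
      (fun n => LinearMap.lTensor N (Algebra.lsmul (ZMod 2) (ZMod 2) F (Sq n))) n := by
  rw [cartanSq, cauchyProduct]
  refine Finset.sum_congr rfl fun p _ => ?_
  rw [Module.End.mul_eq_comp, LinearMap.rTensor_comp_lTensor]

/-- The Cartan formula is the Cauchy product of the actions on the two factors, which commute and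
each satisfy the relation. No binomial identity is needed. -/
theorem isBullettMacdonald_cartanSq :
    IsBullettMacdonald (E := Module.End (ZMod 2) (N ⊗[ZMod 2] F)) (cartanSq N F) := by
  rw [funext (cartanSq_eq_cauchyProduct N F)]
  apply IsBullettMacdonald.cauchyProduct
  · refine isBullettMacdonald_map (E := Module.End (ZMod 2) (N ⊗[ZMod 2] F))
      (LinearMap.rTensorHom F ∘ₗ (Algebra.lsmul (ZMod 2) (ZMod 2) N).toLinearMap) fun a b => ?_
    simp [Module.End.mul_eq_comp, LinearMap.rTensor_comp]
  · refine isBullettMacdonald_map (E := Module.End (ZMod 2) (N ⊗[ZMod 2] F))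
      (LinearMap.lTensorHom N ∘ₗ (Algebra.lsmul (ZMod 2) (ZMod 2) F).toLinearMap) fun a b => ?_
    simp [Module.End.mul_eq_comp, LinearMap.lTensor_comp]
  · intro i j
    rw [commute_iff_eq, Module.End.mul_eq_comp, Module.End.mul_eq_comp,
      LinearMap.rTensor_comp_lTensor, LinearMap.lTensor_comp_rTensor]

theorem cartanSq_zero : cartanSq N F 0 = LinearMap.id := by
  ext x y
  simp [cartanSq, Sq_zero]

/-- The diagonal action of `𝒜` on `N ⊗ F`. -/
def diagonalAction : SteenrodAlgebra →ₐ[ZMod 2] Module.End (ZMod 2) (N ⊗[ZMod 2] F) :=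
  SteenrodAlgebra.lift (cartanSq N F) (cartanSq_zero N F) (isBullettMacdonald_cartanSq N F)

/-- The tensor product `N ⊗ F` as an `𝒜`-module by the diagonal action. -/
def DiagonalTensor : Type _ := N ⊗[ZMod 2] F

instance : AddCommGroup (DiagonalTensor N F) := inferInstanceAs (AddCommGroup (N ⊗[ZMod 2] F))

instance : Module (ZMod 2) (DiagonalTensor N F) :=
  inferInstanceAs (Module (ZMod 2) (N ⊗[ZMod 2] F))

instance : Module SteenrodAlgebra (DiagonalTensor N F) :=
  letI : Module (Module.End (ZMod 2) (N ⊗[ZMod 2] F)) (DiagonalTensor N F) :=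
    inferInstanceAs (Module (Module.End (ZMod 2) (N ⊗[ZMod 2] F)) (N ⊗[ZMod 2] F))
  Module.compHom _ (diagonalAction N F).toRingHom

/-- The underlying tensor product. -/
def DiagonalTensor.equiv : DiagonalTensor N F ≃ₗ[ZMod 2] N ⊗[ZMod 2] F := LinearEquiv.refl _ _

theorem DiagonalTensor.smul_def (a : SteenrodAlgebra) (z : DiagonalTensor N F) :
    a • z = (diagonalAction N F a : N ⊗[ZMod 2] F →ₗ[ZMod 2] N ⊗[ZMod 2] F) z := rfl

instance : IsScalarTower (ZMod 2) SteenrodAlgebra (DiagonalTensor N F) where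
  smul_assoc c a x := by
    rw [DiagonalTensor.smul_def, map_smul]
    rfl

theorem DiagonalTensor.Sq_smul (n : ℕ) (z : DiagonalTensor N F) :
    equiv N F (Sq n • z) = cartanSq N F n (equiv N F z) := by
  rw [DiagonalTensor.smul_def, diagonalAction, lift_Sq]
  rfl

/-- The sequence of operators `h ↦ ∑ Sqⁱ ∘ h ∘ χ(Sqʲ)`, `i + j = n`. -/
def conjOperator : ℕ → Module.End (ZMod 2) (N →ₗ[ZMod 2] B) :=
  cauchyProduct
    (fun n => LinearMap.llcomp (ZMod 2) N B B (Algebra.lsmul (ZMod 2) (ZMod 2) B (Sq n)))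
    (fun n => LinearMap.lcomp (ZMod 2) B (Algebra.lsmul (ZMod 2) (ZMod 2) N (conjSq n)))

theorem conjOperator_apply (n : ℕ) (h : N →ₗ[ZMod 2] B) (x : N) :
    conjOperator N B n h x = ∑ p ∈ antidiagonal n, Sq p.1 • h (conjSq p.2 • x) := by
  simp [conjOperator, cauchyProduct, LinearMap.sum_apply]

/-- Precomposition reverses products, which undoes the reversal for `conjSq`; it commutes with
postcomposition. -/
theorem isBullettMacdonald_conjOperator : IsBullettMacdonald (conjOperator N B) := by
  apply IsBullettMacdonald.cauchyProduct
  · refine isBullettMacdonald_map (E := Module.End (ZMod 2) (N →ₗ[ZMod 2] B))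
      (LinearMap.llcomp (ZMod 2) N B B ∘ₗ (Algebra.lsmul (ZMod 2) (ZMod 2) B).toLinearMap)
      fun a b => ?_
    ext h x
    simp
  · intro n
    refine ((bullettMacdonald_conjSq n).map ((LinearMap.llcomp (ZMod 2) N N B).flip ∘ₗ
      (Algebra.lsmul (ZMod 2) (ZMod 2) N).toLinearMap)).congr fun a b _ => ?_
    ext h x
    simp
  · intro i j
    ext h x
    simp

theorem conjOperator_zero : conjOperator N B 0 = 1 := by
  ext h x
  simp [conjOperator_apply, Sq_zero, conjSq_zero]

/-- The linear maps `N → B` as an `𝒜`-module by conjugation. -/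
def ConjHom : Type _ := N →ₗ[ZMod 2] B

instance : AddCommGroup (ConjHom N B) := inferInstanceAs (AddCommGroup (N →ₗ[ZMod 2] B))

instance : Module (ZMod 2) (ConjHom N B) := inferInstanceAs (Module (ZMod 2) (N →ₗ[ZMod 2] B))

/-- The action of `𝒜` by conjugation. -/
def conjAction : SteenrodAlgebra →ₐ[ZMod 2] Module.End (ZMod 2) (N →ₗ[ZMod 2] B) :=
  SteenrodAlgebra.lift (conjOperator N B) (conjOperator_zero N B)
    (isBullettMacdonald_conjOperator N B)

instance : Module SteenrodAlgebra (ConjHom N B) :=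
  letI : Module (Module.End (ZMod 2) (N →ₗ[ZMod 2] B)) (ConjHom N B) :=
    inferInstanceAs (Module (Module.End (ZMod 2) (N →ₗ[ZMod 2] B)) (N →ₗ[ZMod 2] B))
  Module.compHom _ (conjAction N B).toRingHom

/-- The underlying linear map. -/
def ConjHom.equiv : ConjHom N B ≃ₗ[ZMod 2] (N →ₗ[ZMod 2] B) := LinearEquiv.refl _ _

theorem ConjHom.smul_def (a : SteenrodAlgebra) (z : ConjHom N B) :
    a • z = (conjAction N B a : (N →ₗ[ZMod 2] B) →ₗ[ZMod 2] (N →ₗ[ZMod 2] B)) z := rfl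

instance : IsScalarTower (ZMod 2) SteenrodAlgebra (ConjHom N B) where
  smul_assoc c a x := by
    rw [ConjHom.smul_def, map_smul]
    rfl

theorem ConjHom.Sq_smul (n : ℕ) (h : ConjHom N B) :
    equiv N B (Sq n • h) = conjOperator N B n (equiv N B h) := by
  rw [ConjHom.smul_def, conjAction, lift_Sq]
  rfl

/-- The element `x ⊗ y` of `N ⊗ F`. -/
def DiagonalTensor.tmul {N F : Type*} [AddCommGroup N] [Module (ZMod 2) N] [AddCommGroup F]
    [Module (ZMod 2) F] (x : N) (y : F) : DiagonalTensor N F := x ⊗ₜ[ZMod 2] y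

@[elab_as_elim]
theorem DiagonalTensor.induction_on {N F : Type*} [AddCommGroup N] [Module (ZMod 2) N]
    [AddCommGroup F] [Module (ZMod 2) F] {p : DiagonalTensor N F → Prop} (z : DiagonalTensor N F)
    (zero : p 0) (tmul : ∀ x y, p (tmul x y)) (add : ∀ z w, p z → p w → p (z + w)) : p z :=
  TensorProduct.induction_on (motive := p) z zero tmul add

variable {N F B}

-- Expanding the right side by the Cartan formula and regrouping leaves inner sums of `Sq i * conjSq
-- l` over fixed `i + l`. These vanish except in total degree `0`. This is the linearity of the
-- adjoint map.
omit [IsScalarTower (ZMod 2) SteenrodAlgebra B] in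
theorem map_tmul_Sq_smul (g : N ⊗[ZMod 2] F →ₗ[ZMod 2] B)
    (hg : ∀ n z, g (cartanSq N F n z) = Sq n • g z) (n : ℕ) (x : N) (y : F) :
    g (x ⊗ₜ (Sq n • y)) = ∑ p ∈ antidiagonal n, Sq p.1 • g ((conjSq p.2 • x) ⊗ₜ y) := by
  simp only [← hg, cartanSq, LinearMap.sum_apply, TensorProduct.map_tmul, Algebra.lsmul_coe,
    map_sum, ← mul_smul]
  symm
  have h' : ∀ (k : ℕ) (y : F), ∑ p ∈ antidiagonal k, g (((Sq p.1 * conjSq p.2) • x) ⊗ₜ[ZMod 2] y) =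
      if k = 0 then g (x ⊗ₜ y) else 0 := by
    intro k y
    rw [← map_sum, ← TensorProduct.sum_tmul, ← Finset.sum_smul,
      show ∑ p ∈ antidiagonal k, Sq p.1 * conjSq p.2 = _ from cauchyProduct_Sq_conjSq k]
    split_ifs <;> simp
  calc _ = ∑ p ∈ antidiagonal n, ∑ q ∈ antidiagonal p.1,
        g (((Sq q.2 * conjSq p.2) • x) ⊗ₜ (Sq q.1 • y)) := by
        refine Finset.sum_congr rfl fun p _ => ?_
        rw [← Finset.Nat.sum_antidiagonal_swap]
        rfl
    _ = _ := by
        rw [← sum_antidiagonal_assoc n fun j i l => g (((Sq i * conjSq l) • x) ⊗ₜ (Sq j • y))]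
        simp only [h']
        rw [Finset.sum_eq_single (n, 0)]
        · simp
        · rintro ⟨a, b⟩ hab hne
          rw [if_neg]
          rintro rfl
          exact hne (by simpa using hab)
        · simp

-- The converse, by the other inverse relation: here the inner sums are of `conjSq l * Sq i`.
omit [IsScalarTower (ZMod 2) SteenrodAlgebra B] in
theorem map_cartanSq (g : N ⊗[ZMod 2] F →ₗ[ZMod 2] B)
    (hg : ∀ n x y, g (x ⊗ₜ (Sq n • y)) =
      ∑ p ∈ antidiagonal n, Sq p.1 • g ((conjSq p.2 • x) ⊗ₜ y)) (n : ℕ) (z : N ⊗[ZMod 2] F) :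
    g (cartanSq N F n z) = Sq n • g z := by
  induction z using TensorProduct.induction_on with
  | zero => simp
  | add z w hz hw => rw [map_add, map_add, map_add, smul_add, hz, hw]
  | tmul x y =>
    have h' : ∀ (k : ℕ), ∑ p ∈ antidiagonal k, g (((conjSq p.1 * Sq p.2) • x) ⊗ₜ[ZMod 2] y) =
        if k = 0 then g (x ⊗ₜ y) else 0 := by
      intro k
      rw [← map_sum, ← TensorProduct.sum_tmul, ← Finset.sum_smul,
        show ∑ p ∈ antidiagonal k, conjSq p.1 * Sq p.2 = _ from cauchyProduct_conjSq_Sq k]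
      split_ifs <;> simp
    simp only [cartanSq, LinearMap.sum_apply, TensorProduct.map_tmul, Algebra.lsmul_coe,
      map_sum, hg, ← mul_smul]
    rw [← Finset.Nat.sum_antidiagonal_swap]
    simp only [Prod.fst_swap, Prod.snd_swap]
    rw [← sum_antidiagonal_assoc n fun j l i => Sq j • g (((conjSq l * Sq i) • x) ⊗ₜ y)]
    simp only [← Finset.smul_sum, h']
    rw [Finset.sum_eq_single (n, 0)]
    · simp
    · rintro ⟨a, b⟩ hab hne
      rw [if_neg, smul_zero]
      rintro rfl
      exact hne (by simpa using hab)
    · simp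

/-- The adjoint `F → Hom(N, B)` of an `𝒜`-linear map `N ⊗ F → B`. -/
def DiagonalTensor.curry (g : DiagonalTensor N F →ₗ[SteenrodAlgebra] B) :
    F →ₗ[SteenrodAlgebra] ConjHom N B :=
  steenrodLinear ((ConjHom.equiv N B).symm.toLinearMap ∘ₗ (TensorProduct.curry
      (g.restrictScalars (ZMod 2) ∘ₗ (DiagonalTensor.equiv N F).symm.toLinearMap)).flip)
    fun n y => by
      apply (ConjHom.equiv N B).injective
      rw [ConjHom.Sq_smul]
      refine LinearMap.ext fun x => ?_
      rw [conjOperator_apply]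
      refine map_tmul_Sq_smul
        (g.restrictScalars (ZMod 2) ∘ₗ (DiagonalTensor.equiv N F).symm.toLinearMap)
        (fun n z => ?_) n x y
      refine Eq.trans ?_ (g.map_smul (Sq n) ((DiagonalTensor.equiv N F).symm z))
      rw [LinearMap.comp_apply]
      refine congrArg g ((DiagonalTensor.equiv N F).injective ?_)
      rw [DiagonalTensor.Sq_smul]
      simp

theorem DiagonalTensor.curry_apply (g : DiagonalTensor N F →ₗ[SteenrodAlgebra] B) (y : F) (x : N) :
    ConjHom.equiv N B (DiagonalTensor.curry g y) x = g (tmul x y) := rfl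

/-- The `𝒜`-linear map `N ⊗ F → B` with a given adjoint `F → Hom(N, B)`. -/
def DiagonalTensor.uncurry (h : F →ₗ[SteenrodAlgebra] ConjHom N B) :
    DiagonalTensor N F →ₗ[SteenrodAlgebra] B :=
  steenrodLinear (TensorProduct.lift
      ((ConjHom.equiv N B).toLinearMap ∘ₗ h.restrictScalars (ZMod 2)).flip ∘ₗ
        (DiagonalTensor.equiv N F).toLinearMap)
    fun n z => by
      rw [LinearMap.comp_apply, LinearEquiv.coe_coe, DiagonalTensor.Sq_smul]
      refine map_cartanSq _ (fun n x y => ?_) n _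
      simp only [TensorProduct.lift.tmul, LinearMap.flip_apply, LinearMap.comp_apply,
        LinearEquiv.coe_coe, LinearMap.coe_restrictScalars, map_smul]
      rw [ConjHom.Sq_smul, conjOperator_apply]

theorem DiagonalTensor.uncurry_tmul (h : F →ₗ[SteenrodAlgebra] ConjHom N B) (x : N) (y : F) :
    DiagonalTensor.uncurry h (tmul x y) = ConjHom.equiv N B (h y) x := rfl

section Basis

variable {κ ι : Type*} (e : Basis κ (ZMod 2) N) (r : Basis ι SteenrodAlgebra F)

-- The adjoint is determined by its values on the `𝒜`-basis `r`, and each value, being `𝔽₂`-linear,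
-- by the basis `e`.
include e r in
theorem DiagonalTensor.hom_ext {g g' : DiagonalTensor N F →ₗ[SteenrodAlgebra] B}
    (h : ∀ k j, g (tmul (e k) (r j)) = g' (tmul (e k) (r j))) : g = g' := by
  have h1 : DiagonalTensor.curry g = DiagonalTensor.curry g' := by
    refine r.ext fun j => (ConjHom.equiv N B).injective ?_
    exact e.ext fun k => h k j
  refine LinearMap.ext fun z => ?_
  induction z using DiagonalTensor.induction_on with
  | zero => rw [map_zero, map_zero]
  | tmul x y => rw [← curry_apply, ← curry_apply, h1]
  | add z w hz hw => rw [map_add, map_add, hz, hw]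

/-- The `𝒜`-linear map with prescribed values on the `e k ⊗ r j`. -/
def DiagonalTensor.constr (c : κ → ι → B) : DiagonalTensor N F →ₗ[SteenrodAlgebra] B :=
  DiagonalTensor.uncurry (r.constr ℕ fun j =>
    (ConjHom.equiv N B).symm (e.constr ℕ fun k => c k j))

theorem DiagonalTensor.constr_tmul (c : κ → ι → B) (k : κ) (j : ι) :
    DiagonalTensor.constr e r c (tmul (e k) (r j)) = c k j := by
  rw [DiagonalTensor.constr, DiagonalTensor.uncurry_tmul, Basis.constr_basis,
    LinearEquiv.apply_symm_apply, Basis.constr_basis]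

/-- The `𝒜`-basis of `N ⊗ F` formed by the `e k ⊗ r j`. -/
def DiagonalTensor.basis : Basis (κ × ι) SteenrodAlgebra (DiagonalTensor N F) :=
  Basis.ofRepr (LinearEquiv.ofLinearMap
    (DiagonalTensor.constr e r fun k j => Finsupp.single (k, j) 1)
    (Finsupp.linearCombination SteenrodAlgebra fun p : κ × ι => tmul (e p.1) (r p.2))
    (by
      ext p : 2
      simp only [LinearMap.comp_apply, Finsupp.lsingle_apply,
        Finsupp.linearCombination_single, one_smul, LinearMap.id_apply, constr_tmul])
    (by
      -- No direct spanning argument is needed: by the adjunction, an endomorphism fixing every `e k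
      -- ⊗ r j` is the identity.
      refine DiagonalTensor.hom_ext e r fun k j => ?_
      rw [LinearMap.comp_apply, DiagonalTensor.constr_tmul]
      simp only [Finsupp.linearCombination_single, one_smul, LinearMap.id_apply]))

theorem DiagonalTensor.basis_apply (p : κ × ι) :
    DiagonalTensor.basis e r p = tmul (e p.1) (r p.2) := by
  refine ((DiagonalTensor.basis e r).repr_symm_single_one p).symm.trans ?_
  refine (Finsupp.linearCombination_single _ _ _).trans (one_smul _ _)

end Basis

end Diagonal

/-- Moving the action of `a` to the first factor by conjugation. -/
theorem exists_conj_smul (a : SteenrodAlgebra) : ∃ a' : SteenrodAlgebra,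
    ∀ {N : Type v} {F : Type w} [AddCommGroup N] [Module (ZMod 2) N] [Module SteenrodAlgebra N]
      [IsScalarTower (ZMod 2) SteenrodAlgebra N] [AddCommGroup F] [Module (ZMod 2) F]
      [Module SteenrodAlgebra F] [IsScalarTower (ZMod 2) SteenrodAlgebra F]
      (f : N ⊗[ZMod 2] F →ₗ[ZMod 2] ZMod 2),
      (∀ n z, f (cartanSq N F n z) = Sq n • f z) →
        ∀ x y, f (x ⊗ₜ (a • y)) = f ((a' • x) ⊗ₜ y) := by
  induction a using SteenrodAlgebra.induction_on with
  | scalar c =>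
    refine ⟨algebraMap _ _ c, fun f _ x y => ?_⟩
    rw [algebraMap_smul, algebraMap_smul, TensorProduct.tmul_smul, TensorProduct.smul_tmul']
  | sq n =>
    refine ⟨SteenrodAlgebra.conjSq n, fun f hf x y => ?_⟩
    -- Squares of positive degree act by zero on `𝔽₂`, so only the term with `Sq 0` outside
    -- survives.
    rw [map_tmul_Sq_smul f hf, Finset.sum_eq_single (0, n)]
    · simp [SteenrodAlgebra.Sq_zero]
    · rintro ⟨i, j⟩ hij hne
      rw [SteenrodAlgebra.smul_zmod, SteenrodAlgebra.augmentation_Sq, if_neg, zero_mul]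
      rintro rfl
      exact hne (by simpa using hij)
    · simp
  | mul a b ha hb =>
    obtain ⟨a', ha⟩ := ha
    obtain ⟨b', hb⟩ := hb
    refine ⟨b' * a', fun f hf x y => ?_⟩
    rw [mul_smul, ha f hf, hb f hf, mul_smul]
  | add a b ha hb =>
    obtain ⟨a', ha⟩ := ha
    obtain ⟨b', hb⟩ := hb
    refine ⟨a' + b', fun f hf x y => ?_⟩
    rw [add_smul, add_smul, TensorProduct.tmul_add, TensorProduct.add_tmul, map_add, map_add,
      ha f hf, hb f hf]

@[elab_as_elim]
theorem basis_induction_on {R V ι : Type*} [Semiring R] [AddCommMonoid V] [Module R V]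
    (b : Basis ι R V) {motive : V → Prop} (x : V) (basis : ∀ j, motive (b j)) (zero : motive 0)
    (add : ∀ x y, motive x → motive y → motive (x + y))
    (smul : ∀ (c : R) x, motive x → motive (c • x)) : motive x :=
  Submodule.span_induction (p := fun x _ => motive x) (by rintro _ ⟨j, rfl⟩; exact basis j) zero
    (fun x y _ _ hx hy => add x y hx hy) (fun c x _ hx => smul c x hx) (b.mem_span x)

/-! ### Homogeneous components and graded maps out of free modules -/

section GradedPart

variable {V : Type*} [AddCommGroup V] [Module (ZMod 2) V] {𝓥 : ℤ → Submodule (ZMod 2) V}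

/-- The homogeneous component of degree `p`. -/
def gradedPart (h : DirectSum.IsInternal 𝓥) (p : ℤ) : V →ₗ[ZMod 2] V :=
  (𝓥 p).subtype ∘ₗ DirectSum.component (ZMod 2) ℤ (fun p => 𝓥 p) p ∘ₗ
    (LinearEquiv.ofBijective (DirectSum.coeLinearMap 𝓥) h).symm.toLinearMap

theorem gradedPart_mem (h : DirectSum.IsInternal 𝓥) (p : ℤ) (x : V) : gradedPart h p x ∈ 𝓥 p :=
  Subtype.property _

theorem ofBijective_symm_of_mem (h : DirectSum.IsInternal 𝓥) {p : ℤ} {x : V} (hx : x ∈ 𝓥 p) :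
    (LinearEquiv.ofBijective (DirectSum.coeLinearMap 𝓥) h).symm x =
      DirectSum.lof (ZMod 2) ℤ (fun p => 𝓥 p) p ⟨x, hx⟩ := by
  rw [LinearEquiv.symm_apply_eq]
  exact (DirectSum.coeLinearMap_lof (R := ZMod 2) 𝓥 p ⟨x, hx⟩).symm

theorem gradedPart_of_mem (h : DirectSum.IsInternal 𝓥) {p : ℤ} {x : V} (hx : x ∈ 𝓥 p) :
    gradedPart h p x = x := by
  simp only [gradedPart, LinearMap.comp_apply, LinearEquiv.coe_coe, ofBijective_symm_of_mem h hx,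
    DirectSum.component.lof_self, Submodule.subtype_apply]

theorem gradedPart_of_mem_ne (h : DirectSum.IsInternal 𝓥) {p q : ℤ} {x : V} (hx : x ∈ 𝓥 q)
    (hpq : q ≠ p) : gradedPart h p x = 0 := by
  simp only [gradedPart, LinearMap.comp_apply, LinearEquiv.coe_coe, ofBijective_symm_of_mem h hx]
  rw [DirectSum.component.of, dif_neg hpq, map_zero]

theorem homogeneous_induction (h : DirectSum.IsInternal 𝓥) {motive : V → Prop} (x : V)
    (homogeneous : ∀ p, ∀ x ∈ 𝓥 p, motive x)
    (add : ∀ x y, motive x → motive y → motive (x + y)) : motive x := by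
  have hx : x ∈ ⨆ p, 𝓥 p := by rw [h.submodule_iSup_eq_top]; trivial
  induction hx using Submodule.iSup_induction' with
  | mem p x hx => exact homogeneous p x hx
  | zero => exact homogeneous 0 0 (Submodule.zero_mem _)
  | add x y _ _ hx hy => exact add x y hx hy

/-- Stated for additive maps, so that it covers `𝒜`-linear maps and multiplication by a Steenrod
square alike. -/
theorem gradedPart_map {W : Type*} [AddCommGroup W] [Module (ZMod 2) W]
    {𝓦 : ℤ → Submodule (ZMod 2) W} (h : DirectSum.IsInternal 𝓥) (h' : DirectSum.IsInternal 𝓦)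
    {F : Type*} [FunLike F V W] [AddMonoidHomClass F V W] (f : F) (d : ℤ)
    (hf : ∀ p, ∀ x ∈ 𝓥 p, f x ∈ 𝓦 (p + d)) (p : ℤ) (x : V) :
    gradedPart h' (p + d) (f x) = f (gradedPart h p x) := by
  induction x using homogeneous_induction h with
  | homogeneous q x hx =>
    rcases eq_or_ne q p with rfl | hne
    · rw [gradedPart_of_mem h hx, gradedPart_of_mem h' (hf _ x hx)]
    · rw [gradedPart_of_mem_ne h hx hne, map_zero,
        gradedPart_of_mem_ne h' (hf _ x hx) (by omega)]
  | add x y hx hy => simp only [map_add, hx, hy]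

/-- A coordinate at `k` can be nonzero only on vectors of degree `dim k`, so a vector lying both in
`𝓥 p` and in the sum of the other pieces has no nonzero coordinate. -/
theorem isInternal_of_basis {κ : Type*} (b : Basis κ (ZMod 2) V) (dim : κ → ℤ)
    (hb : ∀ k, b k ∈ 𝓥 (dim k)) (h : ∀ p, ∀ x ∈ 𝓥 p, ∀ k, b.repr x k ≠ 0 → dim k = p) :
    DirectSum.IsInternal 𝓥 := by
  classical
  rw [DirectSum.isInternal_submodule_iff_iSupIndep_and_iSup_eq_top]
  constructor
  · intro p
    rw [Submodule.disjoint_def]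
    intro x hx hx'
    have key : ∀ k, dim k = p → b.repr x k = 0 := by
      intro k hk
      have hle : (⨆ (q : ℤ) (_ : q ≠ p), 𝓥 q) ≤ LinearMap.ker (b.coord k) := by
        refine iSup₂_le fun q hq y hy => ?_
        rw [LinearMap.mem_ker, Basis.coord_apply]
        by_contra hne
        exact hq ((h q y hy k hne).symm.trans hk)
      exact hle hx'
    apply b.repr.injective
    rw [map_zero]
    ext k
    by_contra hne
    exact hne (key k (h p x hx k hne))
  · rw [eq_top_iff, ← b.span_eq, Submodule.span_le]
    rintro _ ⟨k, rfl⟩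
    exact Submodule.mem_iSup_of_mem (dim k) (hb k)

theorem repr_ne_zero_of_mem {κ : Type*} (b : Basis κ (ZMod 2) V) (dim : κ → ℤ)
    (h : DirectSum.IsInternal 𝓥) (hb : ∀ k, b k ∈ 𝓥 (dim k)) {p : ℤ} {x : V} (hx : x ∈ 𝓥 p) {k : κ}
    (hk : b.repr x k ≠ 0) : dim k = p := by
  classical
  have key : ∀ x : V, dim k ≠ p → b.repr (gradedPart h p x) k = 0 := by
    intro x hne
    induction x using basis_induction_on b with
    | zero => simp
    | add x y hx hy => simp [hx, hy]
    | smul c x hx => simp [hx]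
    | basis j =>
      rcases eq_or_ne (dim j) p with hj | hj
      · rw [gradedPart_of_mem h (hj ▸ hb j), b.repr_self, Finsupp.single_apply, if_neg]
        rintro rfl
        exact hne hj
      · rw [gradedPart_of_mem_ne h (hb j) hj]
        simp
  by_contra hne
  exact hk (by rw [← gradedPart_of_mem h hx, key x hne])

end GradedPart

section GradedSteenrod

variable {V W : Type*} [AddCommGroup V] [Module (ZMod 2) V] [Module SteenrodAlgebra V]
  [IsScalarTower (ZMod 2) SteenrodAlgebra V] [AddCommGroup W] [Module (ZMod 2) W]
  [Module SteenrodAlgebra W] [IsScalarTower (ZMod 2) SteenrodAlgebra W]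
  {𝓥 : ℤ → Submodule (ZMod 2) V} {𝓦 : ℤ → Submodule (ZMod 2) W}

omit [IsScalarTower (ZMod 2) SteenrodAlgebra V] in
theorem gradedPart_Sq_smul (h : IsGradedSteenrodModule 𝓥) (n : ℕ) (p : ℤ) (x : V) :
    gradedPart h.isInternal p (Sq n • x) = Sq n • gradedPart h.isInternal (p - n) x := by
  have := gradedPart_map h.isInternal h.isInternal (DistribSMul.toAddMonoidHom V (Sq n)) n
    (fun p x hx => h.sq_smul_mem n p x hx) (p - n) x
  rwa [sub_add_cancel] at this

/-- An `𝒜`-linear map out of a free module is graded if it respects the degrees of generators. -/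
theorem map_mem_of_generators (h : IsGradedSteenrodModule 𝓥) (h' : IsGradedSteenrodModule 𝓦)
    {ι : Type*} (b : Basis ι SteenrodAlgebra V) (deg : ι → ℤ) (hb : ∀ j, b j ∈ 𝓥 (deg j))
    (f : V →ₗ[SteenrodAlgebra] W) (hf : ∀ j, f (b j) ∈ 𝓦 (deg j)) (p : ℤ) (x : V)
    (hx : x ∈ 𝓥 p) : f x ∈ 𝓦 p := by
  -- Commuting with all projections makes sense for arbitrary vectors, so it can be proved by
  -- induction over the basis and then over the generators of `𝒜`, without a grading on `𝒜` itself.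
  have key : ∀ y p, f (gradedPart h.isInternal p y) = gradedPart h'.isInternal p (f y) := by
    intro y
    induction y using basis_induction_on b with
    | zero => simp
    | add x y hx hy => simp [hx, hy]
    | basis j =>
      intro p
      rcases eq_or_ne (deg j) p with rfl | hj
      · rw [gradedPart_of_mem _ (hb j), gradedPart_of_mem _ (hf j)]
      · rw [gradedPart_of_mem_ne _ (hb j) hj, gradedPart_of_mem_ne _ (hf j) hj, map_zero]
    | smul a y hy =>
      induction a using SteenrodAlgebra.induction_on generalizing y with
      | scalar c =>
        intro p
        rw [algebraMap_smul, map_smul, LinearMap.map_smul_of_tower, LinearMap.map_smul_of_tower, map_smul, hy]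
      | sq n =>
        intro p
        rw [gradedPart_Sq_smul h, map_smul, map_smul, hy, gradedPart_Sq_smul h']
      | mul a b ha hb =>
        rw [mul_smul]
        exact ha _ (hb _ hy)
      | add a b ha hb =>
        intro p
        rw [add_smul, map_add, map_add, map_add, map_add, ha _ hy, hb _ hy]
  rw [← gradedPart_of_mem h.isInternal hx, key]
  exact gradedPart_mem _ _ _

/-- Lifting a graded map out of a free module. -/
theorem exists_graded_lift {U : Type*} [AddCommGroup U] [Module (ZMod 2) U]
    [Module SteenrodAlgebra U] [IsScalarTower (ZMod 2) SteenrodAlgebra U]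
    {𝓤 : ℤ → Submodule (ZMod 2) U}
    (h : IsGradedSteenrodModule 𝓥) (h' : IsGradedSteenrodModule 𝓦)
    (h'' : DirectSum.IsInternal 𝓤)
    {ι : Type*} (b : Basis ι SteenrodAlgebra V) (deg : ι → ℤ) (hb : ∀ j, b j ∈ 𝓥 (deg j))
    (α : V →ₗ[SteenrodAlgebra] U) (hα : ∀ p, ∀ x ∈ 𝓥 p, α x ∈ 𝓤 p)
    (β : W →ₗ[SteenrodAlgebra] U) (hβ : ∀ p, ∀ x ∈ 𝓦 p, β x ∈ 𝓤 p)
    (hαβ : ∀ x, ∃ y, β y = α x) :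
    ∃ γ : V →ₗ[SteenrodAlgebra] W, (∀ p, ∀ x ∈ 𝓥 p, γ x ∈ 𝓦 p) ∧ ∀ x, β (γ x) = α x := by
  have hex : ∀ j, ∃ y ∈ 𝓦 (deg j), β y = α (b j) := by
    intro j
    obtain ⟨y, hy⟩ := hαβ (b j)
    -- A preimage need not be homogeneous, but its component of degree `deg j` is again a preimage.
    refine ⟨gradedPart h'.isInternal (deg j) y, gradedPart_mem _ _ _, ?_⟩
    have := gradedPart_map h'.isInternal h'' β 0 (by simpa using hβ) (deg j) y
    rw [← this, add_zero, hy, gradedPart_of_mem _ (hα _ _ (hb j))]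
  choose y hy hy' using hex
  refine ⟨b.constr ℕ y, map_mem_of_generators h h' b deg hb _ fun j => ?_, fun x => ?_⟩
  · rw [Basis.constr_basis]
    exact hy j
  · have : β ∘ₗ b.constr ℕ y = α := b.ext fun j => by
      rw [LinearMap.comp_apply, Basis.constr_basis, hy']
    exact LinearMap.congr_fun this x

end GradedSteenrod

/-- Recursion with an invariant `good` that makes the next choice possible; it builds both the chain
maps and the homotopies. -/
theorem exists_dependent_sequence {α : ℕ → Type*} (good : ∀ i, α i → Prop)
    (rel : ∀ i, α i → α (i + 1) → Prop) (a₀ : α 0) (h₀ : good 0 a₀)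
    (step : ∀ i a, good i a → ∃ a', good (i + 1) a' ∧ rel i a a') :
    ∃ f : ∀ i, α i, f 0 = a₀ ∧ ∀ i, good i (f i) ∧ rel i (f i) (f (i + 1)) := by
  choose next hgood hrel using step
  let f : ∀ i, {a : α i // good i a} := fun i =>
    Nat.rec ⟨a₀, h₀⟩ (fun i a => ⟨next i a.1 a.2, hgood i a.1 a.2⟩) i
  exact ⟨fun i => (f i).1, rfl, fun i => ⟨(f i).2, hrel i (f i).1 (f i).2⟩⟩

/-! ### Maps on cohomology, and independence of `Ext` from the resolution -/

section Cohomology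

variable {X X' : ℕ → Type*} [∀ i, AddCommGroup (X i)] [∀ i, Module (ZMod 2) (X i)]
  [∀ i, AddCommGroup (X' i)] [∀ i, Module (ZMod 2) (X' i)]
  (δ : ∀ i, X i →ₗ[ZMod 2] X (i + 1)) (δ' : ∀ i, X' i →ₗ[ZMod 2] X' (i + 1))

variable {δ δ'} in
theorem map_coboundaries (α : ∀ i, X i →ₗ[ZMod 2] X' i)
    (hα : ∀ i x, α (i + 1) (δ i x) = δ' i (α i x)) (s : ℕ) {x : X s} (hx : x ∈ coboundaries δ s) :
    α s x ∈ coboundaries δ' s := by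
  cases s with
  | zero =>
    obtain rfl : x = 0 := hx
    rw [map_zero]
    exact Submodule.zero_mem _
  | succ s =>
    obtain ⟨y, rfl⟩ := hx
    exact ⟨α s y, (hα s y).symm⟩

/-- The map on cohomology induced by a cochain map. -/
def cohomologyMap (α : ∀ i, X i →ₗ[ZMod 2] X' i)
    (hα : ∀ i x, α (i + 1) (δ i x) = δ' i (α i x)) (s : ℕ) :
    Cohomology δ s →ₗ[ZMod 2] Cohomology δ' s :=
  Submodule.mapQ _ _ ((α s).restrict (p := cocycles δ s) (q := cocycles δ' s) fun x hx => by
    rw [LinearMap.mem_ker] at hx ⊢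
    rw [← hα, hx, map_zero]) fun _ hx => map_coboundaries α hα s hx

theorem nonempty_cohomology_equiv (α : ∀ i, X i →ₗ[ZMod 2] X' i)
    (hα : ∀ i x, α (i + 1) (δ i x) = δ' i (α i x)) (β : ∀ i, X' i →ₗ[ZMod 2] X i)
    (hβ : ∀ i x, β (i + 1) (δ' i x) = δ i (β i x)) (s : ℕ)
    (hβα : ∀ x, δ s x = 0 → β s (α s x) - x ∈ coboundaries δ s)
    (hαβ : ∀ x, δ' s x = 0 → α s (β s x) - x ∈ coboundaries δ' s) :
    Nonempty (Cohomology δ s ≃ₗ[ZMod 2] Cohomology δ' s) := by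
  refine ⟨LinearEquiv.ofLinearMap (cohomologyMap δ δ' α hα s) (cohomologyMap δ' δ β hβ s) ?_ ?_⟩
  · refine LinearMap.ext fun z => ?_
    obtain ⟨⟨x, hx⟩, rfl⟩ := Submodule.Quotient.mk_surjective _ z
    exact (Submodule.Quotient.eq _).2 (hαβ x hx)
  · refine LinearMap.ext fun z => ?_
    obtain ⟨⟨x, hx⟩, rfl⟩ := Submodule.Quotient.mk_surjective _ z
    exact (Submodule.Quotient.eq _).2 (hβα x hx)

end Cohomology

section Comparison

variable {N : Type*} [AddCommGroup N] [Module (ZMod 2) N] [Module SteenrodAlgebra N]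
  [IsScalarTower (ZMod 2) SteenrodAlgebra N] {𝓝 : ℤ → Submodule (ZMod 2) N}

/-- Lift over generators degree by degree. The invariant is that `φ ∘ d` takes values in the image
of the next differential of `P'`; exactness renews it. -/
theorem GradedFreeResolution.exists_chainMap (hN : DirectSum.IsInternal 𝓝)
    (P : GradedFreeResolution.{v, w} 𝓝) (P' : GradedFreeResolution.{v', w'} 𝓝) :
    ∃ φ : ∀ i, P.obj i →ₗ[SteenrodAlgebra] P'.obj i,
      (∀ i p, ∀ x ∈ P.grading i p, φ i x ∈ P'.grading i p) ∧
      (∀ x, P'.aug (φ 0 x) = P.aug x) ∧ ∀ i x, P'.d i (φ (i + 1) x) = φ i (P.d i x) := by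
  obtain ⟨φ₀, hφ₀, hφ₀'⟩ := exists_graded_lift (P.isGraded 0) (P'.isGraded 0) hN (P.gen 0)
    (P.deg 0) (P.gen_mem 0) P.aug P.aug_mem P'.aug P'.aug_mem fun x => P'.aug_surjective _
  obtain ⟨φ, h0, h⟩ := exists_dependent_sequence
    (α := fun i => P.obj i →ₗ[SteenrodAlgebra] P'.obj i)
    (fun i φ => (∀ p, ∀ x ∈ P.grading i p, φ x ∈ P'.grading i p) ∧
      ∀ x, ∃ y, P'.d i y = φ (P.d i x))
    (fun i φ φ' => ∀ x, P'.d i (φ' x) = φ (P.d i x)) φ₀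
    ⟨hφ₀, fun x => (P'.exact_zero _).1 (by rw [hφ₀', (P.exact_zero _).2 ⟨x, rfl⟩])⟩
    (fun i φ hφ => by
      obtain ⟨φ', h1, h2⟩ := exists_graded_lift (P.isGraded (i + 1)) (P'.isGraded (i + 1))
        (P'.isGraded i).isInternal (P.gen (i + 1)) (P.deg (i + 1)) (P.gen_mem (i + 1))
        (φ ∘ₗ P.d i) (fun p x hx => hφ.1 p _ (P.d_mem i p x hx)) (P'.d i) (P'.d_mem i) hφ.2
      refine ⟨φ', ⟨h1, fun x => (P'.exact i _).1 ?_⟩, h2⟩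
      rw [h2, LinearMap.comp_apply, (P.exact i _).2 ⟨x, rfl⟩, map_zero])
  exact ⟨φ, fun i => (h i).1.1, fun x => by rw [h0, hφ₀'], fun i => (h i).2⟩

-- The invariant `d ∘ h ∘ d = θ ∘ d` says that `θ - h ∘ d` lands in cycles at the next stage, hence
-- lifts through the differential.
omit [IsScalarTower (ZMod 2) SteenrodAlgebra N] in
theorem GradedFreeResolution.exists_homotopy (P : GradedFreeResolution.{v, w} 𝓝)
    (θ : ∀ i, P.obj i →ₗ[SteenrodAlgebra] P.obj i)
    (hgr : ∀ i p, ∀ x ∈ P.grading i p, θ i x ∈ P.grading i p)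
    (haug : ∀ x, P.aug (θ 0 x) = 0) (hd : ∀ i x, P.d i (θ (i + 1) x) = θ i (P.d i x)) :
    ∃ h : ∀ i, P.obj i →ₗ[SteenrodAlgebra] P.obj (i + 1),
      (∀ i p, ∀ x ∈ P.grading i p, h i x ∈ P.grading (i + 1) p) ∧
      (∀ x, θ 0 x = P.d 0 (h 0 x)) ∧
      ∀ i x, θ (i + 1) x = P.d (i + 1) (h (i + 1) x) + h i (P.d i x) := by
  obtain ⟨h₀, hh₀, hh₀'⟩ := exists_graded_lift (P.isGraded 0) (P.isGraded 1)
    (P.isGraded 0).isInternal (P.gen 0) (P.deg 0) (P.gen_mem 0) (θ 0) (hgr 0) (P.d 0) (P.d_mem 0)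
    fun x => (P.exact_zero _).1 (haug x)
  obtain ⟨h, h0, h'⟩ := exists_dependent_sequence
    (α := fun i => P.obj i →ₗ[SteenrodAlgebra] P.obj (i + 1))
    (fun i h => (∀ p, ∀ x ∈ P.grading i p, h x ∈ P.grading (i + 1) p) ∧
      ∀ x, P.d i (h (P.d i x)) = θ i (P.d i x))
    (fun i h h' => ∀ x, P.d (i + 1) (h' x) = θ (i + 1) x - h (P.d i x)) h₀
    ⟨hh₀, fun x => by rw [hh₀']⟩
    (fun i h hh => by
      obtain ⟨h', h1, h2⟩ := exists_graded_lift (P.isGraded (i + 1)) (P.isGraded (i + 2))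
        (P.isGraded (i + 1)).isInternal (P.gen (i + 1)) (P.deg (i + 1)) (P.gen_mem (i + 1))
        (θ (i + 1) - h ∘ₗ P.d i) (fun p x hx => Submodule.sub_mem _ (hgr _ p x hx)
          (hh.1 p _ (P.d_mem i p x hx))) (P.d (i + 1)) (P.d_mem (i + 1))
        (fun x => (P.exact i _).1 (by
          rw [LinearMap.sub_apply, map_sub, hd, LinearMap.comp_apply, hh.2, sub_self]))
      refine ⟨h', ⟨h1, fun x => ?_⟩, h2⟩
      rw [h2, LinearMap.sub_apply, LinearMap.comp_apply, (P.exact i _).2 ⟨x, rfl⟩, map_zero,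
        sub_zero])
  refine ⟨h, fun i => (h' i).1.1, fun x => by rw [h0, hh₀'], fun i x => ?_⟩
  rw [(h' i).2, sub_add_cancel]

/-- Composition with a graded `𝒜`-linear map. -/
def resolutionHomPrecomp {N' : Type*} [AddCommGroup N'] [Module (ZMod 2) N']
    [Module SteenrodAlgebra N'] {𝓝' : ℤ → Submodule (ZMod 2) N'}
    (P : GradedFreeResolution.{v, w} 𝓝) (P' : GradedFreeResolution.{v', w'} 𝓝') (t : ℤ)
    {i j : ℕ} (φ : P.obj i →ₗ[SteenrodAlgebra] P'.obj j)
    (hφ : ∀ p, ∀ x ∈ P.grading i p, φ x ∈ P'.grading j p) :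
    resolutionHom P' t j →ₗ[ZMod 2] resolutionHom P t i :=
  (LinearMap.lcomp (ZMod 2) (ZMod 2) (φ.restrictScalars (ZMod 2))).restrict (by
    rintro f ⟨hf, hf'⟩
    refine ⟨fun a x => ?_, fun p hp x hx => ?_⟩
    · simp [hf]
    · simpa using hf' p hp _ (hφ p x hx))

omit [IsScalarTower (ZMod 2) SteenrodAlgebra N] in
theorem resolutionHomD_apply (P : GradedFreeResolution.{v, w} 𝓝) (t : ℤ) (i : ℕ)
    (f : resolutionHom P t i) (x : P.obj (i + 1)) :
    (resolutionHomD P t i f).1 x = f.1 (P.d i x) := rfl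

-- Apply the homotopy `h` to `φ - id`. A cocycle `f` kills the summand `d ∘ h`, so the difference is
-- the coboundary of `f ∘ h`. In degree `0` that summand is all there is, and the difference
-- vanishes.
omit [IsScalarTower (ZMod 2) SteenrodAlgebra N] in
theorem resolutionHom_homotopy (P : GradedFreeResolution.{v, w} 𝓝)
    (φ : ∀ i, P.obj i →ₗ[SteenrodAlgebra] P.obj i)
    (hgr : ∀ i p, ∀ x ∈ P.grading i p, φ i x ∈ P.grading i p)
    (haug : ∀ x, P.aug (φ 0 x) = P.aug x) (hd : ∀ i x, P.d i (φ (i + 1) x) = φ i (P.d i x))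
    (t : ℤ) (s : ℕ) (f : resolutionHom P t s) (hf : resolutionHomD P t s f = 0) :
    resolutionHomPrecomp P P t (φ s) (hgr s) f - f ∈
      coboundaries (X := fun i => ↥(resolutionHom P t i)) (resolutionHomD P t) s := by
  obtain ⟨h, hh, h0, h1⟩ := P.exists_homotopy (fun i => φ i - LinearMap.id)
    (fun i p x hx => Submodule.sub_mem _ (hgr i p x hx) hx)
    (fun x => by simp [haug]) (fun i x => by simp [hd])
  have hf' : ∀ x, f.1 (P.d s x) = 0 := fun x => by rw [← resolutionHomD_apply, hf]; rfl
  cases s with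
  | zero =>
    refine Subtype.ext (LinearMap.ext fun x => ?_)
    change f.1 (φ 0 x) - f.1 x = 0
    rw [← map_sub]
    exact (congrArg f.1 (h0 x)).trans (hf' _)
  | succ s =>
    refine ⟨resolutionHomPrecomp P P t (h s) (hh s) f, Subtype.ext (LinearMap.ext fun x => ?_)⟩
    change f.1 (h s (P.d s x)) = f.1 (φ (s + 1) x) - f.1 x
    rw [← map_sub]
    refine Eq.trans ?_ (congrArg f.1 (h1 s x)).symm
    rw [map_add, hf', zero_add]

/-- `Ext` does not depend on the resolution. -/
theorem nonempty_steenrodExt_equiv (hN : DirectSum.IsInternal 𝓝)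
    (P : GradedFreeResolution.{v, w} 𝓝) (P' : GradedFreeResolution.{v', w'} 𝓝) (s : ℕ) (t : ℤ) :
    Nonempty (SteenrodExt P s t ≃ₗ[ZMod 2] SteenrodExt P' s t) := by
  obtain ⟨φ, hφ, hφ0, hφd⟩ := GradedFreeResolution.exists_chainMap hN P P'
  obtain ⟨ψ, hψ, hψ0, hψd⟩ := GradedFreeResolution.exists_chainMap hN P' P
  refine nonempty_cohomology_equiv (X := fun i => ↥(resolutionHom P t i))
    (X' := fun i => ↥(resolutionHom P' t i)) _ _
    (fun i => resolutionHomPrecomp P' P t (ψ i) (hψ i)) (fun i f => ?_)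
    (fun i => resolutionHomPrecomp P P' t (φ i) (hφ i)) (fun i f => ?_) s (fun f hf => ?_)
    (fun f hf => ?_)
  · refine Subtype.ext (LinearMap.ext fun x => ?_)
    exact congrArg f.1 (hψd i x)
  · refine Subtype.ext (LinearMap.ext fun x => ?_)
    exact congrArg f.1 (hφd i x)
  · exact resolutionHom_homotopy P (fun i => ψ i ∘ₗ φ i)
      (fun i p x hx => hψ i p _ (hφ i p x hx)) (fun x => by simp [hφ0, hψ0])
      (fun i x => by simp [hφd, hψd]) t s f hf
  · exact resolutionHom_homotopy P' (fun i => φ i ∘ₗ ψ i)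
      (fun i p x hx => hφ i p _ (hψ i p x hx)) (fun x => by simp [hφ0, hψ0])
      (fun i x => by simp [hφd, hψd]) t s f hf

end Comparison

/-! ### The dual basis of the homomorphisms out of a free module -/

section ResolutionBasis

/-- With `𝔽₂` placed in degree `t`, maps vanishing outside degree `t` become degree-preserving maps,
so `map_mem_of_generators` applies to them. -/
theorem isGradedSteenrodModule_concentrated (t : ℤ) :
    IsGradedSteenrodModule (M := ZMod 2) fun p => if p = t then ⊤ else ⊥ where
  isInternal := by
    refine isInternal_of_basis (Basis.singleton Unit (ZMod 2)) (fun _ => t) (fun _ => ?_)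
      fun p x hx k hk => ?_
    · rw [if_pos rfl]
      trivial
    · by_contra hne
      rw [if_neg (Ne.symm hne)] at hx
      obtain rfl : x = 0 := hx
      simp at hk
  sq_smul_mem i p x hx := by
    rw [SteenrodAlgebra.smul_zmod, SteenrodAlgebra.augmentation_Sq]
    rcases eq_or_ne i 0 with rfl | hi
    · simpa using hx
    · rw [if_neg hi, zero_mul]
      exact Submodule.zero_mem _

variable {N : Type*} [AddCommGroup N] [Module (ZMod 2) N] [Module SteenrodAlgebra N]
  {𝓝 : ℤ → Submodule (ZMod 2) N} (P : GradedFreeResolution.{v, w} 𝓝) (t : ℤ) (i : ℕ)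

/-- The values of a map `P_i → 𝔽₂` on the generators of degree `t`. -/
def resolutionHomEval :
    resolutionHom P t i →ₗ[ZMod 2] ({j : P.idx i // P.deg i j = t} → ZMod 2) where
  toFun f j := f.1 (P.gen i j)
  map_add' _ _ := rfl
  map_smul' _ _ := rfl

theorem resolutionHomEval_bijective : Function.Bijective (resolutionHomEval P t i) := by
  classical
  constructor
  · rw [injective_iff_map_eq_zero]
    intro f hf
    refine Subtype.ext (LinearMap.ext fun x => ?_)
    change f.1 x = 0
    induction x using basis_induction_on (P.gen i) with
    | basis j =>
      rcases eq_or_ne (P.deg i j) t with hj | hj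
      · exact congrFun hf ⟨j, hj⟩
      · exact f.2.2 _ hj _ (P.gen_mem i j)
    | zero => exact map_zero _
    | add x y hx hy => rw [map_add, hx, hy, add_zero]
    | smul a x hx => rw [f.2.1, hx, smul_zero]
  · intro c
    let g : P.obj i →ₗ[SteenrodAlgebra] ZMod 2 :=
      (P.gen i).constr ℕ fun j => if h : P.deg i j = t then c ⟨j, h⟩ else 0
    have hg := map_mem_of_generators (P.isGraded i) (isGradedSteenrodModule_concentrated t)
      (P.gen i) (P.deg i) (P.gen_mem i) g fun j => by
        rw [Basis.constr_basis]
        split_ifs <;> trivial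
    refine ⟨⟨g.restrictScalars (ZMod 2), fun a x => g.map_smul a x, fun p hp x hx => ?_⟩, ?_⟩
    · have := hg p x hx
      rwa [if_neg hp] at this
    · funext j
      change g (P.gen i j) = c j
      rw [Basis.constr_basis, dif_pos j.2]

/-- The basis of `Hom_𝒜^t(P_i, 𝔽₂)` dual to the generators of degree `t`. -/
def resolutionHomBasis [Finite {j : P.idx i // P.deg i j = t}] :
    Basis {j : P.idx i // P.deg i j = t} (ZMod 2) (resolutionHom P t i) :=
  Basis.ofEquivFun (LinearEquiv.ofBijective _ (resolutionHomEval_bijective P t i))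

theorem resolutionHomBasis_repr [Finite {j : P.idx i // P.deg i j = t}] (f : resolutionHom P t i)
    (j : {j : P.idx i // P.deg i j = t}) :
    (resolutionHomBasis P t i).repr f j = f.1 (P.gen i j) := rfl

end ResolutionBasis

/-! ### Leading terms and intrinsic tags -/

section LeadingTerm

variable {ι V : Type*} [LinearOrder ι] [AddCommGroup V] [Module (ZMod 2) V]
  {b : Basis ι (ZMod 2) V} {v w : V} {j k : ι}

theorem eq_one_of_ne_zero_zmod_two {c : ZMod 2} (h : c ≠ 0) : c = 1 := by
  revert c
  decide

theorem exists_isLeadingTerm (b : Basis ι (ZMod 2) V) (hv : v ≠ 0) : ∃ j, IsLeadingTerm b v j := by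
  have hne : (b.repr v).support.Nonempty := by
    rw [Finsupp.support_nonempty_iff]
    simpa using hv
  exact ⟨(b.repr v).support.max' hne, Finsupp.mem_support_iff.1 (Finset.max'_mem _ _),
    fun k hk => Finset.le_max' _ _ (Finsupp.mem_support_iff.2 hk)⟩

theorem IsLeadingTerm.unique (hj : IsLeadingTerm b v j) (hk : IsLeadingTerm b v k) : j = k :=
  le_antisymm (hk.2 _ hj.1) (hj.2 _ hk.1)

theorem IsLeadingTerm.ne_zero (hj : IsLeadingTerm b v j) : v ≠ 0 := by
  rintro rfl
  exact hj.1 (by simp)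

/-- The only nonzero coefficient is `1`, so equal leading terms cancel. This is the elimination step
behind all later arguments. -/
theorem IsLeadingTerm.add_lt (hv : IsLeadingTerm b v j) (hw : IsLeadingTerm b w j)
    (hk : IsLeadingTerm b (v + w) k) : k < j := by
  have h1 := hk.1
  rw [map_add, Finsupp.add_apply] at h1
  refine lt_of_le_of_ne ?_ ?_
  · by_contra hlt
    rw [not_le] at hlt
    refine h1 ?_
    rw [not_not.1 fun h => hlt.not_ge (hv.2 k h), not_not.1 fun h => hlt.not_ge (hw.2 k h),
      add_zero]
  · rintro rfl
    rw [eq_one_of_ne_zero_zmod_two hv.1, eq_one_of_ne_zero_zmod_two hw.1] at h1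
    exact h1 rfl

theorem IsLeadingTerm.add_of_lt (hv : IsLeadingTerm b v j) (hw : IsLeadingTerm b w k)
    (hkj : k < j) : IsLeadingTerm b (v + w) j := by
  have h0 : ∀ l, k < l → b.repr w l = 0 := fun l hl => not_not.1 fun h => hl.not_ge (hw.2 l h)
  refine ⟨?_, fun l hl => ?_⟩
  · rw [map_add, Finsupp.add_apply, h0 j hkj, add_zero]
    exact hv.1
  · rcases le_or_gt l k with h | h
    · exact h.trans hkj.le
    · rw [map_add, Finsupp.add_apply, h0 l h, add_zero] at hl
      exact hv.2 l hl

theorem IsLeadingTerm.add_of_gt (hv : IsLeadingTerm b v j) (hw : IsLeadingTerm b w k)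
    (hkj : j < k) : IsLeadingTerm b (v + w) k := by
  rw [add_comm]
  exact hw.add_of_lt hv hkj

end LeadingTerm

section Tag

variable {ι κ V W : Type*} [LinearOrder ι] [LinearOrder κ] [AddCommGroup V] [Module (ZMod 2) V]
  [AddCommGroup W] [Module (ZMod 2) W]

/-- Some vector with leading term `x` is mapped to one with leading term `y`. -/
def LeadsTo (f : V →ₗ[ZMod 2] W) (b : Basis ι (ZMod 2) V) (c : Basis κ (ZMod 2) W) (y : κ)
    (x : ι) : Prop :=
  ∃ v, IsLeadingTerm b v x ∧ IsLeadingTerm c (f v) y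

/-- `x` is the least leading term of the vectors mapped to vectors with leading term `y`. -/
def IsTag (f : V →ₗ[ZMod 2] W) (b : Basis ι (ZMod 2) V) (c : Basis κ (ZMod 2) W) (y : κ)
    (x : ι) : Prop :=
  LeadsTo f b c y x ∧ ∀ x', LeadsTo f b c y x' → x ≤ x'

variable {f : V →ₗ[ZMod 2] W} {b : Basis ι (ZMod 2) V} {c : Basis κ (ZMod 2) W}

/-- Among vectors led by `x`, take one whose image has the least leading term `y`. If some `x' < x`
also led to `y`, adding the corresponding vector would keep the leading term `x` and lower that of
the image, which is nonzero by hypothesis. -/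
theorem exists_isTag_of_not_kernel [Finite κ] {x : ι}
    (hx : ¬ ∃ v, f v = 0 ∧ IsLeadingTerm b v x) : ∃ y, IsTag f b c y x := by
  have hb : IsLeadingTerm b (b x) x := by
    classical
    refine ⟨by simp, fun k hk => ?_⟩
    rw [b.repr_self, Finsupp.single_apply] at hk
    by_contra h
    exact hk (if_neg (by rintro rfl; exact h le_rfl))
  have hne : {y | LeadsTo f b c y x}.Nonempty := by
    obtain ⟨y, hy⟩ := exists_isLeadingTerm c (v := f (b x)) fun h => hx ⟨_, h, hb⟩
    exact ⟨y, _, hb, hy⟩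
  obtain ⟨y, ⟨v, hv, hy⟩, hmin⟩ := WellFounded.has_min (wellFounded_lt (α := κ)) _ hne
  refine ⟨y, ⟨v, hv, hy⟩, fun x' ⟨w, hw, hwy⟩ => ?_⟩
  by_contra hlt
  rw [not_le] at hlt
  have h1 := hv.add_of_lt hw hlt
  obtain ⟨y', hy'⟩ := exists_isLeadingTerm c (v := f (v + w)) fun h => hx ⟨_, h, h1⟩
  refine hmin y' ⟨_, h1, hy'⟩ ?_
  rw [map_add] at hy'
  exact hy.add_lt hwy hy'

/-- Adding a kernel vector led by `x` would lower the leading term without changing the image,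
against minimality. -/
theorem IsTag.not_kernel {y : κ} {x : ι} (h : IsTag f b c y x) :
    ¬ ∃ v, f v = 0 ∧ IsLeadingTerm b v x := by
  rintro ⟨z, hz, hzx⟩
  obtain ⟨⟨v, hv, hy⟩, hmin⟩ := h
  have hf : f (v + z) = f v := by rw [map_add, hz, add_zero]
  obtain ⟨x', hx'⟩ := exists_isLeadingTerm b (v := v + z) fun h0 => hy.ne_zero (by
    rw [← hf, h0, map_zero])
  exact (hv.add_lt hzx hx').not_ge (hmin x' ⟨_, hx', by rwa [hf]⟩)

theorem exists_isTag_of_range [Finite ι] {y : κ} (hy : ∃ v, IsLeadingTerm c (f v) y) :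
    ∃ x, IsTag f b c y x := by
  have hne : {x | LeadsTo f b c y x}.Nonempty := by
    obtain ⟨v, hv⟩ := hy
    obtain ⟨x, hx⟩ := exists_isLeadingTerm b (v := v) fun h => hv.ne_zero (by rw [h, map_zero])
    exact ⟨x, v, hx, hv⟩
  obtain ⟨x, hx, hmin⟩ := WellFounded.has_min (wellFounded_lt (α := ι)) _ hne
  exact ⟨x, hx, fun x' hx' => not_lt.1 (hmin x' hx')⟩

theorem IsTag.right_unique {y : κ} {x x' : ι} (h : IsTag f b c y x) (h' : IsTag f b c y x') :
    x = x' :=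
  le_antisymm (h.2 _ h'.1) (h'.2 _ h.1)

/-- If `y' < y`, the sum of the two witnesses still maps to a vector led by `y` but has leading term
below `x`, against minimality. -/
theorem IsTag.le_left {y y' : κ} {x : ι} (h : IsTag f b c y x) (h' : IsTag f b c y' x) :
    y ≤ y' := by
  by_contra hlt
  rw [not_le] at hlt
  obtain ⟨⟨v, hv, hy⟩, hmin⟩ := h
  obtain ⟨⟨v', hv', hy'⟩, -⟩ := h'
  have hf : IsLeadingTerm c (f (v + v')) y := by
    rw [map_add]
    exact hy.add_of_lt hy' hlt
  obtain ⟨x', hx'⟩ := exists_isLeadingTerm b (v := v + v') fun h0 => hf.ne_zero (by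
    rw [h0, map_zero])
  exact (hv.add_lt hv' hx').not_ge (hmin x' ⟨_, hx', hf⟩)

theorem IsTag.left_unique {y y' : κ} {x : ι} (h : IsTag f b c y x) (h' : IsTag f b c y' x) :
    y = y' :=
  le_antisymm (h.le_left h') (h'.le_left h)

end Tag

/-! ### Existence and uniqueness of Curtis tables, and bases of cohomology -/

section CurtisTable

variable {ι : ℕ → Type*} [∀ i, LinearOrder (ι i)] {X : ℕ → Type*} [∀ i, AddCommGroup (X i)]
  [∀ i, Module (ZMod 2) (X i)] (δ : ∀ i, X i →ₗ[ZMod 2] X (i + 1))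
  (B : ∀ i, Basis (ι i) (ZMod 2) (X i))

/-- `x` is the leading term of a cocycle, but not of a coboundary. -/
def IsCohomologyLeadingTerm (i : ℕ) (x : ι i) : Prop :=
  (∃ v, δ i v = 0 ∧ IsLeadingTerm (B i) v x) ∧
    ¬ ∃ v ∈ coboundaries δ i, IsLeadingTerm (B i) v x

/-- The items of the Curtis table. -/
def IsCurtisItem : ∀ {i : ℕ}, CurtisItem ι i → Prop
  | i, .single x => IsCohomologyLeadingTerm δ B i x
  | _, .tag (i := i) a b => IsTag (δ i) (B i) (B (i + 1)) a b

/-- The Curtis table. -/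
def curtisTable (i : ℕ) : Set (CurtisItem ι i) := {q | IsCurtisItem δ B q}

variable {δ B}

theorem cocycle_of_mem_coboundaries (hδ : ∀ i x, δ (i + 1) (δ i x) = 0) {i : ℕ} {v : X i}
    (hv : v ∈ coboundaries δ i) : δ i v = 0 := by
  cases i with
  | zero =>
    obtain rfl : v = 0 := hv
    exact map_zero _
  | succ i =>
    obtain ⟨w, rfl⟩ := hv
    exact hδ i w

/-- A basis element leads a coboundary, or a cocycle but no coboundary, or no cocycle. In these
cases it is respectively the head of one tag, untagged, or the tail of one tag; since coboundaries
are cocycles, the cases exclude each other. -/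
theorem isCurtisTable_curtisTable [∀ i, Finite (ι i)] (hδ : ∀ i x, δ (i + 1) (δ i x) = 0) :
    IsCurtisTable δ B (curtisTable δ B) where
  appears_once := by
    rintro ⟨i, x⟩
    by_cases hx : ∃ v, δ i v = 0 ∧ IsLeadingTerm (B i) v x
    · by_cases hx' : ∃ v ∈ coboundaries δ i, IsLeadingTerm (B i) v x
      · cases i with
        | zero =>
          obtain ⟨v, hv, hvx⟩ := hx'
          exact absurd hv hvx.ne_zero
        | succ i =>
          obtain ⟨_, ⟨v, rfl⟩, hvx⟩ := hx'
          obtain ⟨b, hb⟩ := exists_isTag_of_range (b := B i) ⟨v, hvx⟩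
          refine ⟨⟨i + 1, .tag x b⟩, ⟨hb, Or.inl rfl⟩, ?_⟩
          rintro ⟨i', q⟩ ⟨hq, hm⟩
          cases q with
          | single x' =>
            cases hm
            exact absurd ⟨_, ⟨v, rfl⟩, hvx⟩ hq.2
          | tag a b' =>
            rcases hm with hm | hm
            · cases hm
              rw [IsTag.right_unique hb hq]
            · cases hm
              exact absurd hx (IsTag.not_kernel hq)
      · refine ⟨⟨i, .single x⟩, ⟨⟨hx, hx'⟩, rfl⟩, ?_⟩
        rintro ⟨i', q⟩ ⟨hq, hm⟩
        cases q with
        | single x' =>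
          cases hm
          rfl
        | tag a b' =>
          rcases hm with hm | hm
          · cases hm
            obtain ⟨v, -, hv⟩ := hq.1
            exact absurd ⟨_, ⟨v, rfl⟩, hv⟩ hx'
          · cases hm
            exact absurd hx (IsTag.not_kernel hq)
    · obtain ⟨a, ha⟩ := exists_isTag_of_not_kernel (c := B (i + 1)) hx
      refine ⟨⟨i + 1, .tag a x⟩, ⟨ha, Or.inr rfl⟩, ?_⟩
      rintro ⟨i', q⟩ ⟨hq, hm⟩
      cases q with
      | single x' =>
        cases hm
        exact absurd hq.1 hx
      | tag a' b' =>
        rcases hm with hm | hm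
        · cases hm
          obtain ⟨v, -, hv⟩ := hq.1
          exact absurd ⟨_, hδ _ v, hv⟩ hx
        · cases hm
          rw [IsTag.left_unique ha hq]
  single_or_head_iff_zero x := by
    refine ⟨fun h => h.1, fun h => ⟨h, ?_⟩⟩
    rintro ⟨v, hv, hvx⟩
    exact hvx.ne_zero hv
  single_or_head_iff_succ i x := by
    constructor
    · rintro (h | ⟨b, hb⟩)
      · exact h.1
      · obtain ⟨v, -, hv⟩ := hb.1
        exact ⟨_, hδ i v, hv⟩
    · intro h
      by_cases h' : ∃ v ∈ coboundaries δ (i + 1), IsLeadingTerm (B (i + 1)) v x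
      · obtain ⟨_, ⟨v, rfl⟩, hvx⟩ := h'
        exact Or.inr (exists_isTag_of_range ⟨v, hvx⟩)
      · exact Or.inl ⟨h, h'⟩
  tag_boundary i a b h := h.1

namespace IsCurtisTable

variable {L : ∀ i, Set (CurtisItem ι i)}

theorem eq_of_mentions (hL : IsCurtisTable δ B L) {i j k : ℕ} {p : CurtisItem ι i}
    {q : CurtisItem ι j} (y : ι k) (hp : p ∈ L i) (hq : q ∈ L j) (hpy : p.Mentions ⟨k, y⟩)
    (hqy : q.Mentions ⟨k, y⟩) : (⟨i, p⟩ : Σ i, CurtisItem ι i) = ⟨j, q⟩ :=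
  (hL.appears_once ⟨k, y⟩).unique ⟨hp, hpy⟩ ⟨hq, hqy⟩

theorem cocycle_of_single (hL : IsCurtisTable δ B L) {i : ℕ} {x : ι i}
    (h : CurtisItem.single x ∈ L i) : ∃ v, δ i v = 0 ∧ IsLeadingTerm (B i) v x := by
  cases i with
  | zero => exact (hL.single_or_head_iff_zero x).1 h
  | succ i => exact (hL.single_or_head_iff_succ i x).1 (Or.inl h)

theorem exists_tag_of_not_cocycle (hL : IsCurtisTable δ B L) {i : ℕ} {b : ι i}
    (h : ¬ ∃ v, δ i v = 0 ∧ IsLeadingTerm (B i) v b) :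
    ∃ a, CurtisItem.tag a b ∈ L (i + 1) := by
  obtain ⟨⟨j, q⟩, ⟨hq, hm⟩, -⟩ := hL.appears_once ⟨i, b⟩
  cases q with
  | single x =>
    cases hm
    exact absurd (hL.cocycle_of_single hq) h
  | tag a c =>
    rcases hm with hm | hm
    · cases hm
      exact absurd ((hL.single_or_head_iff_succ _ _).1 (Or.inr ⟨c, hq⟩)) h
    · cases hm
      exact ⟨a, hq⟩

theorem tag_right_unique (hL : IsCurtisTable δ B L) {i : ℕ} {a : ι (i + 1)} {b b' : ι i}
    (h : CurtisItem.tag a b ∈ L (i + 1)) (h' : CurtisItem.tag a b' ∈ L (i + 1)) : b = b' := by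
  cases hL.eq_of_mentions a h h' (Or.inl rfl) (Or.inl rfl)
  rfl

/-- Well-founded induction on `b`. If `b` leads a cocycle, adding it lowers the leading term of `w`.
Otherwise `b` is the tail of some tag `a' ← b`; with `v` its witness, `w + v` has a smaller leading
term, and `a` is found by comparing the leading terms of `δ v` and `δ (w + v)`. -/
theorem exists_tag_le [∀ i, Finite (ι i)] (hL : IsCurtisTable δ B L) {i : ℕ} (b : ι i)
    (w : X i) (hw : IsLeadingTerm (B i) w b) (a : ι (i + 1))
    (ha : IsLeadingTerm (B (i + 1)) (δ i w) a) :
    ∃ b' ≤ b, CurtisItem.tag a b' ∈ L (i + 1) := by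
  induction b using WellFoundedLT.induction generalizing w a with
  | ind b ih =>
  by_cases hb : ∃ v, δ i v = 0 ∧ IsLeadingTerm (B i) v b
  · obtain ⟨z, hz, hzb⟩ := hb
    have hd : δ i (w + z) = δ i w := by rw [map_add, hz, add_zero]
    obtain ⟨b', hb'⟩ := exists_isLeadingTerm (B i) (v := w + z) fun h0 => ha.ne_zero (by
      rw [← hd, h0, map_zero])
    have hlt := hw.add_lt hzb hb'
    obtain ⟨b'', hle, h⟩ := ih b' hlt (w + z) hb' a (by rwa [hd])
    exact ⟨b'', hle.trans hlt.le, h⟩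
  · obtain ⟨a', ha'⟩ := hL.exists_tag_of_not_cocycle hb
    obtain ⟨v, hv, hva⟩ := hL.tag_boundary i a' b ha'
    have h2 : ∀ x : X (i + 1), x + x = 0 := fun x => by
      rw [← two_smul (ZMod 2) x, show (2 : ZMod 2) = 0 from rfl, zero_smul]
    have hd : δ i v + δ i (w + v) = δ i w := by
      rw [map_add, add_comm (δ i w), ← add_assoc, h2, zero_add]
    by_cases h0 : δ i (w + v) = 0
    · rw [h0, add_zero] at hd
      rw [hd] at hva
      exact ⟨b, le_rfl, hva.unique ha ▸ ha'⟩
    · obtain ⟨a'', ha''⟩ := exists_isLeadingTerm (B (i + 1)) h0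
      obtain ⟨b', hb'⟩ := exists_isLeadingTerm (B i) (v := w + v) fun h => h0 (by
        rw [h, map_zero])
      have hlt := hw.add_lt hv hb'
      obtain ⟨b'', hle, h⟩ := ih b' hlt (w + v) hb' a'' ha''
      rcases lt_trichotomy a' a'' with hlt' | rfl | hlt'
      · have := hva.add_of_gt ha'' hlt'
        rw [hd] at this
        exact ⟨b'', hle.trans hlt.le, this.unique ha ▸ h⟩
      -- No cancellation occurs: a head determines its tail, but the two tails here are `b'' < b`
      -- and `b`.
      · exact absurd (hL.tag_right_unique h ha') (hle.trans_lt hlt).ne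
      · have := hva.add_of_lt ha'' hlt'
        rw [hd] at this
        exact ⟨b, le_rfl, this.unique ha ▸ ha'⟩

/-- `exists_tag_le` makes the tail of every tag minimal. Conversely, an intrinsic tail leads no
cocycle, so it is the tail of some tag of the table, whose head is forced. -/
theorem tag_iff [∀ i, Finite (ι i)] (hL : IsCurtisTable δ B L) {i : ℕ} (a : ι (i + 1))
    (b : ι i) : CurtisItem.tag a b ∈ L (i + 1) ↔ IsTag (δ i) (B i) (B (i + 1)) a b := by
  have key : ∀ a, CurtisItem.tag a b ∈ L (i + 1) → IsTag (δ i) (B i) (B (i + 1)) a b := by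
    refine fun a h => ⟨hL.tag_boundary i a b h, fun b' ⟨w, hw, hwa⟩ => ?_⟩
    obtain ⟨b'', hle, h'⟩ := hL.exists_tag_le b' w hw a hwa
    rwa [hL.tag_right_unique h h']
  refine ⟨key a, fun h => ?_⟩
  obtain ⟨a', ha'⟩ := hL.exists_tag_of_not_cocycle h.not_kernel
  rwa [h.left_unique (key a' ha')]

theorem single_iff [∀ i, Finite (ι i)] (hL : IsCurtisTable δ B L) {i : ℕ} (x : ι i) :
    CurtisItem.single x ∈ L i ↔ IsCohomologyLeadingTerm δ B i x := by
  cases i with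
  | zero =>
    rw [hL.single_or_head_iff_zero]
    refine ⟨fun h => ⟨h, ?_⟩, fun h => h.1⟩
    rintro ⟨v, hv, hvx⟩
    exact hvx.ne_zero hv
  | succ i =>
    constructor
    · refine fun h => ⟨(hL.single_or_head_iff_succ i x).1 (Or.inl h), ?_⟩
      rintro ⟨_, ⟨v, rfl⟩, hvx⟩
      obtain ⟨b, hb⟩ := exists_isTag_of_range (b := B i) ⟨v, hvx⟩
      cases hL.eq_of_mentions x h ((hL.tag_iff x b).2 hb) rfl (Or.inl rfl)
    · rintro ⟨h, h'⟩
      rcases (hL.single_or_head_iff_succ i x).2 h with h | ⟨b, hb⟩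
      · exact h
      · obtain ⟨v, -, hv⟩ := hL.tag_boundary i x b hb
        exact absurd ⟨_, ⟨v, rfl⟩, hv⟩ h'

theorem eq_curtisTable [∀ i, Finite (ι i)] (hL : IsCurtisTable δ B L) : L = curtisTable δ B := by
  funext i
  ext q
  cases q with
  | single x => exact hL.single_iff x
  | tag a b => exact hL.tag_iff a b

theorem single_iff_not_mentions (hL : IsCurtisTable δ B L) {s : ℕ} (x : ι s) :
    CurtisItem.single x ∈ L s ↔ ¬ ∃ (i : ℕ) (a : ι (i + 1)) (b : ι i),
      CurtisItem.tag a b ∈ L (i + 1) ∧ (CurtisItem.tag a b).Mentions ⟨s, x⟩ := by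
  constructor
  · rintro h ⟨i, a, b, hab, hm⟩
    cases hL.eq_of_mentions x h hab rfl hm
  · intro h
    obtain ⟨⟨j, q⟩, ⟨hq, hm⟩, -⟩ := hL.appears_once ⟨s, x⟩
    cases q with
    | single x =>
      cases hm
      exact hq
    | tag a b => exact absurd ⟨_, a, b, hq, hm⟩ h

end IsCurtisTable

theorem existsUnique_isCurtisTable [∀ i, Finite (ι i)] (hδ : ∀ i x, δ (i + 1) (δ i x) = 0) :
    ∃! L, IsCurtisTable δ B L :=
  ⟨_, isCurtisTable_curtisTable hδ, fun _ hL => hL.eq_curtisTable⟩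

/-- The leading terms are distinct, so the largest one in the support cannot cancel. -/
theorem isLeadingTerm_linearCombination {κ V : Type*} [LinearOrder κ] [AddCommGroup V]
    [Module (ZMod 2) V] (b : Basis κ (ZMod 2) V) {S : κ → Prop} (z : {x // S x} → V)
    (hz : ∀ x, IsLeadingTerm b (z x) x.1) {l : {x // S x} →₀ ZMod 2} (hl : l ≠ 0) :
    ∃ x : {x // S x}, IsLeadingTerm b (Finsupp.linearCombination (ZMod 2) z l) x.1 := by
  have hne : l.support.Nonempty := Finsupp.support_nonempty_iff.2 hl
  have hmax : ∀ x ∈ l.support, x ≤ l.support.max' hne := fun x hx => Finset.le_max' _ _ hx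
  have hmem := Finset.max'_mem _ hne
  set y := l.support.max' hne
  have hrepr : ∀ k, b.repr (Finsupp.linearCombination (ZMod 2) z l) k =
      ∑ x ∈ l.support, l x * b.repr (z x) k := by
    intro k
    rw [Finsupp.linearCombination_apply, Finsupp.sum, map_sum, Finsupp.finsetSum_apply]
    simp
  refine ⟨y, ?_, fun k hk => ?_⟩
  · rw [hrepr, Finset.sum_eq_single y]
    · exact mul_ne_zero (Finsupp.mem_support_iff.1 hmem) (hz y).1
    · intro x hx hxy
      have hlt : x < y := lt_of_le_of_ne (hmax x hx) hxy
      rw [not_not.1 fun h => (Subtype.coe_lt_coe.2 hlt).not_ge ((hz x).2 _ h), mul_zero]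
    · exact fun h => absurd hmem h
  · rw [hrepr] at hk
    obtain ⟨x, hx, hxk⟩ := Finset.exists_ne_zero_of_sum_ne_zero hk
    exact ((hz x).2 k (right_ne_zero_of_mul hxk)).trans (Subtype.coe_le_coe.2 (hmax x hx))

/-- Cocycles led by the items that lead cocycles but no coboundaries represent a basis of the
cohomology. -/
theorem exists_basis_cohomology [∀ i, Finite (ι i)] (hδ : ∀ i x, δ (i + 1) (δ i x) = 0) (s : ℕ)
    {S : ι s → Prop} (hS : ∀ x, S x ↔ IsCohomologyLeadingTerm δ B s x)
    (z : {x // S x} → cocycles δ s) (hz : ∀ x, IsLeadingTerm (B s) (z x).1 x.1) :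
    ∃ b : Basis {x // S x} (ZMod 2) (Cohomology δ s), ∀ x, b x = cohomologyClass δ s (z x) := by
  have hli : LinearIndependent (ZMod 2) fun x => cohomologyClass δ s (z x) := by
    rw [linearIndependent_iff]
    intro l hl
    by_contra hne
    obtain ⟨x, hx⟩ := isLeadingTerm_linearCombination (B s) (fun x => (z x).1) hz hne
    -- A vanishing nontrivial combination of classes would be a coboundary led by an element of `S`.
    refine ((hS x.1).1 x.2).2 ⟨_, ?_, hx⟩
    have h1 : cohomologyClass δ s (Finsupp.linearCombination (ZMod 2) z l) = 0 := by
      rw [← hl, Finsupp.apply_linearCombination]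
      rfl
    have h2 := (Submodule.Quotient.mk_eq_zero _).1 h1
    have h3 : (Finsupp.linearCombination (ZMod 2) (fun x => (z x).1) l) =
        (cocycles δ s).subtype (Finsupp.linearCombination (ZMod 2) z l) := by
      rw [Finsupp.apply_linearCombination]
      rfl
    rw [h3]
    exact h2
  have hspan : ∀ (x : ι s) (v : cocycles δ s), IsLeadingTerm (B s) v.1 x →
      cohomologyClass δ s v ∈
        Submodule.span (ZMod 2) (Set.range fun x => cohomologyClass δ s (z x)) := by
    intro x
    induction x using WellFoundedLT.induction with
    | ind x ih =>
    intro v hv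
    -- Adding `w` lowers the leading term, so induction handles `v + w`. The choice of `w` is `z x`
    -- when `S x` holds and a coboundary led by `x` otherwise.
    have key : ∀ w : cocycles δ s, IsLeadingTerm (B s) w.1 x → cohomologyClass δ s w ∈
        Submodule.span (ZMod 2) (Set.range fun x => cohomologyClass δ s (z x)) →
        cohomologyClass δ s v ∈
        Submodule.span (ZMod 2) (Set.range fun x => cohomologyClass δ s (z x)) := by
      intro w hw hmem
      have h1 : cohomologyClass δ s (v + w) ∈
          Submodule.span (ZMod 2) (Set.range fun x => cohomologyClass δ s (z x)) := by
        by_cases h0 : v + w = 0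
        · rw [h0, map_zero]
          exact Submodule.zero_mem _
        · obtain ⟨y, hy⟩ := exists_isLeadingTerm (B s) (v := (v + w).1) fun h =>
            h0 (Subtype.ext h)
          exact ih y (hv.add_lt hw hy) _ hy
      rw [map_add] at h1
      exact (Submodule.add_mem_iff_left _ hmem).1 h1
    by_cases hx : S x
    · exact key (z ⟨x, hx⟩) (hz ⟨x, hx⟩) (Submodule.subset_span ⟨_, rfl⟩)
    · have : ∃ w ∈ coboundaries δ s, IsLeadingTerm (B s) w x := by
        by_contra hcon
        exact hx ((hS x).2 ⟨⟨v.1, v.2, hv⟩, hcon⟩)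
      obtain ⟨w, hw, hwx⟩ := this
      refine key ⟨w, cocycle_of_mem_coboundaries hδ hw⟩ hwx ?_
      have : cohomologyClass δ s ⟨w, cocycle_of_mem_coboundaries hδ hw⟩ = 0 :=
        (Submodule.Quotient.mk_eq_zero _).2 hw
      rw [this]
      exact Submodule.zero_mem _
  refine ⟨Basis.mk hli ?_, fun x => Basis.mk_apply _ _ x⟩
  rintro y -
  obtain ⟨v, rfl⟩ := Submodule.Quotient.mk_surjective _ y
  change cohomologyClass δ s v ∈ _
  by_cases h0 : v = 0
  · rw [h0, map_zero]
    exact Submodule.zero_mem _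
  · obtain ⟨x, hx⟩ := exists_isLeadingTerm (B s) (v := v.1) fun h => h0 (Subtype.ext h)
    exact hspan x v hx

end CurtisTable

/-! ### Comparing tags under truncation, in coordinates -/

section Truncation

variable {ι κ V W ι' κ' V' W' : Type*} [LinearOrder ι] [LinearOrder κ] [AddCommGroup V]
  [Module (ZMod 2) V] [AddCommGroup W] [Module (ZMod 2) W] [LinearOrder ι'] [LinearOrder κ']
  [AddCommGroup V'] [Module (ZMod 2) V'] [AddCommGroup W'] [Module (ZMod 2) W']

/-- The coordinates of `v` at the indices above the range `[m, n]` vanish, and those in the range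
are the coordinates of `v'`. -/
def TruncatesTo (b : Basis ι (ZMod 2) V) (b' : Basis ι' (ZMod 2) V') (incl : ι' → ι) (D : ι → ℤ)
    (m n : ℤ) (v : V) (v' : V') : Prop :=
  (∀ x, b'.repr v' x = b.repr v (incl x)) ∧ ∀ y, m ≤ D y → n < D y → b.repr v y = 0

variable {b : Basis ι (ZMod 2) V} {b' : Basis ι' (ZMod 2) V'} {incl : ι' → ι} {D : ι → ℤ} {m n : ℤ}

/-- Coordinates below the range are unconstrained but too small to lead; those above it vanish. -/
theorem TruncatesTo.isLeadingTerm_iff (hincl : StrictMono incl) (hD : Monotone D)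
    (hrange : ∀ y, y ∈ Set.range incl ↔ m ≤ D y ∧ D y ≤ n) {v : V} {v' : V'}
    (h : TruncatesTo b b' incl D m n v v') (x : ι') :
    IsLeadingTerm b' v' x ↔ IsLeadingTerm b v (incl x) := by
  constructor
  · refine fun hx => ⟨by rw [← h.1]; exact hx.1, fun y hy => ?_⟩
    by_contra hlt
    rw [not_le] at hlt
    have hm : m ≤ D y := ((hrange _).1 ⟨x, rfl⟩).1.trans (hD hlt.le)
    have hn : D y ≤ n := not_lt.1 fun hn => hy (h.2 y hm hn)
    obtain ⟨y', rfl⟩ := (hrange y).2 ⟨hm, hn⟩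
    rw [← h.1] at hy
    exact (hincl.lt_iff_lt.1 hlt).not_ge (hx.2 y' hy)
  · refine fun hx => ⟨by rw [h.1]; exact hx.1, fun y hy => ?_⟩
    rw [h.1] at hy
    exact hincl.le_iff_le.1 (hx.2 _ hy)

omit [LinearOrder ι] [LinearOrder ι'] in
theorem exists_truncatesTo_of_truncation [Finite ι] (b : Basis ι (ZMod 2) V)
    (hincl : Function.Injective incl) (hrange : ∀ y, y ∈ Set.range incl → D y ≤ n) (v' : V') :
    ∃ v, TruncatesTo b b' incl D m n v v' := by
  classical
  refine ⟨b.equivFun.symm fun y => if h : ∃ x, incl x = y then b'.repr v' h.choose else 0,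
    fun x => ?_, fun y _ hy => ?_⟩
  · rw [← b.equivFun_apply, LinearEquiv.apply_symm_apply]
    have h : ∃ x', incl x' = incl x := ⟨x, rfl⟩
    rw [dif_pos h, hincl h.choose_spec]
  · rw [← b.equivFun_apply, LinearEquiv.apply_symm_apply, dif_neg]
    exact fun h => hy.not_ge (hrange y h)

omit [LinearOrder ι] [LinearOrder ι'] in
theorem exists_truncatesTo [Finite ι'] (b' : Basis ι' (ZMod 2) V') {v : V}
    (hv : ∀ y, m ≤ D y → n < D y → b.repr v y = 0) : ∃ v', TruncatesTo b b' incl D m n v v' := by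
  refine ⟨b'.equivFun.symm fun x => b.repr v (incl x), fun x => ?_, hv⟩
  rw [← b'.equivFun_apply, LinearEquiv.apply_symm_apply]

/-- Extension by zero and restriction of coordinates transfer witnesses with leading terms in the
range. The remaining point is that cells below the range cannot spoil minimality in the larger
complex. -/
theorem isTag_truncation_iff [Finite ι] [Finite ι'] {c : Basis κ (ZMod 2) W}
    {c' : Basis κ' (ZMod 2) W'} {incl' : κ' → κ} {D' : κ → ℤ} {f : V →ₗ[ZMod 2] W}
    {f' : V' →ₗ[ZMod 2] W'}
    (hincl : StrictMono incl) (hD : Monotone D)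
    (hrange : ∀ y, y ∈ Set.range incl ↔ m ≤ D y ∧ D y ≤ n)
    (hincl' : StrictMono incl') (hD' : Monotone D')
    (hrange' : ∀ y, y ∈ Set.range incl' ↔ m ≤ D' y ∧ D' y ≤ n)
    (hf : ∀ v v', TruncatesTo b b' incl D m n v v' → TruncatesTo c c' incl' D' m n (f v) (f' v'))
    (y : κ') (x : ι') : IsTag f' b' c' y x ↔ IsTag f b c (incl' y) (incl x) := by
  have htop : ∀ x' v, IsLeadingTerm b v x' → D x' ≤ n → ∀ y, m ≤ D y → n < D y → b.repr v y = 0 := by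
    intro x' v hv hx' y _ hy
    by_contra hne
    exact (hx'.trans_lt hy).not_ge (hD (hv.2 y hne))
  have key : ∀ x, LeadsTo f' b' c' y x ↔ LeadsTo f b c (incl' y) (incl x) := by
    intro x
    constructor
    · rintro ⟨v', hx, hy⟩
      obtain ⟨v, hv⟩ := exists_truncatesTo_of_truncation (b' := b') b hincl.injective
        (fun y hy => ((hrange y).1 hy).2) v'
      exact ⟨v, (hv.isLeadingTerm_iff hincl hD hrange x).1 hx,
        ((hf v v' hv).isLeadingTerm_iff hincl' hD' hrange' y).1 hy⟩
    · rintro ⟨v, hx, hy⟩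
      obtain ⟨v', hv⟩ := exists_truncatesTo (incl := incl) b'
        (htop _ v hx ((hrange _).1 ⟨x, rfl⟩).2)
      exact ⟨v', (hv.isLeadingTerm_iff hincl hD hrange x).2 hx,
        ((hf v v' hv).isLeadingTerm_iff hincl' hD' hrange' y).2 hy⟩
  constructor
  · rintro ⟨h, hmin⟩
    refine ⟨(key x).1 h, fun x₀ h₀ => ?_⟩
    by_contra hlt
    rw [not_le] at hlt
    have hn : D x₀ ≤ n := (hD hlt.le).trans ((hrange _).1 ⟨x, rfl⟩).2
    by_cases hm : m ≤ D x₀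
    · obtain ⟨x', rfl⟩ := (hrange x₀).2 ⟨hm, hn⟩
      exact (hincl.lt_iff_lt.1 hlt).not_ge (hmin x' ((key x').2 h₀))
    · obtain ⟨v, hv, hy⟩ := h₀
      -- A vector led below the range corresponds to zero, so the coordinates of its image in the
      -- range vanish. Its image cannot be led by `incl' y`.
      have h0 : TruncatesTo b b' incl D m n v 0 := by
        refine ⟨fun x' => ?_, htop _ v hv hn⟩
        rw [map_zero, Finsupp.zero_apply, eq_comm]
        by_contra hne
        exact hm (((hrange _).1 ⟨x', rfl⟩).1.trans (hD (hv.2 _ hne)))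
      refine hy.1 ?_
      rw [← (hf v 0 h0).1, map_zero, map_zero, Finsupp.zero_apply]
  · rintro ⟨h, hmin⟩
    exact ⟨(key x).2 h, fun x' h' => hincl.le_iff_le.1 (hmin _ ((key x').1 h'))⟩

end Truncation

/-! ### The tensor product resolution and its identification with `Ext` -/

section TensorGrading

variable {N F : Type*} [AddCommGroup N] [Module (ZMod 2) N] [Module SteenrodAlgebra N]
  [IsScalarTower (ZMod 2) SteenrodAlgebra N] [AddCommGroup F] [Module (ZMod 2) F]
  [Module SteenrodAlgebra F] [IsScalarTower (ZMod 2) SteenrodAlgebra F]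
  (𝓝 : ℤ → Submodule (ZMod 2) N) (𝓕 : ℤ → Submodule (ZMod 2) F)

/-- The total grading of `N ⊗ F`. -/
def tensorGrading (p : ℤ) : Submodule (ZMod 2) (DiagonalTensor N F) :=
  Submodule.span (ZMod 2) {z | ∃ a b : ℤ, a + b = p ∧ ∃ x ∈ 𝓝 a, ∃ y ∈ 𝓕 b,
    DiagonalTensor.tmul x y = z}

variable {𝓝 𝓕}

omit [Module SteenrodAlgebra N] [IsScalarTower (ZMod 2) SteenrodAlgebra N]
  [Module SteenrodAlgebra F] [IsScalarTower (ZMod 2) SteenrodAlgebra F] in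
theorem tmul_mem_tensorGrading {a b : ℤ} {x : N} {y : F} (hx : x ∈ 𝓝 a) (hy : y ∈ 𝓕 b) :
    DiagonalTensor.tmul x y ∈ tensorGrading 𝓝 𝓕 (a + b) :=
  Submodule.subset_span ⟨a, b, rfl, x, hx, y, hy, rfl⟩

omit [Module SteenrodAlgebra N] [IsScalarTower (ZMod 2) SteenrodAlgebra N]
  [Module SteenrodAlgebra F] [IsScalarTower (ZMod 2) SteenrodAlgebra F] in
theorem map_mem_of_mem_tensorGrading {W : Type*} [AddCommGroup W] [Module (ZMod 2) W]
    (f : DiagonalTensor N F →ₗ[ZMod 2] W) {p : ℤ} {S : Submodule (ZMod 2) W}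
    (hf : ∀ a b, a + b = p → ∀ x ∈ 𝓝 a, ∀ y ∈ 𝓕 b, f (DiagonalTensor.tmul x y) ∈ S)
    {z : DiagonalTensor N F} (hz : z ∈ tensorGrading 𝓝 𝓕 p) : f z ∈ S := by
  have : tensorGrading 𝓝 𝓕 p ≤ S.comap f := by
    refine Submodule.span_le.2 ?_
    rintro _ ⟨a, b, hab, x, hx, y, hy, rfl⟩
    exact hf a b hab x hx y hy
  exact this hz

theorem DiagonalTensor.Sq_smul_tmul (n : ℕ) (x : N) (y : F) :
    Sq n • tmul x y =
      ∑ p ∈ Finset.HasAntidiagonal.antidiagonal n, tmul (Sq p.1 • x) (Sq p.2 • y) := by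
  refine (Sq_smul N F n (tmul x y)).trans ?_
  rw [cartanSq, LinearMap.sum_apply]
  rfl

-- Tensoring `e` with a homogeneous `𝔽₂`-basis of `F` gives a homogeneous basis of the tensor
-- product, to which `isInternal_of_basis` applies.
omit [Module SteenrodAlgebra N] [IsScalarTower (ZMod 2) SteenrodAlgebra N]
  [Module SteenrodAlgebra F] [IsScalarTower (ZMod 2) SteenrodAlgebra F] in
theorem isInternal_tensorGrading {κ : Type*} (e : Basis κ (ZMod 2) N) (dim : κ → ℤ)
    (h𝓝 : DirectSum.IsInternal 𝓝) (he : ∀ k, e k ∈ 𝓝 (dim k)) (h𝓕 : DirectSum.IsInternal 𝓕) :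
    DirectSum.IsInternal (tensorGrading 𝓝 𝓕) := by
  let r := h𝓕.collectedBasis fun p => Basis.ofVectorSpace (ZMod 2) (𝓕 p)
  have hr : ∀ σ, r σ ∈ 𝓕 σ.1 := fun σ => h𝓕.collectedBasis_mem _ σ
  let b : Basis _ (ZMod 2) (DiagonalTensor N F) :=
    (e.tensorProduct r).map (DiagonalTensor.equiv N F).symm
  have hb : ∀ k, b k = DiagonalTensor.tmul (e k.1) (r k.2) := by
    intro k
    rw [Basis.map_apply, Basis.tensorProduct_apply']
    rfl
  refine isInternal_of_basis b (fun k => dim k.1 + k.2.1) (fun k => ?_) fun p z hz k hk => ?_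
  · rw [hb]
    exact tmul_mem_tensorGrading (he _) (hr _)
  · by_contra hne
    refine hk ((Submodule.mem_bot (ZMod 2)).1 (map_mem_of_mem_tensorGrading (b.coord k) ?_ hz))
    intro a c hac x hx y hy
    have : b.coord k (DiagonalTensor.tmul x y) = e.repr x k.1 * r.repr y k.2 := by
      refine (Basis.tensorProduct_repr_tmul_apply e r x y k.1 k.2).trans ?_
      rw [smul_eq_mul, mul_comm]
    rw [Submodule.mem_bot, this]
    by_contra hxy
    have h1 := repr_ne_zero_of_mem e dim h𝓝 he hx (left_ne_zero_of_mul hxy)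
    have h2 := repr_ne_zero_of_mem r (fun σ => σ.1) h𝓕 hr hy (right_ne_zero_of_mul hxy)
    exact hne (by omega)

theorem isGradedSteenrodModule_tensorGrading {κ : Type*} (e : Basis κ (ZMod 2) N) (dim : κ → ℤ)
    (h𝓝 : IsGradedSteenrodModule 𝓝) (he : ∀ k, e k ∈ 𝓝 (dim k))
    (h𝓕 : IsGradedSteenrodModule 𝓕) : IsGradedSteenrodModule (tensorGrading 𝓝 𝓕) where
  isInternal := isInternal_tensorGrading e dim h𝓝.isInternal he h𝓕.isInternal
  sq_smul_mem n p z hz := by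
    refine map_mem_of_mem_tensorGrading
      (Algebra.lsmul (ZMod 2) (ZMod 2) (DiagonalTensor N F) (Sq n)) ?_ hz
    intro a b hab x hx y hy
    change Sq n • DiagonalTensor.tmul x y ∈ _
    rw [DiagonalTensor.Sq_smul_tmul]
    refine Submodule.sum_mem _ fun q hq => ?_
    have := tmul_mem_tensorGrading (h𝓝.sq_smul_mem q.1 a x hx) (h𝓕.sq_smul_mem q.2 b y hy)
    have hq' := Finset.HasAntidiagonal.mem_antidiagonal.1 hq
    rwa [show a + q.1 + (b + q.2) = p + n by omega] at this

end TensorGrading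

section TensorResolution

variable {N : Type*} [AddCommGroup N] [Module (ZMod 2) N] [Module SteenrodAlgebra N]
  [IsScalarTower (ZMod 2) SteenrodAlgebra N] {𝓝 : ℤ → Submodule (ZMod 2) N}

theorem trivialGrading_eq_zero {p : ℤ} (hp : p ≠ 0) {x : ZMod 2} (hx : x ∈ trivialGrading p) :
    x = 0 := by
  rw [trivialGrading, if_neg hp] at hx
  exact hx

/-- The resolution `N ⊗ F_*` of `N`. -/
def tensorResolution (h𝓝 : IsGradedSteenrodModule 𝓝) {κ : Type*} (e : Basis κ (ZMod 2) N)
    (dim : κ → ℤ) (he : ∀ k, e k ∈ 𝓝 (dim k)) (F : GradedFreeResolution.{v, w} trivialGrading) :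
    GradedFreeResolution 𝓝 where
  obj i := DiagonalTensor N (F.obj i)
  grading i := tensorGrading 𝓝 (F.grading i)
  isGraded i := isGradedSteenrodModule_tensorGrading e dim h𝓝 he (F.isGraded i)
  idx i := κ ×ₗ F.idx i
  gen i := (DiagonalTensor.basis e (F.gen i)).reindex toLex
  deg i p := dim (ofLex p).1 + F.deg i (ofLex p).2
  gen_mem i p := by
    rw [Basis.reindex_apply, DiagonalTensor.basis_apply]
    exact tmul_mem_tensorGrading (he _) (F.gen_mem i _)
  d i := steenrodLinear ((DiagonalTensor.equiv N (F.obj i)).symm.toLinearMap ∘ₗ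
      LinearMap.lTensor N ((F.d i).restrictScalars (ZMod 2)) ∘ₗ
      (DiagonalTensor.equiv N (F.obj (i + 1))).toLinearMap) fun n z => by
    apply (DiagonalTensor.equiv N (F.obj i)).injective
    simp only [LinearMap.comp_apply, LinearEquiv.coe_coe, DiagonalTensor.Sq_smul,
      LinearEquiv.apply_symm_apply, cartanSq_lTensor]
  aug := steenrodLinear ((TensorProduct.rid (ZMod 2) N).toLinearMap ∘ₗ
      LinearMap.lTensor N (F.aug.restrictScalars (ZMod 2)) ∘ₗ
      (DiagonalTensor.equiv N (F.obj 0)).toLinearMap) fun n z => by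
    induction z using DiagonalTensor.induction_on with
    | zero => simp
    | add z w hz hw => rw [smul_add, map_add, map_add, smul_add, hz, hw]
    | tmul x y =>
      rw [DiagonalTensor.Sq_smul_tmul, map_sum]
      have h : ∀ (x : N) (y : F.obj 0), ((TensorProduct.rid (ZMod 2) N).toLinearMap ∘ₗ
          LinearMap.lTensor N (F.aug.restrictScalars (ZMod 2)) ∘ₗ
          (DiagonalTensor.equiv N (F.obj 0)).toLinearMap) (DiagonalTensor.tmul x y) =
          F.aug y • x := fun x y => TensorProduct.rid_tmul _ _
      simp only [h]
      -- Positive squares act by zero on `𝔽₂`, so of the Cartan sum only `Sq n` on the factor `N`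
      -- remains.
      rw [Finset.sum_eq_single (n, 0)]
      · rw [SteenrodAlgebra.Sq_zero, one_smul, smul_comm]
      · rintro ⟨i, j⟩ hij hne
        rw [map_smul, SteenrodAlgebra.smul_zmod, SteenrodAlgebra.augmentation_Sq, if_neg,
          zero_mul, zero_smul]
        rintro rfl
        exact hne (by simpa using hij)
      · simp
  d_mem i p z hz := by
    refine map_mem_of_mem_tensorGrading ((DiagonalTensor.equiv N (F.obj i)).symm.toLinearMap ∘ₗ
      LinearMap.lTensor N ((F.d i).restrictScalars (ZMod 2)) ∘ₗ
      (DiagonalTensor.equiv N (F.obj (i + 1))).toLinearMap) ?_ hz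
    rintro a b rfl x hx y hy
    exact tmul_mem_tensorGrading hx (F.d_mem i b y hy)
  aug_mem p z hz := by
    refine map_mem_of_mem_tensorGrading ((TensorProduct.rid (ZMod 2) N).toLinearMap ∘ₗ
      LinearMap.lTensor N (F.aug.restrictScalars (ZMod 2)) ∘ₗ
      (DiagonalTensor.equiv N (F.obj 0)).toLinearMap) ?_ hz
    rintro a b rfl x hx y hy
    change TensorProduct.rid (ZMod 2) N (x ⊗ₜ F.aug y) ∈ _
    rw [TensorProduct.rid_tmul]
    rcases eq_or_ne b 0 with rfl | hb
    · rw [add_zero]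
      exact Submodule.smul_mem _ _ hx
    · rw [trivialGrading_eq_zero hb (F.aug_mem b y hy), zero_smul]
      exact Submodule.zero_mem _
  exact i := Module.Flat.lTensor_exact (R := ZMod 2) N
    (f := (F.d (i + 1)).restrictScalars (ZMod 2)) (g := (F.d i).restrictScalars (ZMod 2))
    (F.exact i)
  exact_zero z := by
    refine Iff.trans ?_ (Module.Flat.lTensor_exact (R := ZMod 2) N
      (f := (F.d 0).restrictScalars (ZMod 2)) (g := F.aug.restrictScalars (ZMod 2)) F.exact_zero z)
    exact (TensorProduct.rid (ZMod 2) N).map_eq_zero_iff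
  aug_surjective x := by
    obtain ⟨y, hy⟩ := F.aug_surjective 1
    refine ⟨DiagonalTensor.tmul x y, ?_⟩
    change TensorProduct.rid (ZMod 2) N (x ⊗ₜ F.aug y) = x
    rw [hy, TensorProduct.rid_tmul, one_smul]

variable (h𝓝 : IsGradedSteenrodModule 𝓝) {κ : Type*} (e : Basis κ (ZMod 2) N) (dim : κ → ℤ)
  (he : ∀ k, e k ∈ 𝓝 (dim k)) (F : GradedFreeResolution.{v, w} trivialGrading) (t : ℤ)

/-- `Hom_𝒜^t(N ⊗ F_i, 𝔽₂)` in terms of the resolution `N ⊗ F_*`. -/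
def diagonalHomEquiv (i : ℕ) :
    diagonalHom 𝓝 F t i ≃ₗ[ZMod 2] resolutionHom (tensorResolution h𝓝 e dim he F) t i where
  toFun f := ⟨f.1, fun a x => map_smul_of_map_Sq_smul (V := DiagonalTensor N (F.obj i))
      (f.1 ∘ₗ (DiagonalTensor.equiv N (F.obj i)).toLinearMap) (fun n z => by
        rw [LinearMap.comp_apply, LinearEquiv.coe_coe, DiagonalTensor.Sq_smul, f.2.1]
        rfl) a x,
    fun p hp x hx => (Submodule.mem_bot (ZMod 2)).1 (map_mem_of_mem_tensorGrading
      (f.1 ∘ₗ (DiagonalTensor.equiv N (F.obj i)).toLinearMap) (by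
        rintro a b rfl x hx y hy
        exact f.2.2 a b hp x hx y hy) hx)⟩
  invFun f := ⟨f.1, fun n z => by
      refine Eq.trans ?_ (f.2.1 (Sq n) ((DiagonalTensor.equiv N (F.obj i)).symm z))
      refine congrArg f.1 ((DiagonalTensor.equiv N (F.obj i)).injective ?_)
      refine Eq.trans ?_ (DiagonalTensor.Sq_smul N (F.obj i) n _).symm
      rfl,
    fun p q hpq x hx y hy => f.2.2 (p + q) hpq _ (tmul_mem_tensorGrading hx hy)⟩
  map_add' _ _ := rfl
  map_smul' _ _ := rfl
  left_inv _ := rfl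
  right_inv _ := rfl

include h𝓝 e he in
theorem nonempty_steenrodExt_equiv_diagonalCohomology
    (P : GradedFreeResolution.{v', w'} 𝓝) (s : ℕ) :
    Nonempty (SteenrodExt P s t ≃ₗ[ZMod 2] DiagonalCohomology 𝓝 F t s) := by
  obtain ⟨f⟩ := nonempty_steenrodExt_equiv h𝓝.isInternal P (tensorResolution h𝓝 e dim he F) s t
  obtain ⟨g⟩ := nonempty_cohomology_equiv
    (X := fun i => ↥(resolutionHom (tensorResolution h𝓝 e dim he F) t i))
    (X' := fun i => ↥(diagonalHom 𝓝 F t i))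
    (resolutionHomD (tensorResolution h𝓝 e dim he F) t) (diagonalHomD 𝓝 F t)
    (fun i => (diagonalHomEquiv h𝓝 e dim he F t i).symm.toLinearMap) (fun i f => rfl)
    (fun i => (diagonalHomEquiv h𝓝 e dim he F t i).toLinearMap) (fun i f => rfl) s
    (fun f _ => by simp) (fun f _ => by simp)
  exact ⟨f.trans g⟩

/-- The basis of the `e_k ⊗ r_{i,j}`. -/
def diagonalHomBasis [∀ i, Finite (TensorIndex dim F t i)] (i : ℕ) :
    Basis (TensorIndex dim F t i) (ZMod 2) (diagonalHom 𝓝 F t i) :=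
  letI : Finite {j // (tensorResolution h𝓝 e dim he F).deg i j = t} :=
    inferInstanceAs (Finite (TensorIndex dim F t i))
  (resolutionHomBasis (tensorResolution h𝓝 e dim he F) t i).map
    (diagonalHomEquiv h𝓝 e dim he F t i).symm

theorem diagonalHomBasis_repr [∀ i, Finite (TensorIndex dim F t i)] (i : ℕ)
    (f : diagonalHom 𝓝 F t i) (x : TensorIndex dim F t i) :
    (diagonalHomBasis h𝓝 e dim he F t i).repr f x =
      f.1 (e (ofLex x.1).1 ⊗ₜ F.gen i (ofLex x.1).2) := by
  have : Finite {j // (tensorResolution h𝓝 e dim he F).deg i j = t} :=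
    inferInstanceAs (Finite (TensorIndex dim F t i))
  refine (resolutionHomBasis_repr (tensorResolution h𝓝 e dim he F) t i
    (diagonalHomEquiv h𝓝 e dim he F t i f) x).trans ?_
  have h : ((DiagonalTensor.basis e (F.gen i)).reindex toLex) x.1 =
      DiagonalTensor.tmul (e (ofLex x.1).1) (F.gen i (ofLex x.1).2) := by
    rw [Basis.reindex_apply, DiagonalTensor.basis_apply]
    rfl
  exact congrArg f.1 h

theorem isDualBasis_diagonalHomBasis [∀ i, Finite (TensorIndex dim F t i)] :
    IsDualBasis e dim (diagonalHomBasis h𝓝 e dim he F t) := by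
  classical
  intro i x k j
  constructor
  · intro hx
    have := diagonalHomBasis_repr h𝓝 e dim he F t i (diagonalHomBasis h𝓝 e dim he F t i x) x
    rw [Basis.repr_self, Finsupp.single_eq_same, hx] at this
    exact this.symm
  · intro hx
    by_cases ht : dim k + F.deg i j = t
    · have := diagonalHomBasis_repr h𝓝 e dim he F t i (diagonalHomBasis h𝓝 e dim he F t i x)
        ⟨toLex (k, j), ht⟩
      rw [Basis.repr_self, Finsupp.single_apply, if_neg fun h => hx (congrArg Subtype.val h)]
        at this
      exact this.symm
    · exact (diagonalHomBasis h𝓝 e dim he F t i x).2.2 _ _ ht _ (he k) _ (F.gen_mem i j)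

omit [IsScalarTower (ZMod 2) SteenrodAlgebra N] in
theorem finite_tensorIndex [Finite κ] (hF : ∀ (i : ℕ) (q : ℤ), {j : F.idx i | F.deg i j = q}.Finite)
    (i : ℕ) : Finite (TensorIndex dim F t i) := by
  have : ∀ k, Finite {j : F.idx i // F.deg i j = t - dim k} := fun k => hF i _
  refine Finite.of_surjective (α := Σ k : κ, {j : F.idx i // F.deg i j = t - dim k})
    (fun p => ⟨toLex (p.1, p.2.1), by have := p.2.2; simp only [ofLex_toLex]; omega⟩) ?_
  exact fun x => ⟨⟨(ofLex x.1).1, (ofLex x.1).2, by have := x.2; omega⟩, rfl⟩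

end TensorResolution

/-! ### The truncated module and its cochains -/

section Truncation

variable {M : Type*} [AddCommGroup M] [Module (ZMod 2) M] [Module SteenrodAlgebra M]
  [IsScalarTower (ZMod 2) SteenrodAlgebra M] {𝓜 : ℤ → Submodule (ZMod 2) M}
  (h𝓜 : IsGradedSteenrodModule 𝓜) {κ : Type*} (e : Basis κ (ZMod 2) M) (dim : κ → ℤ)
  (he : ∀ k, e k ∈ 𝓜 (dim k)) (m n : ℤ)

include h𝓜 he

variable {e dim m} in
theorem le_dim_of_mem_degreeGE {x : M} (hx : x ∈ degreeGE 𝓜 m) {k : κ} (hk : e.repr x k ≠ 0) :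
    m ≤ dim k := by
  by_contra hlt
  have hle : (⨆ p : Set.Ici m, 𝓜 p) ≤ LinearMap.ker (e.coord k) := by
    refine iSup_le fun p y hy => ?_
    rw [LinearMap.mem_ker, Basis.coord_apply]
    by_contra hne
    have := repr_ne_zero_of_mem e dim h𝓜.isInternal he hy hne
    exact hlt (this ▸ p.2)
  rw [← degreeGE_eq_iSup h𝓜] at hle
  exact hk (hle hx)

-- Used as an induction principle: applied to the locus where two linear maps agree, it reduces
-- equalities on `M^{≥ m}` to the cells of dimension at least `m`.
variable {e dim m} in
theorem degreeGE_eq_top (S : Submodule (ZMod 2) (degreeGE 𝓜 m))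
    (hS : ∀ k (hk : m ≤ dim k), ⟨e k, mem_degreeGE 𝓜 hk (he k)⟩ ∈ S) : S = ⊤ := by
  rw [eq_top_iff]
  rintro ⟨x, hx⟩ -
  have h1 : x ∈ Submodule.span (ZMod 2) (e '' {k | m ≤ dim k}) := by
    rw [Basis.mem_span_image]
    intro k hk
    exact le_dim_of_mem_degreeGE h𝓜 he hx (Finsupp.mem_support_iff.1 hk)
  have h2 : Submodule.span (ZMod 2) (e '' {k | m ≤ dim k}) ≤
      S.map ((degreeGE 𝓜 m).subtype.restrictScalars (ZMod 2)) := by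
    rw [Submodule.span_le]
    rintro _ ⟨k, hk, rfl⟩
    exact ⟨_, hS k hk, rfl⟩
  obtain ⟨u, hu, hux⟩ := h2 h1
  rwa [show (⟨x, hx⟩ : degreeGE 𝓜 m) = u from Subtype.ext hux.symm]

/-- The projection of `M^{≥ m}` to the truncation. -/
def truncationProj {M : Type*} [AddCommGroup M] [Module (ZMod 2) M] [Module SteenrodAlgebra M]
    [IsScalarTower (ZMod 2) SteenrodAlgebra M] (𝓜 : ℤ → Submodule (ZMod 2) M) (m n : ℤ) :
    degreeGE 𝓜 m →ₗ[ZMod 2] Truncation 𝓜 m n :=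
  ((degreeGE 𝓜 (n + 1)).submoduleOf (degreeGE 𝓜 m)).mkQ.restrictScalars (ZMod 2)

omit h𝓜 he in
theorem truncationProj_surjective : Function.Surjective (truncationProj 𝓜 m n) :=
  Submodule.Quotient.mk_surjective _

omit h𝓜 he in
theorem truncationProj_eq_zero_iff (u : degreeGE 𝓜 m) :
    truncationProj 𝓜 m n u = 0 ↔ u.1 ∈ degreeGE 𝓜 (n + 1) :=
  Submodule.Quotient.mk_eq_zero _

omit h𝓜 in
theorem truncationProj_of_lt {k : κ} (hk : m ≤ dim k) (hn : n < dim k) :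
    truncationProj 𝓜 m n ⟨e k, mem_degreeGE 𝓜 hk (he k)⟩ = 0 := by
  rw [truncationProj_eq_zero_iff]
  exact mem_degreeGE 𝓜 (Int.add_one_le_iff.2 hn) (he k)

/-- A relation lifts to a combination of cells of dimension at most `n` lying in `M^{≥ n + 1}`,
where only coordinates of dimension above `n` occur. -/
theorem linearIndependent_truncationVec :
    LinearIndependent (ZMod 2) (truncationVec 𝓜 e dim he m n) := by
  rw [linearIndependent_iff]
  intro l hl
  let u : CellsBetween dim m n → degreeGE 𝓜 m := fun k => ⟨e k, mem_degreeGE 𝓜 k.2.1 (he k)⟩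
  have h1 : truncationProj 𝓜 m n (Finsupp.linearCombination (ZMod 2) u l) = 0 := by
    rw [← hl, Finsupp.apply_linearCombination]
    rfl
  rw [truncationProj_eq_zero_iff] at h1
  have h2 : (Finsupp.linearCombination (ZMod 2) u l).1 =
      Finsupp.linearCombination (ZMod 2) e (l.mapDomain Subtype.val) := by
    rw [Finsupp.linearCombination_mapDomain]
    exact Finsupp.apply_linearCombination (ZMod 2)
      ((degreeGE 𝓜 m).subtype.restrictScalars (ZMod 2)) u l
  ext k
  by_contra hne
  have h3 := le_dim_of_mem_degreeGE h𝓜 he h1 (k := k.1) (by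
    rw [h2, Basis.repr_linearCombination, Finsupp.mapDomain_apply Subtype.val_injective]
    exact hne)
  have := k.2.2
  omega

theorem span_truncationVec :
    Submodule.span (ZMod 2) (Set.range (truncationVec 𝓜 e dim he m n)) = ⊤ := by
  have := degreeGE_eq_top (m := m) h𝓜 he ((Submodule.span (ZMod 2)
    (Set.range (truncationVec 𝓜 e dim he m n))).comap (truncationProj 𝓜 m n)) fun k hk => by
      rw [Submodule.mem_comap]
      by_cases hn : dim k ≤ n
      · exact Submodule.subset_span ⟨⟨k, hk, hn⟩, rfl⟩
      · rw [truncationProj_of_lt e dim he m n hk (not_le.1 hn)]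
        exact Submodule.zero_mem _
  rw [eq_top_iff]
  rintro x -
  obtain ⟨u, rfl⟩ := truncationProj_surjective m n x
  have hu : u ∈ (⊤ : Submodule (ZMod 2) (degreeGE 𝓜 m)) := trivial
  rwa [← this] at hu

/-- The classes of the `e k` as a basis of the truncation. -/
def truncationBasis : Basis (CellsBetween dim m n) (ZMod 2) (Truncation 𝓜 m n) :=
  Basis.mk (linearIndependent_truncationVec h𝓜 e dim he m n)
    (span_truncationVec h𝓜 e dim he m n).ge

theorem coe_truncationBasis :
    ⇑(truncationBasis h𝓜 e dim he m n) = truncationVec 𝓜 e dim he m n :=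
  Basis.coe_mk _ _

theorem truncationBasis_repr (u : degreeGE 𝓜 m) (k : CellsBetween dim m n) :
    (truncationBasis h𝓜 e dim he m n).repr (truncationProj 𝓜 m n u) k = e.repr u.1 k := by
  classical
  have := degreeGE_eq_top (m := m) h𝓜 he (LinearMap.eqLocus
    ((truncationBasis h𝓜 e dim he m n).coord k ∘ₗ truncationProj 𝓜 m n)
    (e.coord k ∘ₗ (degreeGE 𝓜 m).subtype.restrictScalars (ZMod 2))) fun j hj => by
      change (truncationBasis h𝓜 e dim he m n).repr
        (truncationProj 𝓜 m n ⟨e j, mem_degreeGE 𝓜 hj (he j)⟩) k = e.repr (e j) k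
      by_cases hn : dim j ≤ n
      · have h1 : truncationProj 𝓜 m n ⟨e j, mem_degreeGE 𝓜 hj (he j)⟩ =
            truncationBasis h𝓜 e dim he m n ⟨j, hj, hn⟩ := by
          rw [coe_truncationBasis]
          rfl
        rw [h1, Basis.repr_self, Basis.repr_self, Finsupp.single_apply, Finsupp.single_apply]
        simp only [Subtype.ext_iff]
      · rw [truncationProj_of_lt e dim he m n hj (not_le.1 hn), map_zero, Finsupp.zero_apply,
          Basis.repr_self, Finsupp.single_apply, if_neg]
        rintro rfl
        exact hn k.2.2
  have hu : u ∈ (⊤ : Submodule (ZMod 2) (degreeGE 𝓜 m)) := trivial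
  rw [← this] at hu
  exact hu

omit h𝓜 in
theorem truncationVec_mem (k : CellsBetween dim m n) :
    truncationVec 𝓜 e dim he m n k ∈ truncationGrading 𝓜 m n (dim k) :=
  ⟨⟨e k, mem_degreeGE 𝓜 k.2.1 (he k)⟩, he k, rfl⟩

theorem truncationBasis_mem (k : CellsBetween dim m n) :
    truncationBasis h𝓜 e dim he m n k ∈ truncationGrading 𝓜 m n (dim k) := by
  rw [coe_truncationBasis]
  exact truncationVec_mem e dim he m n k

theorem isGradedSteenrodModule_truncationGrading :
    IsGradedSteenrodModule (truncationGrading 𝓜 m n) where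
  isInternal := by
    refine isInternal_of_basis (truncationBasis h𝓜 e dim he m n) (fun k => dim k)
      (truncationBasis_mem h𝓜 e dim he m n) fun p x hx k hk => ?_
    obtain ⟨u, hu, rfl⟩ := hx
    have := truncationBasis_repr h𝓜 e dim he m n u k
    exact repr_ne_zero_of_mem e dim h𝓜.isInternal he hu (this ▸ hk)
  sq_smul_mem i p x hx := by
    obtain ⟨u, hu, rfl⟩ := hx
    exact ⟨Sq i • u, h𝓜.sq_smul_mem i p u.1 hu, rfl⟩

variable (F : GradedFreeResolution.{v, w} trivialGrading) (t : ℤ)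
  [∀ i, Finite (TensorIndex dim F t i)]
  [∀ i, Finite (TensorIndex (fun k : CellsBetween dim m n => dim k) F t i)]

/-- The basis of the `e_k ⊗ r_{i,j}` for the truncation. -/
abbrev truncationHomBasis (i : ℕ) :
    Basis (TensorIndex (fun k : CellsBetween dim m n => dim k) F t i) (ZMod 2)
      (diagonalHom (truncationGrading 𝓜 m n) F t i) :=
  diagonalHomBasis (isGradedSteenrodModule_truncationGrading h𝓜 e dim he m n)
    (truncationBasis h𝓜 e dim he m n) (fun k => dim k)
    (truncationBasis_mem h𝓜 e dim he m n) F t i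

omit [∀ i, Finite (TensorIndex dim F t i)] in
theorem truncationHomBasis_repr (i : ℕ) (f : diagonalHom (truncationGrading 𝓜 m n) F t i)
    (x : TensorIndex (fun k : CellsBetween dim m n => dim k) F t i) :
    (truncationHomBasis h𝓜 e dim he m n F t i).repr f x =
      f.1 (truncationVec 𝓜 e dim he m n (ofLex x.1).1 ⊗ₜ F.gen i (ofLex x.1).2) := by
  rw [← coe_truncationBasis h𝓜]
  exact diagonalHomBasis_repr _ _ _ _ _ _ _ _ _

omit [∀ i, Finite (TensorIndex dim F t i)] in
theorem isDualBasis_truncationHomBasis :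
    IsDualBasis (truncationVec 𝓜 e dim he m n) (fun k : CellsBetween dim m n => dim k)
      (truncationHomBasis h𝓜 e dim he m n F t) := by
  rw [← coe_truncationBasis h𝓜]
  exact isDualBasis_diagonalHomBasis _ _ _ _ _ _

/-- Coordinates are values on the `e_k ⊗ r_j`, so the coordinate condition is agreement on `M^{≥ m}`
tensored with generators; conjugation extends this to all of `F_i`. Cells with `n < dim k < m`,
which can occur for an empty range, are invisible to `M^{≥ m}` and so must stay unconstrained. -/
theorem truncatesTo_iff (i : ℕ) (f : diagonalHom 𝓜 F t i)
    (f' : diagonalHom (truncationGrading 𝓜 m n) F t i) :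
    TruncatesTo (diagonalHomBasis h𝓜 e dim he F t i) (truncationHomBasis h𝓜 e dim he m n F t i)
      TensorIndex.incl (fun y => dim (ofLex y.1).1) m n f f' ↔
      ∀ (u : degreeGE 𝓜 m) (y : F.obj i), f.1 (u.1 ⊗ₜ y) = f'.1 (truncationProj 𝓜 m n u ⊗ₜ y) := by
  constructor
  · rintro ⟨h1, h2⟩ u y
    induction y using basis_induction_on (F.gen i) generalizing u with
    | zero => simp
    | add y z hy hz => rw [TensorProduct.tmul_add, TensorProduct.tmul_add, map_add, map_add, hy, hz]
    | smul a y hy =>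
      -- The same `a'` works for `M` and for the truncation. Since `M^{≥ m}` is an `𝒜`-submodule,
      -- the induction hypothesis applies to `a' • u`.
      obtain ⟨a', ha'⟩ := exists_conj_smul a
      rw [ha' f.1 f.2.1, ha' f'.1 f'.2.1]
      exact hy (a' • u)
    | basis j =>
      have := degreeGE_eq_top (m := m) h𝓜 he (LinearMap.eqLocus
        (f.1 ∘ₗ (TensorProduct.mk (ZMod 2) M (F.obj i)).flip (F.gen i j) ∘ₗ
          (degreeGE 𝓜 m).subtype.restrictScalars (ZMod 2))
        (f'.1 ∘ₗ (TensorProduct.mk (ZMod 2) (Truncation 𝓜 m n) (F.obj i)).flip (F.gen i j) ∘ₗ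
          truncationProj 𝓜 m n)) fun k hk => by
          change f.1 (e k ⊗ₜ F.gen i j) = f'.1 (truncationProj 𝓜 m n
            ⟨e k, mem_degreeGE 𝓜 hk (he k)⟩ ⊗ₜ F.gen i j)
          by_cases hn : dim k ≤ n
          · by_cases ht : dim k + F.deg i j = t
            · have := h1 ⟨toLex (⟨k, hk, hn⟩, j), ht⟩
              rw [truncationHomBasis_repr, diagonalHomBasis_repr] at this
              exact this.symm
            · rw [f.2.2 _ _ ht _ (he k) _ (F.gen_mem i j)]
              exact (f'.2.2 _ _ ht _ (truncationVec_mem e dim he m n ⟨k, hk, hn⟩) _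
                (F.gen_mem i j)).symm
          · rw [truncationProj_of_lt e dim he m n hk (not_le.1 hn), TensorProduct.zero_tmul,
              map_zero]
            by_cases ht : dim k + F.deg i j = t
            · have := h2 ⟨toLex (k, j), ht⟩ hk (not_le.1 hn)
              rwa [diagonalHomBasis_repr] at this
            · exact f.2.2 _ _ ht _ (he k) _ (F.gen_mem i j)
      have hu : u ∈ (⊤ : Submodule (ZMod 2) (degreeGE 𝓜 m)) := trivial
      rw [← this] at hu
      exact hu
  · intro h
    refine ⟨fun x => ?_, fun y hm hn => ?_⟩
    · rw [truncationHomBasis_repr, diagonalHomBasis_repr]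
      exact (h ⟨e _, mem_degreeGE 𝓜 (ofLex x.1).1.2.1 (he _)⟩ _).symm
    · rw [diagonalHomBasis_repr]
      refine (h ⟨e _, mem_degreeGE 𝓜 hm (he _)⟩ _).trans ?_
      rw [truncationProj_of_lt e dim he m n hm hn, TensorProduct.zero_tmul, map_zero]

omit h𝓜 he [∀ i, Finite (TensorIndex dim F t i)]
  [∀ i, Finite (TensorIndex (fun k : CellsBetween dim m n => dim k) F t i)] in
theorem diagonalHomD_tmul (i : ℕ) (f : diagonalHom 𝓜 F t i) (x : M) (y : F.obj (i + 1)) :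
    (diagonalHomD 𝓜 F t i f).1 (x ⊗ₜ y) = f.1 (x ⊗ₜ F.d i y) := rfl

omit h𝓜 he [∀ i, Finite (TensorIndex dim F t i)]
  [∀ i, Finite (TensorIndex (fun k : CellsBetween dim m n => dim k) F t i)] in
theorem diagonalHomD_diagonalHomD (i : ℕ) (f : diagonalHom 𝓜 F t i) :
    diagonalHomD 𝓜 F t (i + 1) (diagonalHomD 𝓜 F t i f) = 0 := by
  refine Subtype.ext (TensorProduct.ext' fun x y => ?_)
  rw [diagonalHomD_tmul, diagonalHomD_tmul, (F.exact i _).2 ⟨y, rfl⟩, TensorProduct.tmul_zero,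
    map_zero]
  rfl

/-- In the form given by `truncatesTo_iff` this is immediate, as the differential touches only the
factor `F_i`. -/
theorem truncatesTo_diagonalHomD (i : ℕ) (f : diagonalHom 𝓜 F t i)
    (f' : diagonalHom (truncationGrading 𝓜 m n) F t i)
    (h : TruncatesTo (diagonalHomBasis h𝓜 e dim he F t i)
      (truncationHomBasis h𝓜 e dim he m n F t i)
      TensorIndex.incl (fun y => dim (ofLex y.1).1) m n f f') :
    TruncatesTo (diagonalHomBasis h𝓜 e dim he F t (i + 1))
      (truncationHomBasis h𝓜 e dim he m n F t (i + 1))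
      TensorIndex.incl (fun y => dim (ofLex y.1).1) m n (diagonalHomD 𝓜 F t i f)
      (diagonalHomD (truncationGrading 𝓜 m n) F t i f') := by
  rw [truncatesTo_iff] at h ⊢
  intro u y
  rw [diagonalHomD_tmul, diagonalHomD_tmul, h]

end Truncation

/-! ### Order properties of the inclusion of indices -/

section TensorIndex

variable {κ : Type*} [LinearOrder κ] {dim : κ → ℤ} {m n : ℤ}
  {L : Type*} [AddCommGroup L] [Module (ZMod 2) L] [Module SteenrodAlgebra L]
  {𝓛 : ℤ → Submodule (ZMod 2) L} {F : GradedFreeResolution.{v, w} 𝓛}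
  [∀ i, LinearOrder (F.idx i)] {t : ℤ} {i : ℕ}

theorem TensorIndex.strictMono_incl : StrictMono
    (TensorIndex.incl : TensorIndex (fun k : CellsBetween dim m n => dim k) F t i → _) := by
  intro x y hxy
  rw [← Subtype.coe_lt_coe, Prod.Lex.lt_iff] at hxy ⊢
  rcases hxy with h | ⟨h, h'⟩
  · exact Or.inl h
  · exact Or.inr ⟨congrArg Subtype.val h, h'⟩

theorem TensorIndex.monotone_dim (hdim : Monotone dim) :
    Monotone fun y : TensorIndex dim F t i => dim (ofLex y.1).1 := by
  intro x y hxy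
  rw [← Subtype.coe_le_coe, Prod.Lex.le_iff] at hxy
  rcases hxy with h | ⟨h, -⟩
  · exact hdim h.le
  · exact (congrArg dim h).le

omit [LinearOrder κ] [∀ i, LinearOrder (F.idx i)] in
theorem TensorIndex.mem_range_incl (y : TensorIndex dim F t i) :
    y ∈ Set.range (TensorIndex.incl :
      TensorIndex (fun k : CellsBetween dim m n => dim k) F t i → _) ↔
      m ≤ dim (ofLex y.1).1 ∧ dim (ofLex y.1).1 ≤ n := by
  constructor
  · rintro ⟨x, rfl⟩
    exact (ofLex x.1).1.2
  · intro h
    exact ⟨⟨toLex (⟨(ofLex y.1).1, h⟩, (ofLex y.1).2), y.2⟩, rfl⟩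

omit [LinearOrder κ] [∀ i, LinearOrder (F.idx i)] in
theorem CurtisItem.Mentions.incl {s : ℕ}
    {a : TensorIndex (fun k : CellsBetween dim m n => dim k) F t (i + 1)}
    {b : TensorIndex (fun k : CellsBetween dim m n => dim k) F t i}
    {x : TensorIndex (fun k : CellsBetween dim m n => dim k) F t s}
    (h : CurtisItem.Mentions (ι := TensorIndex (fun k : CellsBetween dim m n => dim k) F t)
      (CurtisItem.tag a b) ⟨s, x⟩) :
    CurtisItem.Mentions (ι := TensorIndex dim F t) (CurtisItem.tag a.incl b.incl)
      ⟨s, x.incl⟩ := by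
  rcases h with h | h
  · cases h
    exact Or.inl rfl
  · cases h
    exact Or.inr rfl

end TensorIndex

end

/-! ### The main theorem -/

theorem mainTheorem5
    {M : Type*} [AddCommGroup M] [Module (ZMod 2) M] [Module SteenrodAlgebra M]
    [IsScalarTower (ZMod 2) SteenrodAlgebra M]
    (𝓜 : ℤ → Submodule (ZMod 2) M) (h𝓜 : IsGradedSteenrodModule 𝓜)
    {κ : Type*} [Finite κ] [LinearOrder κ]
    (e : Module.Basis κ (ZMod 2) M) (dim : κ → ℤ) (he : ∀ k, e k ∈ 𝓜 (dim k))
    (hdim : Monotone dim)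
    (F : GradedFreeResolution trivialGrading) [∀ i, LinearOrder (F.idx i)]
    (hF : ∀ (i : ℕ) (q : ℤ), {j : F.idx i | F.deg i j = q}.Finite)
    (m n t : ℤ) :
    ∃ (B : ∀ i, Module.Basis (TensorIndex dim F t i) (ZMod 2) (diagonalHom 𝓜 F t i))
      (B' : ∀ i, Module.Basis (TensorIndex (fun k : CellsBetween dim m n => dim k) F t i) (ZMod 2)
        (diagonalHom (truncationGrading 𝓜 m n) F t i)),
      IsDualBasis e dim B ∧
      IsDualBasis (truncationVec 𝓜 e dim he m n) (fun k : CellsBetween dim m n => dim k) B' ∧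
      (∃! T, IsDiagonalCurtisTable B T) ∧
      (∃! T', IsDiagonalCurtisTable B' T') ∧
      ∀ T T', IsDiagonalCurtisTable B T →
        IsDiagonalCurtisTable B' T' →
        -- the tags of the truncation are the tags of `T` that lie in the range
        (∀ (i : ℕ) (a : TensorIndex (fun k : CellsBetween dim m n => dim k) F t (i + 1))
            (b : TensorIndex (fun k : CellsBetween dim m n => dim k) F t i),
          CurtisItem.tag a b ∈ T' (i + 1) ↔ CurtisItem.tag a.incl b.incl ∈ T (i + 1)) ∧
        -- its untagged items are the items in the range that appear in no surviving tag
        (∀ (s : ℕ) (x : TensorIndex (fun k : CellsBetween dim m n => dim k) F t s),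
          CurtisItem.single x ∈ T' s ↔ NotInSurvivingTag T x) ∧
        -- these include the untagged items of `T` in the range
        (∀ (s : ℕ) (x : TensorIndex (fun k : CellsBetween dim m n => dim k) F t s),
          CurtisItem.single x.incl ∈ T s → CurtisItem.single x ∈ T' s) ∧
        -- cocycles led by these items represent a basis of the cohomology of the complex
        (∀ (s : ℕ) (z : {x : TensorIndex (fun k : CellsBetween dim m n => dim k) F t s //
              NotInSurvivingTag T x} →
              DiagonalCocycles (truncationGrading 𝓜 m n) F t s),
          (∀ x, IsLeadingTerm (B' s) (z x).1 x.1) →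
          ∃ b : Module.Basis {x : TensorIndex (fun k : CellsBetween dim m n => dim k) F t s //
              NotInSurvivingTag T x} (ZMod 2)
              (DiagonalCohomology (truncationGrading 𝓜 m n) F t s),
            ∀ x, b x = cohomologyClass (X := fun i => ↥(diagonalHom (truncationGrading 𝓜 m n) F t i))
              (diagonalHomD (truncationGrading 𝓜 m n) F t) s (z x)) ∧
        -- and they count a basis of the Adams `E_2`-term `Ext^{s,t}` of the truncation
        (∀ (P : GradedFreeResolution (truncationGrading 𝓜 m n)) (s : ℕ),
          Nonempty (SteenrodExt P s t ≃ₗ[ZMod 2]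
            ({x : TensorIndex (fun k : CellsBetween dim m n => dim k) F t s //
              NotInSurvivingTag T x} →₀ ZMod 2))) := by
  have hfin : ∀ i, Finite (TensorIndex dim F t i) := finite_tensorIndex dim F t hF
  have hfin' : ∀ i, Finite (TensorIndex (fun k : CellsBetween dim m n => dim k) F t i) :=
    finite_tensorIndex _ F t hF
  have hN := isGradedSteenrodModule_truncationGrading h𝓜 e dim he m n
  have hd := diagonalHomD_diagonalHomD (𝓜 := 𝓜) F t
  have hd' := diagonalHomD_diagonalHomD (𝓜 := truncationGrading 𝓜 m n) F t
  refine ⟨diagonalHomBasis h𝓜 e dim he F t, truncationHomBasis h𝓜 e dim he m n F t,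
    isDualBasis_diagonalHomBasis h𝓜 e dim he F t,
    isDualBasis_truncationHomBasis h𝓜 e dim he m n F t, existsUnique_isCurtisTable hd,
    existsUnique_isCurtisTable hd', fun T T' hT hT' => ?_⟩
  have htag : ∀ (i : ℕ) (a : TensorIndex (fun k : CellsBetween dim m n => dim k) F t (i + 1))
      (b : TensorIndex (fun k : CellsBetween dim m n => dim k) F t i),
      CurtisItem.tag a b ∈ T' (i + 1) ↔ CurtisItem.tag a.incl b.incl ∈ T (i + 1) := by
    intro i a b
    rw [hT.tag_iff, hT'.tag_iff]
    exact isTag_truncation_iff TensorIndex.strictMono_incl (TensorIndex.monotone_dim hdim)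
      TensorIndex.mem_range_incl TensorIndex.strictMono_incl (TensorIndex.monotone_dim hdim)
      TensorIndex.mem_range_incl (truncatesTo_diagonalHomD h𝓜 e dim he m n F t i) a b
  have hsingle : ∀ (s : ℕ) (x : TensorIndex (fun k : CellsBetween dim m n => dim k) F t s),
      CurtisItem.single x ∈ T' s ↔ NotInSurvivingTag T x := by
    intro s x
    rw [hT'.single_iff_not_mentions]
    simp only [htag, NotInSurvivingTag]
  have hS : ∀ (s : ℕ) (x : TensorIndex (fun k : CellsBetween dim m n => dim k) F t s),
      NotInSurvivingTag T x ↔ IsCohomologyLeadingTerm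
        (X := fun i => ↥(diagonalHom (truncationGrading 𝓜 m n) F t i))
        (diagonalHomD (truncationGrading 𝓜 m n) F t) (truncationHomBasis h𝓜 e dim he m n F t) s x :=
    fun s x => (hsingle s x).symm.trans (hT'.single_iff x)
  refine ⟨htag, hsingle, fun s x hx => ?_, fun s z hz => ?_, fun P s => ?_⟩
  · rw [hsingle]
    rintro ⟨i, a, b, hab, hm⟩
    exact (hT.single_iff_not_mentions x.incl).1 hx ⟨i, a.incl, b.incl, hab, hm.incl⟩
  · exact exists_basis_cohomology hd' s (hS s) z hz
  -- Every untagged item leads some cocycle, so representatives exist and the basis statement can be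
  -- applied to them.
  · choose z hz hzx using fun x : {x : TensorIndex (fun k : CellsBetween dim m n => dim k) F t s //
      NotInSurvivingTag T x} => ((hS s x.1).1 x.2).1
    obtain ⟨b, -⟩ := exists_basis_cohomology hd' s (hS s) (fun x => ⟨z x, hz x⟩) hzx
    obtain ⟨f⟩ := nonempty_steenrodExt_equiv_diagonalCohomology hN
      (truncationBasis h𝓜 e dim he m n) (fun k : CellsBetween dim m n => dim k)
      (truncationBasis_mem h𝓜 e dim he m n) F t P s
    exact ⟨f.trans b.repr⟩
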